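/- Let $k$ be an algebraically closed field of characteristic zero and let $B=\mathcal{O}(SL_2(k))=k[x,y,z,w]/(xw-yz-1)$, where $x,y,z,w$ are the entries of the generic matrix $M=\begin{pmatrix} x&y\\ z&w\end{pmatrix}$. Let $\upsilon$ be the $k$-derivation of $B$ with $\upsilon x=z$, $\upsilon y=w$, $\upsilon z=\upsilon w=0$ (the infinitesimal left action of the matrices $\begin{pmatrix}1&t\\0&1\end{pmatrix}$). For a binary form $f\in k[x,y]\subset B$ of degree $d$, let $\widehat f\subset B$ be the $k$-span of $f,\upsilon f,\dots,\upsilon^d f$, and let $k[\widehat{f_1},\dots,\widehat{f_r}]$ be the $k$-subalgebra of $B$ generated by $\widehat{f_1}\cup\dots\cup\widehat{f_r}$. For a subgroup $H\le SL_2(k)$, let $B^H$ be the ring of invariants for the action by right multiplication ($h\in H$ sends the entries of $M$ to those of $Mh$). Put $\mathbf{j}=\begin{pmatrix}0&1\\-1&0\end{pmatrix}$ and $\psi_n=\begin{pmatrix}\zeta_n&0\\0&\zeta_n^{-1}\end{pmatrix}$, where $\zeta_n\in k$ is any primitive $n$-th root of unity; let $i\in k$ be any primitive fourth root of unity, put $\mathbf{i}=\begin{pmatrix}i&0\\0&-i\end{pmatrix}$,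 $\mathbf{k}=\begin{pmatrix}0&i\\i&0\end{pmatrix}$, $\sigma=\tfrac12(I+\mathbf{i}+\mathbf{j}+\mathbf{k})$, and $$\kappa=\tfrac1{\sqrt5}\begin{pmatrix}\zeta_5^4-\zeta_5&\zeta_5^2-\zeta_5^3\\ \zeta_5^2-\zeta_5^3&\zeta_5-\zeta_5^4\end{pmatrix}$$ for either square root $\sqrt5\in k$. Define the subgroups $\mathbb{Z}_n=\langle\psi_n\rangle$ $(n\ge2)$, $\mathrm{BD}_{4n}=\langle\psi_{2n},\mathbf{j}\rangle$ $(n\ge 2)$ with $\mathrm{BD}_8=\langle \mathbf{i},\mathbf{j}\rangle$, $\mathrm{BT}_{24}=\langle\mathrm{BD}_8,\sigma^2\rangle$, $\mathrm{BO}_{48}=\langle\mathrm{BT}_{24},\psi_8\rangle$ and $\mathrm{BI}_{120}=\langle\psi_5,\kappa,\mathbf{j}\rangle$ of $SL_2(k)$. Then: (a) $B^{\mathbb{Z}_n}=k[\widehat{x^n+y^n},\widehat{xy}]$ for all $n\ge2$. (b) $B^{\mathbb{Z}_n}=k[\widehat{x^n+y^n}]$ for all odd $n\ge3$. (c) $B^{\mathbb{Z}_{2n}}=k[\widehat{f_n}]$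 for all odd $n\ge3$, where $f_n=x^{2n}+(xy)^n+y^{2n}$. (d) $B^{\mathrm{BD}_{4n}}=k[\widehat{x^{2n}+y^{2n}}]$ for all $n\ge2$. (e) $B^{\mathrm{BT}_{24}}=k[\widehat{xy(x^4-y^4)}]$. (f) $B^{\mathrm{BO}_{48}}=k[\widehat{v_1}]$, where $v_1=x^8+14x^4y^4+y^8$. (g) $B^{\mathrm{BI}_{120}}=k[\widehat{w_1}]$, where $w_1=xy(x^{10}+11x^5y^5-y^{10})$. Moreover, $B^{\mathrm{BI}_{120}}$ is a unique factorization domain. -/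

import Mathlib

namespace SLTwo

open Matrix

noncomputable section

variable (k : Type*) [Field k]

/-- The ideal of `SL₂` in the polynomial ring in the four entries of a `2 × 2` matrix. -/
def detIdeal : Ideal (MvPolynomial (Fin 2 × Fin 2) k) :=
  Ideal.span {(Matrix.mvPolynomialX (Fin 2) (Fin 2) k).det - 1}

/-- The coordinate ring `B = k[x, y, z, w] / (x w - y z - 1)` of `SL₂(k)`. -/
abbrev B : Type _ := MvPolynomial (Fin 2 × Fin 2) k ⧸ detIdeal k

/-- The generic matrix `(x, y; z, w)` over `B`. -/
def generic : Matrix (Fin 2) (Fin 2) (B k) :=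
  Matrix.of fun i j => Ideal.Quotient.mkₐ k (detIdeal k) (MvPolynomial.X (i, j))

/-- The coordinate function `x` (upper left entry). -/
def x : B k := generic k 0 0

/-- The coordinate function `y` (upper right entry). -/
def y : B k := generic k 0 1

/-- The coordinate function `z` (lower left entry). -/
def z : B k := generic k 1 0

/-- The coordinate function `w` (lower right entry). -/
def w : B k := generic k 1 1

lemma generic_det : (generic k).det = 1 := by
  have h : (Ideal.Quotient.mkₐ k (detIdeal k))
      ((Matrix.mvPolynomialX (Fin 2) (Fin 2) k).det - 1) = 0 :=
    Ideal.Quotient.eq_zero_iff_mem.2 (Ideal.subset_span rfl)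
  rw [map_sub, map_one, sub_eq_zero, AlgHom.map_det] at h
  exact h

variable {k}

lemma rightMul_aux (h : Matrix.SpecialLinearGroup (Fin 2) k)
    (p : MvPolynomial (Fin 2 × Fin 2) k) (hp : p ∈ detIdeal k) :
    MvPolynomial.aeval (fun e : Fin 2 × Fin 2 =>
      (generic k * (h : Matrix (Fin 2) (Fin 2) k).map (algebraMap k (B k))) e.1 e.2) p = 0 := by
  suffices hle : detIdeal k ≤ RingHom.ker (MvPolynomial.aeval (fun e : Fin 2 × Fin 2 =>
      (generic k * (h : Matrix (Fin 2) (Fin 2) k).map (algebraMap k (B k))) e.1 e.2)) from hle hp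
  refine Ideal.span_le.2 (Set.singleton_subset_iff.2 (RingHom.mem_ker.2 ?_))
  rw [map_sub, map_one, AlgHom.map_det]
  have e : (MvPolynomial.aeval (fun e : Fin 2 × Fin 2 =>
      (generic k * (h : Matrix (Fin 2) (Fin 2) k).map (algebraMap k (B k))) e.1 e.2)).mapMatrix
        (Matrix.mvPolynomialX (Fin 2) (Fin 2) k) =
      generic k * (h : Matrix (Fin 2) (Fin 2) k).map (algebraMap k (B k)) := by
    ext i j
    simp [Matrix.mvPolynomialX]
  have hd : ((h : Matrix (Fin 2) (Fin 2) k).map (algebraMap k (B k))).det = 1 := by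
    have := (RingHom.map_det (algebraMap k (B k)) (h : Matrix (Fin 2) (Fin 2) k)).symm
    rw [h.2, map_one] at this
    exact this
  rw [e, Matrix.det_mul, generic_det, hd, one_mul, sub_self]

/-- The algebra endomorphism of `B` induced by right multiplication `g ↦ g h` on `SL₂(k)`: it
sends each entry of the generic matrix `M` to the corresponding entry of `M h`. -/
def rightMul (h : Matrix.SpecialLinearGroup (Fin 2) k) : B k →ₐ[k] B k :=
  Ideal.Quotient.liftₐ (detIdeal k) (MvPolynomial.aeval (fun e : Fin 2 × Fin 2 =>
    (generic k * (h : Matrix (Fin 2) (Fin 2) k).map (algebraMap k (B k))) e.1 e.2))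
    (rightMul_aux h)

/-- The ring of invariants `B^H` for the right multiplication action of `H ≤ SL₂(k)`. -/
def invariants (H : Subgroup (Matrix.SpecialLinearGroup (Fin 2) k)) : Subalgebra k (B k) where
  carrier := {b | ∀ h ∈ H, rightMul h b = b}
  mul_mem' ha hb h hh := by rw [map_mul, ha h hh, hb h hh]
  add_mem' ha hb h hh := by rw [map_add, ha h hh, hb h hh]
  algebraMap_mem' r h _ := AlgHom.commutes (rightMul h) r

/-- The derivation `x ↦ z, y ↦ w, z ↦ 0, w ↦ 0` of the polynomial ring in `x, y, z, w`. -/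
def polyUpsilon :
    Derivation k (MvPolynomial (Fin 2 × Fin 2) k) (MvPolynomial (Fin 2 × Fin 2) k) :=
  MvPolynomial.mkDerivation k fun e => if e.1 = 0 then MvPolynomial.X (1, e.2) else 0

lemma polyUpsilon_aux (p : MvPolynomial (Fin 2 × Fin 2) k)
    (hp : Ideal.Quotient.mkₐ k (detIdeal k) p = 0) :
    Ideal.Quotient.mkₐ k (detIdeal k) (polyUpsilon p) = 0 := by
  have h0 : polyUpsilon ((Matrix.mvPolynomialX (Fin 2) (Fin 2) k).det - 1) = 0 := by
    simp [Matrix.det_fin_two, Matrix.mvPolynomialX, polyUpsilon, Derivation.leibniz,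
      MvPolynomial.mkDerivation_X]
    ring
  have hp' : p ∈ detIdeal k := Ideal.Quotient.eq_zero_iff_mem.1 hp
  obtain ⟨q, rfl⟩ := Ideal.mem_span_singleton'.1 hp'
  rw [Derivation.leibniz, h0, smul_zero, zero_add, smul_eq_mul]
  exact Ideal.Quotient.eq_zero_iff_mem.2
    (Ideal.mul_mem_right _ _ (Ideal.subset_span rfl))

/-- The locally nilpotent derivation `υ` of `B` with `υ x = z`, `υ y = w`, `υ z = υ w = 0`: the
infinitesimal left action of the unipotent one-parameter subgroup `(1, t; 0, 1)`. -/
def upsilon : Derivation k (B k) (B k) :=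
  Derivation.liftOfSurjective (f := Ideal.Quotient.mkₐ k (detIdeal k))
    (Ideal.Quotient.mkₐ_surjective k (detIdeal k)) (d := polyUpsilon) polyUpsilon_aux

lemma upsilon_x : upsilon (x k) = z k := by
  refine (Derivation.liftOfSurjective_apply _ polyUpsilon_aux _).trans ?_
  simp [polyUpsilon, z, generic]

lemma upsilon_y : upsilon (y k) = w k := by
  refine (Derivation.liftOfSurjective_apply _ polyUpsilon_aux _).trans ?_
  simp [polyUpsilon, w, generic]

lemma upsilon_z : upsilon (z k) = 0 := by
  refine (Derivation.liftOfSurjective_apply _ polyUpsilon_aux _).trans ?_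
  simp [polyUpsilon]

lemma upsilon_w : upsilon (w k) = 0 := by
  refine (Derivation.liftOfSurjective_apply _ polyUpsilon_aux _).trans ?_
  simp [polyUpsilon]

/-- For a binary form `f` of degree `d` in `x, y`, the space `f^` spanned by `υ^j f`,
`0 ≤ j ≤ d`: the simple `SL₂`-submodule of `B` generated by `f`. -/
def hat (d : ℕ) (f : B k) : Submodule k (B k) :=
  Submodule.span k {b | ∃ j ≤ d, b = upsilon^[j] f}

/-- The diagonal matrix with entries `ζ, ζ⁻¹`. -/
def psi (ζ : kˣ) : Matrix.SpecialLinearGroup (Fin 2) k :=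
  ⟨!![(ζ : k), 0; 0, ((ζ⁻¹ : kˣ) : k)], by simp [Matrix.det_fin_two]⟩

/-- The matrix `(0, 1; -1, 0)`. -/
def quatJ : Matrix.SpecialLinearGroup (Fin 2) k :=
  ⟨!![0, 1; -1, 0], by simp [Matrix.det_fin_two]⟩

lemma sigma_det [CharZero k] (i : kˣ) (hi : IsPrimitiveRoot i 4) :
    (((1 : k) / 2) • ((1 : Matrix (Fin 2) (Fin 2) k) + !![(i : k), 0; 0, -(i : k)] +
      !![0, 1; -1, 0] + !![0, (i : k); (i : k), 0])).det = 1 := by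
  have h2 : (i : k) ^ 2 = -1 := by
    have h := (hi.map_of_injective (f := Units.coeHom k) Units.val_injective)
    have h4 : ((i : k) ^ 2 - 1) * ((i : k) ^ 2 + 1) = 0 := by
      have := h.pow_eq_one
      simp only [Units.coeHom_apply] at this
      linear_combination this
    rcases mul_eq_zero.1 h4 with h' | h'
    · exact absurd (sub_eq_zero.1 h') (h.pow_ne_one_of_pos_of_lt (by norm_num) (by norm_num))
    · exact eq_neg_of_add_eq_zero_left h'
  simp [Matrix.det_fin_two]
  linear_combination (-(1 : k) / 2) * h2

/-- The matrix `σ = (1 + 𝐢 + 𝐣 + 𝐤) / 2`, where `i` is a square root of `-1` in `k` and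
`𝐢 = (i, 0; 0, -i)`, `𝐣 = (0, 1; -1, 0)`, `𝐤 = (0, i; i, 0)`. -/
def sigma [CharZero k] (i : kˣ) (hi : IsPrimitiveRoot i 4) :
    Matrix.SpecialLinearGroup (Fin 2) k :=
  ⟨((1 : k) / 2) • (1 + !![(i : k), 0; 0, -(i : k)] + !![0, 1; -1, 0] + !![0, (i : k); (i : k), 0]),
    sigma_det i hi⟩

lemma kappa_det [CharZero k] (ζ : kˣ) (hζ : IsPrimitiveRoot ζ 5) (s : k) (hs : s ^ 2 = 5) :
    (s⁻¹ • !![(ζ : k) ^ 4 - ζ, (ζ : k) ^ 2 - (ζ : k) ^ 3;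
      (ζ : k) ^ 2 - (ζ : k) ^ 3, (ζ : k) - (ζ : k) ^ 4]).det = 1 := by
  have h := (hζ.map_of_injective (f := Units.coeHom k) Units.val_injective)
  have hsum : (1 : k) + ζ + (ζ : k) ^ 2 + (ζ : k) ^ 3 + (ζ : k) ^ 4 = 0 := by
    simpa [Finset.sum_range_succ] using h.geom_sum_eq_zero (by norm_num)
  have h5 : (ζ : k) ^ 5 = 1 := by simpa using h.pow_eq_one
  have hs0 : s ≠ 0 := by
    rintro rfl
    norm_num at hs
  have key : ((ζ : k) ^ 4 - ζ) * (ζ - (ζ : k) ^ 4) -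
      ((ζ : k) ^ 2 - (ζ : k) ^ 3) * ((ζ : k) ^ 2 - (ζ : k) ^ 3) = 5 := by
    linear_combination (-(ζ : k) ^ 3 + 4 - ζ) * h5 - hsum
  rw [Matrix.det_smul, Matrix.det_fin_two_of, key, Fintype.card_fin, inv_pow, hs]
  exact inv_mul_cancel₀ (by norm_num)

/-- The matrix `κ`, where `s` is a square root of `5` and `ζ` a primitive fifth root of unity. -/
def kappa [CharZero k] (ζ : kˣ) (hζ : IsPrimitiveRoot ζ 5) (s : k) (hs : s ^ 2 = 5) :
    Matrix.SpecialLinearGroup (Fin 2) k :=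
  ⟨s⁻¹ • !![(ζ : k) ^ 4 - ζ, (ζ : k) ^ 2 - (ζ : k) ^ 3;
    (ζ : k) ^ 2 - (ζ : k) ^ 3, (ζ : k) - (ζ : k) ^ 4], kappa_det ζ hζ s hs⟩

/-- For `ζ` of order `n`, the cyclic group `ℤ_n = ⟨ψ_n⟩`. -/
def cyclic (ζ : kˣ) : Subgroup (Matrix.SpecialLinearGroup (Fin 2) k) :=
  Subgroup.closure {psi ζ}

/-- For `ζ` of order `2 n`, the binary dihedral group `BD_{4n} = ⟨ψ_{2n}, 𝐣⟩`. -/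
def binaryDihedral (ζ : kˣ) : Subgroup (Matrix.SpecialLinearGroup (Fin 2) k) :=
  Subgroup.closure {psi ζ, quatJ}

/-- The binary tetrahedral group `BT_24 = ⟨BD_8, σ²⟩`. -/
def binaryTetrahedral [CharZero k] (i : kˣ) (hi : IsPrimitiveRoot i 4) :
    Subgroup (Matrix.SpecialLinearGroup (Fin 2) k) :=
  binaryDihedral i ⊔ Subgroup.closure {sigma i hi ^ 2}

/-- For `ζ` of order `8`, the binary octahedral group `BO_48 = ⟨BT_24, ψ_8⟩`. -/
def binaryOctahedral [CharZero k] (i : kˣ) (hi : IsPrimitiveRoot i 4) (ζ : kˣ) :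
    Subgroup (Matrix.SpecialLinearGroup (Fin 2) k) :=
  binaryTetrahedral i hi ⊔ Subgroup.closure {psi ζ}

/-- The binary icosahedral group `BI_120 = ⟨ψ_5, κ, 𝐣⟩`. -/
def binaryIcosahedral [CharZero k] (ζ : kˣ) (hζ : IsPrimitiveRoot ζ 5) (s : k)
    (hs : s ^ 2 = 5) : Subgroup (Matrix.SpecialLinearGroup (Fin 2) k) :=
  Subgroup.closure {psi ζ, kappa ζ hζ s hs, quatJ}

end

end SLTwo

/-! ### Row grading of the polynomial ring and homogeneous lifts of elements of `B` -/

namespace SLTwo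

noncomputable section

open MvPolynomial

variable {k : Type*} [Field k]

/-! The derivation `upsilon` comes from left multiplication on `SL₂`, the groups act by right
multiplication, and the two commute. Every ring of invariants is therefore `upsilon`-stable, and as
such it is determined by the invariant binary forms in the first row. The elementary reason is the
Capelli identity `capelli`: on bihomogeneous polynomials in the matrix entries, lowering after
raising, plus the determinant times Cayley's Omega, is a positive integer as soon as the second row
occurs. Raising and Omega commute with the right action and decrease the degree in the second row,
and the determinant is `1` in `B`, so induction on that degree gives `invariants_le_of_forms`.

It remains to show that an `upsilon`-stable subalgebra containing the given form contains all
invariant forms. Since `x w - y z = 1`, transvectants of forms in `x, y` are polynomials in their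
iterated derivatives under `upsilon`, so the subalgebra is closed under transvectants. For cyclic
and dihedral groups the invariant forms are spanned by (symmetrized) monomials, and suitable
transvectants of the given form with itself produce a power of `x y`, from which the monomials
follow. For the polyhedral groups Hessian and Jacobian give the classical forms attached to
vertices, faces and edges. An invariant form vanishing at `(0, 1)` is divisible by the product of
the linear forms in the orbit of `x`, which is the vertex form; any other becomes so after
subtracting a multiple of a product of face and edge forms (`mem_of_invariant_form`). The octahedral
group is treated as an extension of degree two of the tetrahedral one.

For factoriality, `B` is itself a unique factorization domain whose units are the constants, so an
element fixed up to units defines a character of the group. The binary icosahedral group has no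
nontrivial characters, and `uniqueFactorizationMonoid_of_fixed` applies. -/

/-- The degree in the entries of the second row. -/
def rowWeight (e : Fin 2 × Fin 2) : ℕ := e.1

/-- The determinant of the generic matrix in the polynomial ring. -/
def polyDet (k : Type*) [Field k] : MvPolynomial (Fin 2 × Fin 2) k :=
  X (0, 0) * X (1, 1) - X (0, 1) * X (1, 0)

lemma polyDet_eq : polyDet k = (Matrix.mvPolynomialX (Fin 2) (Fin 2) k).det := by
  simp [polyDet, Matrix.det_fin_two, Matrix.mvPolynomialX]

lemma mem_detIdeal {p : MvPolynomial (Fin 2 × Fin 2) k} :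
    p ∈ detIdeal k ↔ ∃ s, p = s * (polyDet k - 1) := by
  rw [detIdeal, Ideal.mem_span_singleton', ← polyDet_eq]
  simp [eq_comm]

/-- The quotient map onto the coordinate ring. -/
def toB (k : Type*) [Field k] : MvPolynomial (Fin 2 × Fin 2) k →ₐ[k] B k :=
  Ideal.Quotient.mkₐ k (detIdeal k)

lemma toB_surjective : Function.Surjective (toB k) := Ideal.Quotient.mkₐ_surjective _ _

lemma toB_eq_zero {p : MvPolynomial (Fin 2 × Fin 2) k} : toB k p = 0 ↔ p ∈ detIdeal k :=
  Ideal.Quotient.eq_zero_iff_mem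

lemma toB_polyDet : toB k (polyDet k) = 1 := by
  have : toB k (polyDet k - 1) = 0 := toB_eq_zero.2 (mem_detIdeal.2 ⟨1, by ring⟩)
  simpa [sub_eq_zero] using this

@[simp] lemma toB_X (e : Fin 2 × Fin 2) : toB k (X e) = generic k e.1 e.2 := rfl

lemma det_eq : x k * w k - y k * z k = 1 := by
  rw [← generic_det, Matrix.det_fin_two]; rfl

/-- Right multiplication by `h` on the polynomial ring in the matrix entries. -/
def polyMul (h : Matrix.SpecialLinearGroup (Fin 2) k) :
    MvPolynomial (Fin 2 × Fin 2) k →ₐ[k] MvPolynomial (Fin 2 × Fin 2) k :=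
  aeval fun e => X (e.1, 0) * C (h 0 e.2) + X (e.1, 1) * C (h 1 e.2)

lemma polyMul_X (h : Matrix.SpecialLinearGroup (Fin 2) k) (i j : Fin 2) :
    polyMul h (X (i, j)) = X (i, 0) * C (h 0 j) + X (i, 1) * C (h 1 j) := by
  simp [polyMul]

lemma rightMul_toB (h : Matrix.SpecialLinearGroup (Fin 2) k)
    (p : MvPolynomial (Fin 2 × Fin 2) k) : rightMul h (toB k p) = toB k (polyMul h p) := by
  suffices H : (rightMul h).comp (toB k) = (toB k).comp (polyMul h) from DFunLike.congr_fun H p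
  refine MvPolynomial.algHom_ext fun e => ?_
  rw [AlgHom.comp_apply, AlgHom.comp_apply, polyMul_X]
  refine (Ideal.Quotient.liftₐ_apply _ _ _ _).trans ?_
  refine (Ideal.Quotient.lift_mk _ _ _).trans ?_
  simp [Matrix.mul_apply, Fin.sum_univ_two, ← MvPolynomial.algebraMap_eq]

lemma isWeightedHomogeneous_polyDet : (polyDet k).IsWeightedHomogeneous rowWeight 1 := by
  refine .sub ?_ ?_
  · exact (isWeightedHomogeneous_X k rowWeight (0, 0)).mul (isWeightedHomogeneous_X k rowWeight (1, 1))
  · exact (isWeightedHomogeneous_X k rowWeight (0, 1)).mul (isWeightedHomogeneous_X k rowWeight (1, 0))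

lemma isHomogeneous_polyMul (h : Matrix.SpecialLinearGroup (Fin 2) k)
    {p : MvPolynomial (Fin 2 × Fin 2) k} {n : ℕ} (hp : p.IsHomogeneous n) :
    (polyMul h p).IsHomogeneous n := by
  have := hp.aeval (S := k) (n := 1)
    (fun e : Fin 2 × Fin 2 => (X (e.1, 0) * C (h 0 e.2) + X (e.1, 1) * C (h 1 e.2) :
      MvPolynomial (Fin 2 × Fin 2) k)) fun e =>
      ((isHomogeneous_X _ _).mul (isHomogeneous_C _ _)).add
        ((isHomogeneous_X _ _).mul (isHomogeneous_C _ _))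
  rwa [one_mul] at this

section WeightScale

variable {σ : Type*} {w : σ → ℕ}

/-- The algebra map multiplying each variable by the power of a new variable given by its weight. -/
def weightScale (k : Type*) [Field k] (w : σ → ℕ) :
    MvPolynomial σ k →ₐ[k] Polynomial (MvPolynomial σ k) :=
  aeval fun e => Polynomial.C (X e) * Polynomial.X ^ w e

lemma weightScale_of_isWeightedHomogeneous {p : MvPolynomial σ k} {n : ℕ}
    (hp : p.IsWeightedHomogeneous w n) :
    weightScale k w p = Polynomial.C p * Polynomial.X ^ n := by
  induction hp using IsWeightedHomogeneous.induction_on with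
  | zero => simp
  | add p q hp hq h1 h2 => rw [map_add, h1, h2, map_add, add_mul]
  | monomial d r hd =>
    rw [weightScale, aeval_monomial, monomial_eq (s := d), map_mul, ← hd, Finsupp.weight_apply, mul_assoc]
    congr 1
    rw [Finsupp.prod, Finsupp.prod, Finsupp.sum, map_prod, ← Finset.prod_pow_eq_pow_sum,
      ← Finset.prod_mul_distrib]
    refine Finset.prod_congr rfl fun e _ => ?_
    rw [mul_pow, map_pow, ← pow_mul, smul_eq_mul, mul_comm (w e)]

lemma eval_weightScale (p : MvPolynomial σ k) : (weightScale k w p).eval 1 = p := by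
  have : ((Polynomial.aeval (R := MvPolynomial σ k) 1).restrictScalars k).comp
      (weightScale k w) = AlgHom.id k _ := by
    refine MvPolynomial.algHom_ext fun e => ?_
    simp [weightScale]
  simpa [Polynomial.coe_aeval_eq_eval] using DFunLike.congr_fun this p

lemma weightScale_ne_zero {p : MvPolynomial σ k} (hp : p ≠ 0) : weightScale k w p ≠ 0 := by
  intro h
  apply hp
  rw [← eval_weightScale (w := w) p, h, Polynomial.eval_zero]

lemma coeff_weightScale (p : MvPolynomial σ k) (n : ℕ) :
    (weightScale k w p).coeff n = weightedHomogeneousComponent w n p := by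
  induction p using MvPolynomial.induction_on' with
  | monomial a b =>
    have hm := isWeightedHomogeneous_monomial w a b rfl
    rw [weightScale_of_isWeightedHomogeneous hm,
      weightedHomogeneousComponent_of_mem hm, Polynomial.coeff_C_mul, Polynomial.coeff_X_pow]
    simp
  | add p q hp hq => rw [map_add, map_add, Polynomial.coeff_add, hp, hq]

lemma isWeightedHomogeneous_of_weightScale {p : MvPolynomial σ k} {n : ℕ}
    (hp : weightScale k w p = Polynomial.C p * Polynomial.X ^ n) :
    p.IsWeightedHomogeneous w n := by
  have := coeff_weightScale (w := w) p n
  rw [hp] at this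
  have h2 : p = weightedHomogeneousComponent w n p := by simpa using this
  rw [h2]
  exact weightedHomogeneousComponent_isWeightedHomogeneous _ _

lemma isWeightedHomogeneous_of_natDegree_le {p : MvPolynomial σ k}
    (h : (weightScale k w p).natDegree ≤ (weightScale k w p).natTrailingDegree) :
    p.IsWeightedHomogeneous w (weightScale k w p).natDegree := by
  set P := weightScale k w p with hP
  have h1 : P = Polynomial.C (P.coeff P.natDegree) * Polynomial.X ^ P.natDegree := by
    ext1 n
    rw [Polynomial.coeff_C_mul, Polynomial.coeff_X_pow]
    rcases lt_trichotomy n P.natDegree with hn | rfl | hn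
    · rw [Polynomial.coeff_eq_zero_of_lt_natTrailingDegree (hn.trans_le h), if_neg hn.ne, mul_zero]
    · rw [if_pos rfl, mul_one]
    · rw [Polynomial.coeff_eq_zero_of_natDegree_lt hn, if_neg hn.ne', mul_zero]
  have h2 : P.coeff P.natDegree = p := by
    conv_rhs => rw [← eval_weightScale (w := w) p, ← hP, h1]
    simp
  apply isWeightedHomogeneous_of_weightScale
  rw [h2] at h1
  exact h1

/-- The lowest and the highest exponent of the weight variable are both additive over a domain; if
they agree for a product, they agree for each factor. -/
lemma isWeightedHomogeneous_of_mul {p q : MvPolynomial σ k} {n : ℕ}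
    (h : (p * q).IsWeightedHomogeneous w n) (hne : p * q ≠ 0) :
    ∃ i j, i + j = n ∧ p.IsWeightedHomogeneous w i ∧ q.IsWeightedHomogeneous w j := by
  have hp := weightScale_ne_zero (w := w) (left_ne_zero_of_mul hne)
  have hq := weightScale_ne_zero (w := w) (right_ne_zero_of_mul hne)
  have h1 := weightScale_of_isWeightedHomogeneous h
  rw [map_mul] at h1
  have e1 := congrArg Polynomial.natDegree h1
  have e2 := congrArg Polynomial.natTrailingDegree h1
  rw [Polynomial.natDegree_mul hp hq, Polynomial.natDegree_C_mul_X_pow _ _ hne] at e1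
  rw [Polynomial.natTrailingDegree_mul hp hq,
    Polynomial.natTrailingDegree_mul (Polynomial.C_ne_zero.2 hne) (by simp),
    Polynomial.natTrailingDegree_C, Polynomial.natTrailingDegree_X_pow, zero_add] at e2
  have h3 := Polynomial.natTrailingDegree_le_natDegree (weightScale k w p)
  have h4 := Polynomial.natTrailingDegree_le_natDegree (weightScale k w q)
  exact ⟨_, _, e1, isWeightedHomogeneous_of_natDegree_le (by omega),
    isWeightedHomogeneous_of_natDegree_le (by omega)⟩

end WeightScale

lemma isWeightedHomogeneous_polyMul (h : Matrix.SpecialLinearGroup (Fin 2) k)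
    {p : MvPolynomial (Fin 2 × Fin 2) k} {n : ℕ} (hp : p.IsWeightedHomogeneous rowWeight n) :
    (polyMul h p).IsWeightedHomogeneous rowWeight n := by
  apply isWeightedHomogeneous_of_weightScale
  have : (weightScale k rowWeight).comp (polyMul h) =
      (Polynomial.mapAlgHom (polyMul h)).comp (weightScale k rowWeight) := by
    refine MvPolynomial.algHom_ext fun ⟨i, j⟩ => ?_
    rw [AlgHom.comp_apply, AlgHom.comp_apply, polyMul_X]
    simp [weightScale, ← algebraMap_eq, Polynomial.algebraMap_apply, rowWeight, polyMul_X]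
    ring
  have h2 := DFunLike.congr_fun this p
  rw [AlgHom.comp_apply, AlgHom.comp_apply, weightScale_of_isWeightedHomogeneous hp] at h2
  simpa using h2

/-- Multiplication by `polyDet k - 1`, which has parts of weights `0` and `1`, widens the range of
weights by one, so a nonzero multiple of it is never homogeneous. Each graded piece thus embeds in
`B`. -/
lemma IsWeightedHomogeneous.eq_zero_of_toB {p : MvPolynomial (Fin 2 × Fin 2) k} {n : ℕ}
    (hp : p.IsWeightedHomogeneous rowWeight n) (h : toB k p = 0) : p = 0 := by
  obtain ⟨s, rfl⟩ := mem_detIdeal.1 (toB_eq_zero.1 h)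
  by_contra hne
  have hs : s ≠ 0 := left_ne_zero_of_mul hne
  have hd : polyDet k ≠ 0 := by
    rw [polyDet_eq]; exact Matrix.det_mvPolynomialX_ne_zero _ _
  have h1 := weightScale_of_isWeightedHomogeneous hp
  rw [map_mul, map_sub, map_one, weightScale_of_isWeightedHomogeneous isWeightedHomogeneous_polyDet,
    pow_one] at h1
  set L : Polynomial (MvPolynomial (Fin 2 × Fin 2) k) := Polynomial.C (polyDet k) * Polynomial.X - 1
  have hL : L.natDegree = 1 := by
    have : L = Polynomial.C (polyDet k) * Polynomial.X + Polynomial.C (-1) := by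
      simp [L, sub_eq_add_neg]
    rw [this, Polynomial.natDegree_linear hd]
  have hL0 : L ≠ 0 := by rintro h0; rw [h0] at hL; simp at hL
  have hLt : L.natTrailingDegree = 0 :=
    Polynomial.natTrailingDegree_eq_zero.2 (Or.inr (by simp [L]))
  have e1 := congrArg Polynomial.natDegree h1
  have e2 := congrArg Polynomial.natTrailingDegree h1
  rw [Polynomial.natDegree_mul (weightScale_ne_zero hs) hL0, Polynomial.natDegree_C_mul_X_pow _ _ hne,
    hL] at e1
  rw [Polynomial.natTrailingDegree_mul (weightScale_ne_zero hs) hL0,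
    Polynomial.natTrailingDegree_mul (Polynomial.C_ne_zero.2 hne) (by simp),
    Polynomial.natTrailingDegree_C, Polynomial.natTrailingDegree_X_pow, hLt] at e2
  have := Polynomial.natTrailingDegree_le_natDegree (weightScale k rowWeight s)
  omega

lemma eq_of_toB_eq {p q : MvPolynomial (Fin 2 × Fin 2) k} {n : ℕ}
    (hp : p.IsWeightedHomogeneous rowWeight n) (hq : q.IsWeightedHomogeneous rowWeight n)
    (h : toB k p = toB k q) : p = q :=
  sub_eq_zero.1 (IsWeightedHomogeneous.eq_zero_of_toB (hp.sub hq) (by rw [map_sub, h, sub_self]))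

/-- Factors `polyDet k` raise the weight without changing the image in `B`. Lifts in all large
weights are needed so that two summands can be lifted in the same weight. -/
lemma exists_lift (b : B k) : ∃ N : ℕ, ∀ n ≥ N, ∃ q : MvPolynomial (Fin 2 × Fin 2) k,
    q.IsWeightedHomogeneous rowWeight n ∧ toB k q = b := by
  obtain ⟨p, rfl⟩ := toB_surjective b
  induction p using MvPolynomial.induction_on with
  | C a =>
    refine ⟨0, fun n _ => ⟨C a * polyDet k ^ n, ?_, ?_⟩⟩
    · simpa using (isWeightedHomogeneous_polyDet.pow n).C_mul a
    · rw [map_mul, map_pow, toB_polyDet, one_pow, mul_one]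
  | add p q hp hq =>
    obtain ⟨N, hN⟩ := hp
    obtain ⟨M, hM⟩ := hq
    refine ⟨max N M, fun n hn => ?_⟩
    obtain ⟨p', h1, h2⟩ := hN n (le_trans (le_max_left _ _) hn)
    obtain ⟨q', h3, h4⟩ := hM n (le_trans (le_max_right _ _) hn)
    exact ⟨p' + q', h1.add h3, by rw [map_add, map_add, h2, h4]⟩
  | mul_X p e hp =>
    obtain ⟨N, hN⟩ := hp
    refine ⟨N + 1, fun n hn => ?_⟩
    have hw : rowWeight e ≤ 1 := by have := e.1.2; simp only [rowWeight]; omega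
    obtain ⟨q, h1, h2⟩ := hN (n - rowWeight e) (by omega)
    refine ⟨q * X e, ?_, by rw [map_mul, map_mul, h2]⟩
    have := h1.mul (isWeightedHomogeneous_X k rowWeight e)
    rwa [Nat.sub_add_cancel (by omega)] at this

end

end SLTwo

/-! ### The Capelli identity and the reduction to invariant binary forms -/

namespace SLTwo

noncomputable section

open MvPolynomial

variable {k : Type*} [Field k]

lemma upsilon_toB (p : MvPolynomial (Fin 2 × Fin 2) k) :
    upsilon (toB k p) = toB k (X (1, 0) * pderiv (0, 0) p + X (1, 1) * pderiv (0, 1) p) := by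
  have h : (polyUpsilon : Derivation k (MvPolynomial (Fin 2 × Fin 2) k) _) =
      (X (1, 0) : MvPolynomial (Fin 2 × Fin 2) k) • pderiv (0, 0) +
        (X (1, 1) : MvPolynomial (Fin 2 × Fin 2) k) • pderiv (0, 1) := by
    refine MvPolynomial.derivation_ext fun ⟨i, j⟩ => ?_
    fin_cases i <;> fin_cases j <;> simp [polyUpsilon, pderiv_X]
  refine (Derivation.liftOfSurjective_apply _ polyUpsilon_aux _).trans ?_
  rw [h]
  rfl

/-- The chain rule for the substitution by `h`; it underlies the equivariance of `raise`, `omega`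
and `upsilon`. -/
lemma pderiv_polyMul (h : Matrix.SpecialLinearGroup (Fin 2) k) (i l : Fin 2)
    (p : MvPolynomial (Fin 2 × Fin 2) k) :
    pderiv (i, l) (polyMul h p) =
      C (h l 0) * polyMul h (pderiv (i, 0) p) + C (h l 1) * polyMul h (pderiv (i, 1) p) := by
  induction p using MvPolynomial.induction_on with
  | C a => simp [← algebraMap_eq]
  | add p q hp hq => simp only [map_add, hp, hq]; ring
  | mul_X p e hp =>
    obtain ⟨a, b⟩ := e
    simp only [map_mul, Derivation.leibniz, hp, polyMul_X, map_add, smul_eq_mul]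
    fin_cases i <;> fin_cases l <;> fin_cases a <;> fin_cases b <;>
      simp [pderiv_X] <;> ring

/-- The raising operator, replacing an entry of the second row by the entry above it. -/
def raise (p : MvPolynomial (Fin 2 × Fin 2) k) : MvPolynomial (Fin 2 × Fin 2) k :=
  X (0, 0) * pderiv (1, 0) p + X (0, 1) * pderiv (1, 1) p

/-- Cayley's Omega operator. -/
def omega (p : MvPolynomial (Fin 2 × Fin 2) k) : MvPolynomial (Fin 2 × Fin 2) k :=
  pderiv (0, 0) (pderiv (1, 1) p) - pderiv (0, 1) (pderiv (1, 0) p)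

lemma det_entries (h : Matrix.SpecialLinearGroup (Fin 2) k) :
    h 0 0 * h 1 1 - h 0 1 * h 1 0 = 1 := by
  have := h.2
  rwa [Matrix.det_fin_two] at this

lemma raise_polyMul (h : Matrix.SpecialLinearGroup (Fin 2) k)
    (p : MvPolynomial (Fin 2 × Fin 2) k) : raise (polyMul h p) = polyMul h (raise p) := by
  simp only [raise, pderiv_polyMul, map_add, map_mul, polyMul_X]
  ring

/-- Substitution by a matrix multiplies Omega by its determinant, here `1`. -/
lemma omega_polyMul (h : Matrix.SpecialLinearGroup (Fin 2) k)
    (p : MvPolynomial (Fin 2 × Fin 2) k) : omega (polyMul h p) = polyMul h (omega p) := by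
  have hd : (C (h 0 0) * C (h 1 1) - C (h 0 1) * C (h 1 0) : MvPolynomial (Fin 2 × Fin 2) k) = 1 := by
    rw [← C_mul, ← C_mul, ← C_sub, det_entries, C_1]
  simp only [omega, pderiv_polyMul, map_add, map_sub, Derivation.leibniz, pderiv_C, smul_eq_mul,
    mul_zero, add_zero]
  linear_combination (polyMul h (pderiv (0, 0) (pderiv (1, 1) p)) -
    polyMul h (pderiv (0, 1) (pderiv (1, 0) p))) * hd

lemma upsilon_rightMul (h : Matrix.SpecialLinearGroup (Fin 2) k) (b : B k) :
    upsilon (rightMul h b) = rightMul h (upsilon b) := by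
  obtain ⟨p, rfl⟩ := toB_surjective b
  rw [rightMul_toB, upsilon_toB, upsilon_toB, rightMul_toB]
  simp only [pderiv_polyMul, map_add, map_mul, polyMul_X]
  ring

lemma isWeightedHomogeneous_raise {p : MvPolynomial (Fin 2 × Fin 2) k} {n : ℕ}
    (hp : p.IsWeightedHomogeneous rowWeight (n + 1)) :
    (raise p).IsWeightedHomogeneous rowWeight n := by
  have h : ∀ j : Fin 2, (X (0, j) * pderiv (1, j) p : MvPolynomial (Fin 2 × Fin 2) k).IsWeightedHomogeneous
      rowWeight n := fun j => by
    have := (isWeightedHomogeneous_X k rowWeight (0, j)).mul (hp.pderiv (i := (1, j)) (n' := n) rfl)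
    simpa [rowWeight] using this
  exact (h 0).add (h 1)

lemma isWeightedHomogeneous_omega {p : MvPolynomial (Fin 2 × Fin 2) k} {n : ℕ}
    (hp : p.IsWeightedHomogeneous rowWeight (n + 1)) :
    (omega p).IsWeightedHomogeneous rowWeight n := by
  have h : ∀ j l : Fin 2, (pderiv (0, l) (pderiv (1, j) p)).IsWeightedHomogeneous
      rowWeight n := fun j l => (hp.pderiv (n' := n) rfl).pderiv rfl
  exact (h _ _).sub (h _ _)

lemma isHomogeneous_raise {p : MvPolynomial (Fin 2 × Fin 2) k} {m : ℕ}
    (hp : p.IsHomogeneous (m + 1)) : (raise p).IsHomogeneous (m + 1) := by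
  have h : ∀ j : Fin 2, (X (0, j) * pderiv (1, j) p : MvPolynomial (Fin 2 × Fin 2) k).IsHomogeneous
      (m + 1) := fun j => by
    have := (isHomogeneous_X k ((0, j) : Fin 2 × Fin 2)).mul (hp.pderiv (i := (1, j)))
    rwa [Nat.add_sub_cancel, add_comm] at this
  exact (h 0).add (h 1)

lemma isHomogeneous_omega {p : MvPolynomial (Fin 2 × Fin 2) k} {m : ℕ}
    (hp : p.IsHomogeneous m) : (omega p).IsHomogeneous (m - 1 - 1) :=
  hp.pderiv.pderiv.sub hp.pderiv.pderiv

/-- The Capelli identity. -/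
lemma capelli (p : MvPolynomial (Fin 2 × Fin 2) k) {n r : ℕ}
    (hn : p.IsWeightedHomogeneous rowWeight n) (hr : p.IsHomogeneous (n + r)) :
    (X (1, 0) * pderiv (0, 0) (raise p) + X (1, 1) * pderiv (0, 1) (raise p)) +
      polyDet k * omega p = C ((n * (r + 1) : ℕ) : k) * p := by
  -- Euler's identities for the second row and for all entries; their difference `h3` is the one for
  -- the first row.
  have h2 := hn.sum_weight_X_mul_pderiv
  have h1 := hr.sum_X_mul_pderiv
  simp only [Fintype.sum_prod_type, Fin.sum_univ_two, rowWeight, Fin.val_zero, Fin.val_one,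
    nsmul_eq_mul, Nat.cast_add] at h1 h2
  simp only [Nat.cast_zero, Nat.cast_one, zero_mul, one_mul, zero_add] at h2
  have h3 : X (0, 0) * pderiv (0, 0) p + X (0, 1) * pderiv (0, 1) p = (r : MvPolynomial (Fin 2 × Fin 2) k) * p := by
    linear_combination h1 - h2
  -- Differentiating the second-row Euler identity supplies the second-order terms of the lowered
  -- `raise p`.
  have e0 := congrArg (pderiv (0, 0)) h2
  have e1 := congrArg (pderiv (0, 1)) h2
  simp [Derivation.leibniz, pderiv_X] at e0 e1
  simp [raise, omega, polyDet, Derivation.leibniz, pderiv_X]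
  linear_combination X (0, 0) * e0 + X (0, 1) * e1 + h2 + n * h3

/-- The map `k[x, y] → B`. -/
def formToB (k : Type*) [Field k] : MvPolynomial (Fin 2) k →ₐ[k] B k :=
  (toB k).comp (rename fun j => (0, j))

@[simp] lemma formToB_X_zero : formToB k (X 0) = x k := by simp [formToB, x]
@[simp] lemma formToB_X_one : formToB k (X 1) = y k := by simp [formToB, y]

/-- The right action on binary forms. -/
def formMul (h : Matrix.SpecialLinearGroup (Fin 2) k) :
    MvPolynomial (Fin 2) k →ₐ[k] MvPolynomial (Fin 2) k :=
  aeval fun j => X 0 * C (h 0 j) + X 1 * C (h 1 j)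

lemma formMul_X (h : Matrix.SpecialLinearGroup (Fin 2) k) (j : Fin 2) :
    formMul h (X j) = X 0 * C (h 0 j) + X 1 * C (h 1 j) := by
  simp [formMul]

lemma polyMul_rename (h : Matrix.SpecialLinearGroup (Fin 2) k) (g : MvPolynomial (Fin 2) k) :
    polyMul h (rename (fun j => ((0 : Fin 2), j)) g) = rename (fun j => (0, j)) (formMul h g) := by
  suffices H : (polyMul h).comp (rename fun j => ((0 : Fin 2), j)) =
    (rename fun j => (0, j)).comp (formMul h) from DFunLike.congr_fun H g
  refine MvPolynomial.algHom_ext fun j => ?_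
  simp [polyMul_X, formMul_X]

lemma rightMul_formToB (h : Matrix.SpecialLinearGroup (Fin 2) k) (g : MvPolynomial (Fin 2) k) :
    rightMul h (formToB k g) = formToB k (formMul h g) := by
  simp only [formToB, AlgHom.comp_apply, rightMul_toB, polyMul_rename]

lemma rename_row_injective : Function.Injective
    (rename (R := k) fun j : Fin 2 => ((0 : Fin 2), j)) :=
  rename_injective _ fun _ _ h => (Prod.ext_iff.1 h).2

lemma isWeightedHomogeneous_rename (g : MvPolynomial (Fin 2) k) :
    (rename (fun j => ((0 : Fin 2), j)) g).IsWeightedHomogeneous rowWeight 0 := by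
  apply isWeightedHomogeneous_of_weightScale
  rw [pow_zero, mul_one]
  have : (weightScale k rowWeight).comp (rename fun j => ((0 : Fin 2), j)) =
      Polynomial.CAlgHom.comp (rename fun j => ((0 : Fin 2), j)) := by
    refine MvPolynomial.algHom_ext fun j => ?_
    simp [weightScale, rowWeight]
  exact DFunLike.congr_fun this g

lemma formToB_injective : Function.Injective (formToB k) := fun f g h =>
  rename_row_injective <| eq_of_toB_eq (isWeightedHomogeneous_rename f) (isWeightedHomogeneous_rename g) h

lemma exists_rename_of_isWeightedHomogeneous {p : MvPolynomial (Fin 2 × Fin 2) k}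
    (hp : p.IsWeightedHomogeneous rowWeight 0) :
    ∃ g : MvPolynomial (Fin 2) k, rename (fun j => (0, j)) g = p := by
  refine exists_rename_eq_of_vars_subset_range p _ (fun i j h => (Prod.ext_iff.1 h).2) ?_
  rintro ⟨i, j⟩ he
  obtain ⟨d, hd, hd'⟩ := (mem_vars_iff_mem_support _).1 he
  have h0 := hp (mem_support_iff.1 hd)
  rw [Finsupp.weight_apply, Finsupp.sum, Finset.sum_eq_zero_iff] at h0
  have h1 := h0 _ hd'
  have h2 : i = 0 := by
    have : d (i, j) ≠ 0 := Finsupp.mem_support_iff.1 hd'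
    have h3 : rowWeight (i, j) = 0 := by simpa [this] using h1
    exact Fin.ext h3
  exact ⟨j, by rw [h2]⟩

lemma polyMul_homogeneousComponent (h : Matrix.SpecialLinearGroup (Fin 2) k) (m : ℕ)
    (p : MvPolynomial (Fin 2 × Fin 2) k) :
    polyMul h (homogeneousComponent m p) = homogeneousComponent m (polyMul h p) := by
  conv_rhs => rw [← sum_homogeneousComponent p]
  simp only [map_sum]
  have : ∀ i, homogeneousComponent m (polyMul h (homogeneousComponent i p)) =
      if m = i then polyMul h (homogeneousComponent i p) else 0 := fun i =>
    homogeneousComponent_of_mem (isHomogeneous_polyMul h (homogeneousComponent_isHomogeneous i p))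
  simp only [this]
  rw [Finset.sum_ite_eq]
  split_ifs with hm
  · rfl
  · rw [homogeneousComponent_eq_zero _ _ (by simpa using hm), map_zero]

lemma isWeightedHomogeneous_homogeneousComponent {p : MvPolynomial (Fin 2 × Fin 2) k} {n : ℕ}
    (hp : p.IsWeightedHomogeneous rowWeight n) (m : ℕ) :
    (homogeneousComponent m p).IsWeightedHomogeneous rowWeight n := by
  intro d hd
  rw [coeff_homogeneousComponent] at hd
  exact hp (fun h => hd (by rw [h, ite_self]))

/-- Induction on the degree `n` in the second row: in `B` the Capelli identity expresses `n * (r +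
1)` times the image of `p` through the images of `raise p` and `omega p`, which are again invariant
and of second-row degree `n - 1`. The integer is invertible in characteristic zero. -/
lemma toB_mem_of_bihomogeneous [CharZero k] (H : Set (Matrix.SpecialLinearGroup (Fin 2) k))
    (A : Subalgebra k (B k)) (hA : ∀ a ∈ A, upsilon a ∈ A)
    (hQ : ∀ (d : ℕ) (g : MvPolynomial (Fin 2) k), g.IsHomogeneous d →
      (∀ h ∈ H, formMul h g = g) → formToB k g ∈ A) (n : ℕ) :
    ∀ (m : ℕ) (p : MvPolynomial (Fin 2 × Fin 2) k), p.IsWeightedHomogeneous rowWeight n →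
      p.IsHomogeneous m → (∀ h ∈ H, polyMul h p = p) → toB k p ∈ A := by
  induction n with
  | zero =>
    intro m p hp hm hinv
    obtain ⟨g, rfl⟩ := exists_rename_of_isWeightedHomogeneous hp
    refine hQ m g ?_ fun h hh => ?_
    · exact (IsHomogeneous.rename_isHomogeneous_iff fun i j h => (Prod.ext_iff.1 h).2).1 hm
    · have := hinv h hh
      rw [polyMul_rename] at this
      exact rename_row_injective this
  | succ n ih =>
    intro m p hp hm hinv
    rcases eq_or_ne p 0 with rfl | hne
    · rw [map_zero]; exact A.zero_mem
    -- A nonzero polynomial has total degree at least its second-row degree; the difference is the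
    -- degree `r` in the first row.
    have hle : n + 1 ≤ m := by
      obtain ⟨d, hd⟩ := ne_zero_iff.1 hne
      rw [← hp hd, ← hm hd, Finsupp.weight_apply, Finsupp.weight_apply]
      refine Finset.sum_le_sum fun e _ => ?_
      have : rowWeight e ≤ 1 := by have := e.1.2; simp only [rowWeight]; omega
      simpa using Nat.mul_le_mul_left (d e) this
    obtain ⟨r, rfl⟩ := Nat.exists_eq_add_of_le hle
    have hc := congrArg (toB k) (capelli p hp hm)
    rw [map_add, ← upsilon_toB, map_mul, toB_polyDet, one_mul, map_mul, ← algebraMap_eq,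
      AlgHom.commutes, ← Algebra.smul_def] at hc
    have h1 : toB k (raise p) ∈ A := by
      refine ih (n + r + 1) _ (isWeightedHomogeneous_raise hp) (isHomogeneous_raise ?_) fun h hh => ?_
      · rwa [add_right_comm] at hm
      · rw [← raise_polyMul, hinv h hh]
    have h2 : toB k (omega p) ∈ A := by
      refine ih _ _ (isWeightedHomogeneous_omega hp) (isHomogeneous_omega hm) fun h hh => ?_
      rw [← omega_polyMul, hinv h hh]
    have h3 := A.add_mem (hA _ h1) h2
    rw [hc] at h3
    have h4 := A.smul_mem h3 ((((n + 1) * (r + 1) : ℕ) : k)⁻¹)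
    rwa [smul_smul, inv_mul_cancel₀ (Nat.cast_ne_zero.2 (by positivity)), one_smul] at h4

/-- A subalgebra stable under `υ` that contains the invariant binary forms contains all
invariants. -/
theorem invariants_le_of_forms [CharZero k] (H : Subgroup (Matrix.SpecialLinearGroup (Fin 2) k))
    (A : Subalgebra k (B k)) (hA : ∀ a ∈ A, upsilon a ∈ A)
    (hQ : ∀ (d : ℕ) (g : MvPolynomial (Fin 2) k), g.IsHomogeneous d →
      (∀ h ∈ H, formMul h g = g) → formToB k g ∈ A) : invariants H ≤ A := by
  intro b hb
  obtain ⟨N, hN⟩ := exists_lift b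
  obtain ⟨q, hq, rfl⟩ := hN N le_rfl
  -- A lift of given weight is unique, so invariance in `B` passes to the lift.
  have hinv : ∀ h ∈ H, polyMul h q = q := fun h hh =>
    eq_of_toB_eq (isWeightedHomogeneous_polyMul h hq) hq (by rw [← rightMul_toB]; exact hb h hh)
  rw [← sum_homogeneousComponent q, map_sum]
  refine A.sum_mem fun m _ => ?_
  refine toB_mem_of_bihomogeneous H A hA hQ N m _ (isWeightedHomogeneous_homogeneousComponent hq m)
    (homogeneousComponent_isHomogeneous m q) fun h hh => ?_
  rw [polyMul_homogeneousComponent, hinv h hh]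

end

end SLTwo

/-! ### Generation criteria for rings of invariants -/

namespace SLTwo

noncomputable section

open MvPolynomial

variable {k : Type*} [Field k]

lemma rightMul_one (b : B k) : rightMul 1 b = b := by
  obtain ⟨p, rfl⟩ := toB_surjective b
  rw [rightMul_toB]
  congr 1
  suffices H : polyMul (k := k) 1 = AlgHom.id k _ from DFunLike.congr_fun H p
  refine MvPolynomial.algHom_ext fun ⟨i, j⟩ => ?_
  rw [polyMul_X]
  fin_cases j <;> simp

lemma mul_apply_two (g h : Matrix.SpecialLinearGroup (Fin 2) k) (i j : Fin 2) :
    (g * h) i j = g i 0 * h 0 j + g i 1 * h 1 j := by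
  have : (g * h) i j = ((g : Matrix (Fin 2) (Fin 2) k) * (h : Matrix (Fin 2) (Fin 2) k)) i j := rfl
  rw [this, Matrix.mul_apply, Fin.sum_univ_two]

lemma polyMul_mul (g h : Matrix.SpecialLinearGroup (Fin 2) k) (p : MvPolynomial (Fin 2 × Fin 2) k) :
    polyMul (g * h) p = polyMul g (polyMul h p) := by
  suffices H : polyMul (g * h) = (polyMul g).comp (polyMul h) from DFunLike.congr_fun H p
  refine MvPolynomial.algHom_ext fun ⟨i, j⟩ => ?_
  have hC : ∀ a : k, polyMul g (C a) = C a := fun a => (polyMul g).commutes a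
  rw [AlgHom.comp_apply, polyMul_X, polyMul_X, map_add, map_mul, map_mul, hC, hC, polyMul_X, polyMul_X,
    mul_apply_two, mul_apply_two, C_add, C_add, C_mul, C_mul, C_mul, C_mul]
  ring

lemma rightMul_mul (g h : Matrix.SpecialLinearGroup (Fin 2) k) (b : B k) :
    rightMul (g * h) b = rightMul g (rightMul h b) := by
  obtain ⟨p, rfl⟩ := toB_surjective b
  rw [rightMul_toB, rightMul_toB, rightMul_toB, polyMul_mul]

lemma mem_invariants_closure {S : Set (Matrix.SpecialLinearGroup (Fin 2) k)} {b : B k} :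
    b ∈ invariants (Subgroup.closure S) ↔ ∀ h ∈ S, rightMul h b = b := by
  refine ⟨fun hb h hh => hb h (Subgroup.subset_closure hh), fun hb h hh => ?_⟩
  induction hh using Subgroup.closure_induction with
  | mem h hh => exact hb h hh
  | one => exact rightMul_one b
  | mul g h _ _ hg hh => rw [rightMul_mul, hh, hg]
  | inv h _ hh => conv_lhs => rw [← hh, ← rightMul_mul, inv_mul_cancel, rightMul_one]

lemma formMul_eq_iff {h : Matrix.SpecialLinearGroup (Fin 2) k} {f g : MvPolynomial (Fin 2) k} :
    formMul h f = g ↔ rightMul h (formToB k f) = formToB k g := by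
  rw [rightMul_formToB, formToB_injective.eq_iff]

lemma upsilon_mem_adjoin {T : Set (B k)} (hT : ∀ t ∈ T, upsilon t ∈ Algebra.adjoin k T) {a : B k}
    (ha : a ∈ Algebra.adjoin k T) : upsilon a ∈ Algebra.adjoin k T := by
  induction ha using Algebra.adjoin_induction with
  | mem t ht => exact hT t ht
  | algebraMap r => rw [Derivation.map_algebraMap]; exact Subalgebra.zero_mem _
  | add a b _ _ ha hb => rw [map_add]; exact Subalgebra.add_mem _ ha hb
  | mul a b h1 h2 ha hb =>
    rw [Derivation.leibniz, smul_eq_mul, smul_eq_mul]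
    exact Subalgebra.add_mem _ (Subalgebra.mul_mem _ h1 hb) (Subalgebra.mul_mem _ h2 ha)

/-- If `T` consists of invariants and generates a `υ`-stable subalgebra containing all invariant
forms, then it generates the ring of invariants. -/
theorem invariants_closure_eq_adjoin [CharZero k] (S : Set (Matrix.SpecialLinearGroup (Fin 2) k))
    (T : Set (B k)) (hT : ∀ t ∈ T, upsilon t ∈ Algebra.adjoin k T)
    (hinv : ∀ s ∈ S, ∀ t ∈ T, rightMul s t = t)
    (hQ : ∀ (d : ℕ) (g : MvPolynomial (Fin 2) k), g.IsHomogeneous d →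
      (∀ s ∈ S, formMul s g = g) → formToB k g ∈ Algebra.adjoin k T) :
    invariants (Subgroup.closure S) = Algebra.adjoin k T := by
  refine le_antisymm ?_ (Algebra.adjoin_le fun t ht => mem_invariants_closure.2 fun s hs => hinv s hs t ht)
  exact invariants_le_of_forms _ _ (fun a ha => upsilon_mem_adjoin hT ha) fun d g hg hinv =>
    hQ d g hg fun s hs => hinv s (Subgroup.subset_closure hs)

/-- Leibniz's rule for iterates, which stops after two terms because `upsilon` kills `l` in two
steps. -/
lemma iterate_upsilon_linear_mul {l : B k} (hl : upsilon (upsilon l) = 0) (b : B k) (m : ℕ) :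
    upsilon^[m + 1] (l * b) = l * upsilon^[m + 1] b + (m + 1) * (upsilon l * upsilon^[m] b) := by
  induction m with
  | zero => simp [Derivation.leibniz]; ring
  | succ m ih =>
    rw [Function.iterate_succ_apply', ih, Function.iterate_succ_apply' _ (m + 1), Function.iterate_succ_apply' _ m]
    have : upsilon ((m : B k) + 1) = 0 := by
      rw [map_add, Derivation.map_natCast, Derivation.map_one_eq_zero, add_zero]
    simp only [map_add, Derivation.leibniz, smul_eq_mul, hl, this]
    push_cast
    ring

lemma iterate_upsilon_linear_mul_eq_zero {l : B k} (hl : upsilon (upsilon l) = 0) {b : B k} {m : ℕ}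
    (h : upsilon^[m] b = 0) : upsilon^[m + 1] (l * b) = 0 := by
  rw [iterate_upsilon_linear_mul hl, Function.iterate_succ_apply', h]
  simp

/-- Each factor `x` or `y` raises the order of nilpotency by at most one. This makes `hat d` of a
form of degree `d` stable under `upsilon`. -/
lemma iterate_upsilon_formToB {F : MvPolynomial (Fin 2) k} {d : ℕ} (hF : F.IsHomogeneous d) :
    upsilon^[d + 1] (formToB k F) = 0 := by
  have hx : upsilon (upsilon (x k)) = 0 := by rw [upsilon_x, upsilon_z]
  have hy : upsilon (upsilon (y k)) = 0 := by rw [upsilon_y, upsilon_w]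
  have hpow : ∀ (l : B k), upsilon (upsilon l) = 0 → ∀ (a n : ℕ) (b : B k), upsilon^[n] b = 0 →
      upsilon^[a + n] (l ^ a * b) = 0 := by
    intro l hl a n b hb
    induction a with
    | zero => simpa using hb
    | succ a ih =>
      rw [pow_succ', mul_assoc, Nat.succ_add]
      exact iterate_upsilon_linear_mul_eq_zero hl ih
  induction hF using IsWeightedHomogeneous.induction_on with
  | zero => rw [map_zero]; exact iterate_map_zero _ _
  | add p q hp hq h1 h2 => rw [map_add, iterate_map_add, h1, h2, add_zero]
  | monomial e r he =>
    have h2 : e 0 + (e 1 + 1) = d + 1 := by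
      rw [← he, Finsupp.weight_apply, Finsupp.sum_fintype _ _ (by simp), Fin.sum_univ_two]
      simp [add_assoc]
    have h1 : formToB k (monomial e r) = x k ^ e 0 * (y k ^ e 1 * algebraMap k (B k) r) := by
      rw [monomial_eq, Finsupp.prod_fintype _ _ (by simp), Fin.prod_univ_two]
      simp only [map_mul, map_pow, formToB_X_zero, formToB_X_one, ← algebraMap_eq, AlgHom.commutes]
      ring
    rw [h1, ← h2]
    refine hpow _ hx _ _ _ (hpow _ hy _ _ _ ?_)
    rw [Function.iterate_one, Derivation.map_algebraMap]

lemma upsilon_mem_hat {F : MvPolynomial (Fin 2) k} {d : ℕ} (hF : F.IsHomogeneous d) {t : B k}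
    (ht : t ∈ hat d (formToB k F)) : upsilon t ∈ hat d (formToB k F) := by
  induction ht using Submodule.span_induction with
  | mem t ht =>
    obtain ⟨j, hj, rfl⟩ := ht
    rw [← Function.iterate_succ_apply' upsilon]
    rcases hj.lt_or_eq with h | rfl
    · exact Submodule.subset_span ⟨j + 1, h, rfl⟩
    · rw [iterate_upsilon_formToB hF]; exact Submodule.zero_mem _
  | zero => rw [map_zero]; exact Submodule.zero_mem _
  | add a b _ _ ha hb => rw [map_add]; exact Submodule.add_mem _ ha hb
  | smul c a _ ha => rw [Derivation.map_smul]; exact Submodule.smul_mem _ _ ha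

lemma rightMul_eq_of_mem_hat {h : Matrix.SpecialLinearGroup (Fin 2) k} {f : B k} {d : ℕ}
    (hf : rightMul h f = f) {t : B k} (ht : t ∈ hat d f) : rightMul h t = t := by
  induction ht using Submodule.span_induction with
  | mem t ht =>
    obtain ⟨j, -, rfl⟩ := ht
    induction j with
    | zero => exact hf
    | succ j ih => rw [Function.iterate_succ_apply', ← upsilon_rightMul, ih]
  | zero => rw [map_zero]
  | add a b _ _ ha hb => rw [map_add, ha, hb]
  | smul c a _ ha => rw [map_smul, ha]

lemma self_mem_hat (d : ℕ) (f : B k) : f ∈ hat d f := Submodule.subset_span ⟨0, Nat.zero_le _, rfl⟩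

/-- The case of `invariants_closure_eq_adjoin` of one binary form. The containment of invariant forms
may be checked in any `υ`-stable subalgebra containing the form. -/
theorem invariants_closure_eq_adjoin_hat [CharZero k]
    (S : Set (Matrix.SpecialLinearGroup (Fin 2) k)) {F : MvPolynomial (Fin 2) k} {d : ℕ}
    (hF : F.IsHomogeneous d) (hinv : ∀ s ∈ S, formMul s F = F)
    (hQ : ∀ A : Subalgebra k (B k), (∀ a ∈ A, upsilon a ∈ A) → formToB k F ∈ A →
      ∀ (e : ℕ) (g : MvPolynomial (Fin 2) k), g.IsHomogeneous e →
      (∀ s ∈ S, formMul s g = g) → formToB k g ∈ A) :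
    invariants (Subgroup.closure S) = Algebra.adjoin k (hat d (formToB k F) : Set (B k)) := by
  have hT : ∀ t ∈ (hat d (formToB k F) : Set (B k)),
      upsilon t ∈ Algebra.adjoin k (hat d (formToB k F) : Set (B k)) := fun t ht =>
    Algebra.subset_adjoin (upsilon_mem_hat hF ht)
  refine invariants_closure_eq_adjoin S _ hT ?_ ?_
  · exact fun s hs t ht => rightMul_eq_of_mem_hat (formMul_eq_iff.1 (hinv s hs)) ht
  · exact hQ _ (fun a ha => upsilon_mem_adjoin hT ha) (Algebra.subset_adjoin (self_mem_hat _ _))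

end

end SLTwo

/-! ### Factoriality of fixed rings and of `B` -/

namespace SLTwo

noncomputable section

open MvPolynomial

section FixedRing

/-- If a group acts on a unique factorization domain `R` such that every element which is
invariant up to units is invariant, then the ring of invariants `S` is again a unique factorization
domain. -/
theorem uniqueFactorizationMonoid_of_fixed {R S G : Type*} [CommRing R] [IsDomain R]
    [UniqueFactorizationMonoid R] [CommRing S] [IsDomain S] [Group G] [MulSemiringAction G R]
    (i : S →+* R) (hi : Function.Injective i) (hS : ∀ b, b ∈ i.range ↔ ∀ g : G, g • b = b)
    (hG : ∀ e : R, e ≠ 0 → (∀ g : G, Associated (g • e) e) → ∀ g : G, g • e = e) :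
    UniqueFactorizationMonoid S := by
  classical
  have hfix : ∀ (a : S) (g : G), g • i a = i a := fun a => (hS _).1 ⟨a, rfl⟩
  have hdvd : ∀ a b : S, i a ∣ i b ↔ a ∣ b := by
    refine fun a b => ⟨?_, map_dvd i⟩
    rintro ⟨c, hc⟩
    rcases eq_or_ne a 0 with rfl | ha
    · rw [map_zero, zero_mul, map_eq_zero_iff i hi] at hc
      rw [hc]
    · have hia : i a ≠ 0 := (map_ne_zero_iff i hi).2 ha
      obtain ⟨c', rfl⟩ := (hS c).2 fun g => by
        apply mul_left_cancel₀ hia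
        rw [← hc, ← hfix b g, hc, smul_mul', hfix]
      exact ⟨c', hi (by rw [hc, map_mul])⟩
  have hunit : ∀ a : S, IsUnit (i a) → IsUnit a := fun a ha => by
    rw [isUnit_iff_dvd_one] at ha ⊢
    rwa [← map_one i, hdvd] at ha
  have hwf : WfDvdMonoid S := by
    refine ⟨Subrelation.wf (r := InvImage DvdNotUnit i) ?_
      (InvImage.wf i ((inferInstance : WfDvdMonoid R).wf))⟩
    rintro a b ⟨ha, x, hx, rfl⟩
    exact ⟨(map_ne_zero_iff i hi).2 ha, i x, fun h => hx (hunit x h), map_mul i a x⟩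
  have hprime : ∀ a : S, Irreducible a → Prime a := by
    intro a ha
    have ha0 : i a ≠ 0 := (map_ne_zero_iff i hi).2 ha.ne_zero
    obtain ⟨p, hp, hpa⟩ := WfDvdMonoid.exists_irreducible_factor (fun h => ha.not_isUnit (hunit a h)) ha0
    have hpp : Prime p := hp.prime
    have hgp : ∀ g : G, Prime (g • p) := fun g =>
      (MulEquiv.prime_iff (MulSemiringAction.toRingEquiv G R g)).2 hpp
    have hgdvd : ∀ (b : S) (g : G), p ∣ i b → g • p ∣ i b := fun b g h => by
      rw [← hfix b g]
      exact map_dvd (MulSemiringAction.toRingEquiv G R g) h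
    -- The orbit of `p` up to units. It is finite, since all its members divide the nonzero element
    -- `i a`.
    let f : G → Associates R := fun g => Associates.mk (g • p)
    have hfin : (Set.range f).Finite := by
      refine ((UniqueFactorizationMonoid.factors (i a)).toFinset.image Associates.mk).finite_toSet.subset ?_
      rintro _ ⟨g, rfl⟩
      obtain ⟨q, hq, hqa⟩ := UniqueFactorizationMonoid.exists_mem_factors_of_dvd ha0
        (hgp g).irreducible (hgdvd a g hpa)
      exact Finset.mem_coe.2 (Finset.mem_image.2
        ⟨q, Multiset.mem_toFinset.2 hq, (Associates.mk_eq_mk_iff_associated.2 hqa).symm⟩)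
    let T := hfin.toFinset
    have hT : ∀ t, t ∈ T ↔ ∃ g, f g = t := fun t => by simp [T]
    -- The orbit product is fixed up to units, hence fixed by `hG`. Its preimage in `S` will be a
    -- prime dividing `a`.
    let e : R := ∏ t ∈ T, Quotient.out t
    have hout : ∀ t : Associates R, Associates.mk (Quotient.out t) = t := fun t => Associates.quot_out t
    have hmk : Associates.mk e = ∏ t ∈ T, t := by
      rw [show Associates.mk e = Associates.mkMonoidHom e from rfl, map_prod]
      exact Finset.prod_congr rfl fun t _ => hout t
    have hact : ∀ (g : G) {a b : R}, Associates.mk a = Associates.mk b →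
        Associates.mk (g • a) = Associates.mk (g • b) := fun g a b h => by
      rw [Associates.mk_eq_mk_iff_associated] at h ⊢
      exact h.map (MulSemiringAction.toRingEquiv G R g)
    have hTprime : ∀ t ∈ T, Prime t := fun t ht => by
      obtain ⟨g, rfl⟩ := (hT t).1 ht
      exact Associates.prime_mk.2 (hgp g)
    have he0 : e ≠ 0 := by
      rw [Finset.prod_ne_zero_iff]
      intro t ht h0
      have := (hTprime t ht).ne_zero
      rw [← hout t, h0] at this
      exact this Associates.mk_zero
    have hassoc : ∀ g : G, Associated (g • e) e := fun g => by
      rw [← Associates.mk_eq_mk_iff_associated, hmk]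
      have : Associates.mk (g • e) = ∏ t ∈ T, Associates.mk (g • Quotient.out t) := by
        rw [Finset.smul_prod', show ∀ a : R, Associates.mk a = Associates.mkMonoidHom a from fun _ => rfl,
          map_prod]
        rfl
      rw [this]
      refine Finset.prod_nbij' (fun t => Associates.mk (g • Quotient.out t))
        (fun t => Associates.mk (g⁻¹ • Quotient.out t)) ?_ ?_ ?_ ?_ (fun _ _ => rfl)
      · intro t ht
        obtain ⟨h, rfl⟩ := (hT t).1 ht
        refine (hT _).2 ⟨g * h, ?_⟩
        rw [hact g (hout (f h)), ← mul_smul]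
      · intro t ht
        obtain ⟨h, rfl⟩ := (hT t).1 ht
        refine (hT _).2 ⟨g⁻¹ * h, ?_⟩
        rw [hact g⁻¹ (hout (f h)), ← mul_smul]
      · intro t _
        rw [hact g⁻¹ (hout _), inv_smul_smul, hout]
      · intro t _
        rw [hact g (hout _), smul_inv_smul, hout]
    obtain ⟨e', he'⟩ := (hS e).2 (hG e he0 hassoc)
    -- As `i b` is fixed, one prime of the orbit divides it only together with all the others, and
    -- these are pairwise non-associated.
    have hedvd : ∀ b : S, p ∣ i b ↔ e' ∣ b := by
      intro b
      rw [← hdvd, he']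
      constructor
      · intro h
        rw [← Associates.mk_dvd_mk, hmk]
        refine Finset.prod_primes_dvd _ hTprime fun t ht => ?_
        obtain ⟨g, rfl⟩ := (hT t).1 ht
        exact Associates.mk_dvd_mk.2 (hgdvd b g h)
      · intro h
        refine dvd_trans ?_ h
        rw [← Associates.mk_dvd_mk, hmk]
        refine Finset.dvd_prod_of_mem (fun t => t) ((hT _).2 ⟨1, ?_⟩)
        simp [f]
    have hep : Prime e' := by
      refine ⟨?_, ?_, ?_⟩
      · rintro rfl
        exact he0 (by rw [← he', map_zero])
      · intro h
        have h1 := (hedvd 1).2 (isUnit_iff_dvd_one.1 h)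
        rw [map_one] at h1
        exact hpp.not_isUnit (isUnit_iff_dvd_one.2 h1)
      · intro b c h
        rw [← hedvd, map_mul] at h
        rw [← hedvd, ← hedvd]
        exact hpp.dvd_or_dvd h
    exact (hep.irreducible.associated_of_dvd ha ((hedvd a).1 hpa)).prime hep
  exact { irreducible_iff_prime := fun {a} => ⟨hprime a, Prime.irreducible⟩ }

end FixedRing

variable {k : Type*} [Field k]

instance : IsDomain (B k) := by
  have : Nontrivial (B k) := by
    refine ⟨1, 0, fun h => one_ne_zero (α := MvPolynomial (Fin 2 × Fin 2) k) ?_⟩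
    exact IsWeightedHomogeneous.eq_zero_of_toB (isWeightedHomogeneous_one k rowWeight) (by rw [map_one, h])
  have : NoZeroDivisors (B k) := by
    refine ⟨fun {a b} h => ?_⟩
    obtain ⟨N, hN⟩ := exists_lift a
    obtain ⟨M, hM⟩ := exists_lift b
    obtain ⟨p, hp, rfl⟩ := hN N le_rfl
    obtain ⟨q, hq, rfl⟩ := hM M le_rfl
    rw [← map_mul] at h
    rcases mul_eq_zero.1 (IsWeightedHomogeneous.eq_zero_of_toB (hp.mul hq) h) with rfl | rfl <;> simp
  exact NoZeroDivisors.to_isDomain _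

/-- Lift the cofactor homogeneously and pad with powers of `polyDet k` until both sides have equal
weight; the equation then already holds between polynomials. -/
lemma exists_dvd_mul_polyDet_pow {p q : MvPolynomial (Fin 2 × Fin 2) k} {i j : ℕ}
    (hp : p.IsWeightedHomogeneous rowWeight i) (hq : q.IsWeightedHomogeneous rowWeight j)
    (h : toB k p ∣ toB k q) : ∃ n, p ∣ q * polyDet k ^ n := by
  obtain ⟨c, hc⟩ := h
  obtain ⟨N, hN⟩ := exists_lift c
  obtain ⟨r, hr, rfl⟩ := hN (N + j) (by omega)
  refine ⟨i + N, r, ?_⟩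
  refine eq_of_toB_eq (n := i + (N + j)) ?_ (hp.mul hr) ?_
  · have := hq.mul (isWeightedHomogeneous_polyDet.pow (i + N))
    convert this using 1
    simp
    ring
  · rw [map_mul, map_pow, toB_polyDet, one_pow, mul_one, map_mul, hc]

/-- Divisibility in `B` lifts up to a power of `polyDet k`, and a prime that does not divide
`polyDet k` ignores such a power. -/
lemma prime_toB {p : MvPolynomial (Fin 2 × Fin 2) k} {i : ℕ}
    (hp : p.IsWeightedHomogeneous rowWeight i) (hpp : Prime p) (hd : ¬ p ∣ polyDet k) :
    Prime (toB k p) := by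
  refine ⟨fun h => hpp.ne_zero (IsWeightedHomogeneous.eq_zero_of_toB hp h), fun h => ?_, ?_⟩
  · rw [isUnit_iff_dvd_one, ← map_one (toB k)] at h
    obtain ⟨n, hn⟩ := exists_dvd_mul_polyDet_pow hp (isWeightedHomogeneous_one k rowWeight) h
    rw [one_mul] at hn
    exact hd (hpp.dvd_of_dvd_pow hn)
  · intro a b hab
    obtain ⟨N, hN⟩ := exists_lift a
    obtain ⟨M, hM⟩ := exists_lift b
    obtain ⟨q, hq, rfl⟩ := hN N le_rfl
    obtain ⟨r, hr, rfl⟩ := hM M le_rfl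
    rw [← map_mul] at hab
    obtain ⟨n, hn⟩ := exists_dvd_mul_polyDet_pow hp (hq.mul hr) hab
    rcases hpp.dvd_or_dvd hn with h | h
    · exact (hpp.dvd_or_dvd h).imp (map_dvd _) (map_dvd _)
    · exact absurd (hpp.dvd_of_dvd_pow h) hd

/-- The coordinate ring of `SL₂` is factorial. -/
instance : UniqueFactorizationMonoid (B k) := by
  refine UniqueFactorizationMonoid.of_exists_prime_factors fun b hb => ?_
  obtain ⟨N, hN⟩ := exists_lift b
  obtain ⟨q, hq, rfl⟩ := hN N le_rfl
  clear hN
  induction q using UniqueFactorizationMonoid.induction_on_prime generalizing N with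
  | h₁ => exact absurd (map_zero _) hb
  | h₂ u hu => exact ⟨0, by simp, by
      rw [Multiset.prod_zero]; exact (associated_one_iff_isUnit.2 (hu.map _)).symm⟩
  | h₃ a p ha hp ih =>
    obtain ⟨i, j, -, h1, h2⟩ := isWeightedHomogeneous_of_mul hq (mul_ne_zero hp.ne_zero ha)
    rw [map_mul] at hb ⊢
    obtain ⟨f, hf, hfa⟩ := ih j h2 (right_ne_zero_of_mul hb)
    -- Prime factors of a homogeneous lift are homogeneous; those dividing `polyDet k` become units
    -- in `B`, the others stay prime.
    by_cases hd : p ∣ polyDet k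
    · refine ⟨f, hf, hfa.trans ?_⟩
      have hu : IsUnit (toB k p) := isUnit_iff_dvd_one.2 (toB_polyDet (k := k) ▸ map_dvd _ hd)
      exact (associated_unit_mul_left _ _ hu).symm
    · refine ⟨toB k p ::ₘ f, ?_, ?_⟩
      · intro b hb
        rcases Multiset.mem_cons.1 hb with rfl | hb
        · exact prime_toB h1 hp hd
        · exact hf b hb
      · rw [Multiset.prod_cons]
        exact hfa.mul_left _

/-- Pairing the entry `(0, i)` with `(1, 1 - i)` turns the determinant into a bilinear form with
coefficients `1, -1`, irreducible since two of them are nonzero and they have no common factor. -/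
lemma prime_polyDet : Prime (polyDet k) := by
  let e : Fin 2 ⊕ Fin 2 ≃ Fin 2 × Fin 2 :=
    { toFun := Sum.elim (fun i => (0, i)) (fun i => (1, 1 - i))
      invFun := fun p => if p.1 = 0 then .inl p.2 else .inr (1 - p.2)
      left_inv := by decide
      right_inv := by decide }
  let c : Fin 2 →₀ k := Finsupp.equivFunOnFinite.symm ![1, -1]
  have h := irreducible_sumSMulXSMulY c (by
    refine ⟨0, by simp [c], 1, by simp [c], by decide⟩) (fun r hr => isUnit_of_dvd_one (hr 0))
  have h2 : renameEquiv k e (sumSMulXSMulY c) = polyDet k := by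
    rw [sumSMulXSMulY, Finsupp.linearCombination_apply, Finsupp.sum_fintype _ _ (by simp)]
    simp [e, c, polyDet, sub_eq_add_neg]
  rw [← h2]
  exact ((MulEquiv.irreducible_iff (renameEquiv k e)).2 h).prime

/-- A homogeneous lift of a unit divides a power of the prime `polyDet k`, so it is a constant times
a power of `polyDet k`. -/
lemma eq_algebraMap_of_isUnit {b : B k} (hb : IsUnit b) : ∃ c : k, b = algebraMap k (B k) c := by
  obtain ⟨N, hN⟩ := exists_lift b
  obtain ⟨q, hq, rfl⟩ := hN N le_rfl
  rw [isUnit_iff_dvd_one, ← map_one (toB k)] at hb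
  obtain ⟨n, hn⟩ := exists_dvd_mul_polyDet_pow hq (isWeightedHomogeneous_one k rowWeight) hb
  rw [one_mul] at hn
  obtain ⟨m, -, u, hu⟩ := (dvd_prime_pow prime_polyDet n).1 hn
  obtain ⟨c, hc, hc2⟩ := MvPolynomial.isUnit_iff_eq_C_of_isReduced.1 (u⁻¹).isUnit
  refine ⟨c, ?_⟩
  rw [← Units.eq_mul_inv_iff_mul_eq] at hu
  rw [hu, hc2, map_mul, map_pow, toB_polyDet, one_pow, one_mul]
  exact (toB k).commutes c

end

end SLTwo

/-! ### Cyclic groups -/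

namespace SLTwo

noncomputable section

open MvPolynomial

variable {k : Type*} [Field k]

lemma formMul_psi_monomial (ζ : kˣ) (e : Fin 2 →₀ ℕ) (r : k) :
    formMul (psi ζ) (monomial e r) = monomial e (((ζ : k) ^ e 0 * (↑ζ⁻¹ : k) ^ e 1) * r) := by
  have h0 : formMul (psi ζ) (X 0) = C (ζ : k) * X 0 := by
    rw [formMul_X]; simp [psi, mul_comm]
  have h1 : formMul (psi ζ) (X 1) = C (↑ζ⁻¹ : k) * X 1 := by
    rw [formMul_X]; simp [psi, mul_comm]
  rw [monomial_eq, monomial_eq, Finsupp.prod_fintype _ _ (by simp), Fin.prod_univ_two, map_mul, map_mul,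
    map_pow, map_pow, h0, h1, ← algebraMap_eq, AlgHom.commutes, algebraMap_eq, C_mul, C_mul, C_pow, C_pow]
  ring

lemma coeff_formMul_psi (ζ : kˣ) (e : Fin 2 →₀ ℕ) (g : MvPolynomial (Fin 2) k) :
    coeff e (formMul (psi ζ) g) = ((ζ : k) ^ e 0 * (↑ζ⁻¹ : k) ^ e 1) * coeff e g := by
  classical
  induction g using MvPolynomial.induction_on' with
  | monomial a b =>
    rw [formMul_psi_monomial, coeff_monomial, coeff_monomial]
    split_ifs with h
    · rw [h]
    · rw [mul_zero]
  | add p q hp hq => rw [map_add, coeff_add, coeff_add, hp, hq, mul_add]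

lemma modEq_of_formMul_psi {ζ : kˣ} {n : ℕ} (hζ : IsPrimitiveRoot ζ n) {g : MvPolynomial (Fin 2) k}
    (hg : formMul (psi ζ) g = g) {e : Fin 2 →₀ ℕ} (he : coeff e g ≠ 0) : e 0 ≡ e 1 [MOD n] := by
  have h := coeff_formMul_psi ζ e g
  rw [hg] at h
  have h1 : (ζ : k) ^ e 0 * (↑ζ⁻¹ : k) ^ e 1 = 1 := mul_right_cancel₀ he (by rw [← h, one_mul])
  rw [hζ.eq_orderOf, ← pow_eq_pow_iff_modEq]
  have h2 : ζ ^ e 0 * ζ⁻¹ ^ e 1 = 1 := Units.ext (by rw [Units.val_mul, Units.val_pow_eq_pow_val, Units.val_pow_eq_pow_val, h1, Units.val_one])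
  rwa [inv_pow, mul_inv_eq_one] at h2

lemma formToB_monomial (e : Fin 2 →₀ ℕ) (r : k) :
    formToB k (monomial e r) = r • (x k ^ e 0 * y k ^ e 1) := by
  rw [monomial_eq, Finsupp.prod_fintype _ _ (by simp), Fin.prod_univ_two]
  rw [map_mul, map_mul, map_pow, map_pow, formToB_X_zero, formToB_X_one, ← algebraMap_eq,
    AlgHom.commutes, ← Algebra.smul_def]

lemma pow_mul_pow_mem {A : Subalgebra k (B k)} {n : ℕ} (hx : x k ^ n ∈ A) (hy : y k ^ n ∈ A)
    (hxy : x k * y k ∈ A) {a b : ℕ} (hab : a ≡ b [MOD n]) : x k ^ a * y k ^ b ∈ A := by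
  rcases le_total a b with h | h
  · obtain ⟨t, ht⟩ := (Nat.modEq_iff_dvd' h).1 hab
    obtain rfl : b = a + n * t := by omega
    have : x k ^ a * y k ^ (a + n * t) = (x k * y k) ^ a * (y k ^ n) ^ t := by
      rw [pow_add, pow_mul]; ring
    rw [this]
    exact A.mul_mem (A.pow_mem hxy _) (A.pow_mem hy _)
  · obtain ⟨t, ht⟩ := (Nat.modEq_iff_dvd' h).1 hab.symm
    obtain rfl : a = b + n * t := by omega
    have : x k ^ (b + n * t) * y k ^ b = (x k * y k) ^ b * (x k ^ n) ^ t := by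
      rw [pow_add, pow_mul]; ring
    rw [this]
    exact A.mul_mem (A.pow_mem hxy _) (A.pow_mem hx _)

lemma formToB_mem_of_formMul_psi {A : Subalgebra k (B k)} {ζ : kˣ} {n : ℕ} (hζ : IsPrimitiveRoot ζ n)
    (hx : x k ^ n ∈ A) (hy : y k ^ n ∈ A) (hxy : x k * y k ∈ A) {g : MvPolynomial (Fin 2) k}
    (hg : formMul (psi ζ) g = g) : formToB k g ∈ A := by
  rw [← support_sum_monomial_coeff g, map_sum]
  refine A.sum_mem fun e he => ?_
  rw [formToB_monomial]
  exact A.smul_mem (pow_mul_pow_mem hx hy hxy (modEq_of_formMul_psi hζ hg (mem_support_iff.1 he))) _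

lemma upsilon_x_pow (n : ℕ) : upsilon (x k ^ n) = n * x k ^ (n - 1) * z k := by
  rw [Derivation.leibniz_pow, upsilon_x, smul_eq_mul, nsmul_eq_mul, mul_assoc]

lemma upsilon_y_pow (n : ℕ) : upsilon (y k ^ n) = n * y k ^ (n - 1) * w k := by
  rw [Derivation.leibniz_pow, upsilon_y, smul_eq_mul, nsmul_eq_mul, mul_assoc]

lemma natCast_mul_mem_iff [CharZero k] {A : Subalgebra k (B k)} {n : ℕ} (hn : n ≠ 0) {b : B k} :
    (n : B k) * b ∈ A ↔ b ∈ A := by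
  refine ⟨fun h => ?_, fun h => A.mul_mem (natCast_mem A n) h⟩
  have := A.smul_mem h ((n : k)⁻¹)
  rwa [Algebra.smul_def, ← mul_assoc, ← map_natCast (algebraMap k (B k)) n, ← map_mul,
    inv_mul_cancel₀ (Nat.cast_ne_zero.2 hn), map_one, one_mul] at this

/-- This is the transvectant of order `r` of `x ^ (a + r) + y ^ (a + r)` with itself. The two pure
terms carry the factor `(-1 + 1) ^ r = 0`; the two cross terms are `(x * y) ^ a` times `r`-th powers
of `∓(x * w - y * z)`, which add up because `r` is even. -/
lemma sum_antidiagonal_polarization {R : Type*} [CommRing R] {x y z w : R} (h : x * w - y * z = 1)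
    {r : ℕ} (hr : Even r) (hr0 : r ≠ 0) (a : ℕ) :
    ∑ m ∈ Finset.HasAntidiagonal.antidiagonal r, r.choose m.1 • ((-1) ^ m.1 *
      ((x ^ (a + m.1) * z ^ m.2 + y ^ (a + m.1) * w ^ m.2) *
        (x ^ (a + m.2) * z ^ m.1 + y ^ (a + m.2) * w ^ m.1))) = 2 * (x * y) ^ a := by
  have h0 := ((Commute.all (-1 : R) 1).add_pow' r).symm
  have h1 := ((Commute.all (-(x * w)) (y * z)).add_pow' r).symm
  have h2 := ((Commute.all (-(y * z)) (x * w)).add_pow' r).symm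
  rw [neg_add_cancel, zero_pow hr0] at h0
  rw [show -(x * w) + y * z = -1 by linear_combination - h, hr.neg_one_pow] at h1
  rw [show -(y * z) + x * w = 1 by linear_combination h, one_pow] at h2
  have key : 2 * (x * y) ^ a = (x ^ (2 * a + r) * z ^ r + y ^ (2 * a + r) * w ^ r) *
      (∑ m ∈ Finset.HasAntidiagonal.antidiagonal r, r.choose m.1 • ((-1) ^ m.1 * 1 ^ m.2)) +
      (x * y) ^ a * (∑ m ∈ Finset.HasAntidiagonal.antidiagonal r,
        r.choose m.1 • ((-(x * w)) ^ m.1 * (y * z) ^ m.2)) +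
      (x * y) ^ a * (∑ m ∈ Finset.HasAntidiagonal.antidiagonal r,
        r.choose m.1 • ((-(y * z)) ^ m.1 * (x * w) ^ m.2)) := by
    rw [h0, h1, h2]
    ring
  rw [key, Finset.mul_sum, Finset.mul_sum, Finset.mul_sum, ← Finset.sum_add_distrib,
    ← Finset.sum_add_distrib]
  refine Finset.sum_congr rfl fun m hm => ?_
  obtain rfl := Finset.HasAntidiagonal.mem_antidiagonal.1 hm
  simp only [nsmul_eq_mul, neg_pow (x * w), neg_pow (y * z), pow_add, mul_pow, one_pow]
  ring

section Transvectants

variable {A : Subalgebra k (B k)} (hA : ∀ a ∈ A, upsilon a ∈ A)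

include hA in
-- The Jacobian of `x y` and `x ^ n + y ^ n` is a multiple of `y ^ n - x ^ n`.
lemma x_pow_mem_and_y_pow_mem [CharZero k] {n : ℕ} (hn : n ≠ 0) (hxy : x k * y k ∈ A)
    (h : x k ^ n + y k ^ n ∈ A) : x k ^ n ∈ A ∧ y k ^ n ∈ A := by
  obtain ⟨m, rfl⟩ : ∃ m, n = m + 1 := Nat.exists_eq_succ_of_ne_zero hn
  have h1 : 2 * (x k * y k) * upsilon (x k ^ (m + 1) + y k ^ (m + 1)) -
      (m + 1 : ℕ) * (x k ^ (m + 1) + y k ^ (m + 1)) * upsilon (x k * y k) =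
        (m + 1 : ℕ) * (y k ^ (m + 1) - x k ^ (m + 1)) := by
    simp only [map_add, upsilon_x_pow, upsilon_y_pow, Derivation.leibniz, upsilon_x, upsilon_y, smul_eq_mul,
      Nat.add_sub_cancel]
    push_cast
    linear_combination ((m : B k) + 1) * (y k ^ (m + 1) - x k ^ (m + 1)) * det_eq (k := k)
  have h2 : y k ^ (m + 1) - x k ^ (m + 1) ∈ A := by
    rw [← natCast_mul_mem_iff hn, ← h1]
    refine A.sub_mem (A.mul_mem (A.mul_mem (ofNat_mem A 2) hxy) (hA _ h)) ?_
    exact A.mul_mem (A.mul_mem (natCast_mem A _) h) (hA _ hxy)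
  constructor
  · rw [← natCast_mul_mem_iff two_ne_zero]
    convert A.sub_mem h h2 using 1
    push_cast; ring
  · rw [← natCast_mul_mem_iff two_ne_zero]
    convert A.add_mem h h2 using 1
    push_cast; ring

include hA in
lemma polarization_mem [CharZero k] {i j : ℕ} (h : x k ^ (i + j) + y k ^ (i + j) ∈ A) :
    x k ^ i * z k ^ j + y k ^ i * w k ^ j ∈ A := by
  induction j generalizing i with
  | zero => simpa using h
  | succ j ih =>
    have h1 := hA _ (ih (i := i + 1) (by rwa [add_right_comm]))
    have h2 : upsilon (x k ^ (i + 1) * z k ^ j + y k ^ (i + 1) * w k ^ j) =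
        (i + 1 : ℕ) * (x k ^ i * z k ^ (j + 1) + y k ^ i * w k ^ (j + 1)) := by
      simp only [map_add, Derivation.leibniz, Derivation.leibniz_pow, upsilon_x, upsilon_y, upsilon_z,
        upsilon_w, smul_eq_mul, nsmul_eq_mul, Nat.add_sub_cancel]
      push_cast
      ring
    rwa [h2, natCast_mul_mem_iff (Nat.succ_ne_zero i)] at h1

include hA in
lemma xy_pow_mem_of_power_sum [CharZero k] {a r : ℕ} (hr : Even r) (hr0 : r ≠ 0)
    (h : x k ^ (a + r) + y k ^ (a + r) ∈ A) : (x k * y k) ^ a ∈ A := by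
  have key := sum_antidiagonal_polarization (det_eq (k := k)) hr hr0 a
  rw [← natCast_mul_mem_iff two_ne_zero, Nat.cast_ofNat, ← key]
  refine A.sum_mem fun m hm => A.nsmul_mem (A.mul_mem (A.pow_mem (A.neg_mem A.one_mem) _)
    (A.mul_mem ?_ ?_)) _
  · exact polarization_mem hA (by rwa [add_assoc, Finset.HasAntidiagonal.mem_antidiagonal.1 hm])
  · exact polarization_mem hA (by rwa [add_assoc, add_comm m.2, Finset.HasAntidiagonal.mem_antidiagonal.1 hm])

end Transvectants

/-- Invariants of the cyclic group of order `n`. -/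
theorem invariants_cyclic_eq_adjoin_pair [CharZero k] {n : ℕ} (hn : 2 ≤ n) {ζ : kˣ}
    (hζ : IsPrimitiveRoot ζ n) :
    invariants (cyclic ζ) = Algebra.adjoin k ((hat n (x k ^ n + y k ^ n) : Set (B k)) ∪
      (hat 2 (x k * y k) : Set (B k))) := by
  have e1 : x k ^ n + y k ^ n = formToB k (X 0 ^ n + X 1 ^ n) := by simp
  have e2 : x k * y k = formToB k (X 0 * X 1) := by simp
  have d1 : (X 0 ^ n + X 1 ^ n : MvPolynomial (Fin 2) k).IsHomogeneous n :=
    (isHomogeneous_X_pow _ _).add (isHomogeneous_X_pow _ _)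
  have d2 : (X 0 * X 1 : MvPolynomial (Fin 2) k).IsHomogeneous 2 :=
    (isHomogeneous_X _ _).mul (isHomogeneous_X _ _)
  have h0 : rightMul (psi ζ) (x k) = (ζ : k) • x k := by
    rw [← formToB_X_zero, rightMul_formToB, formMul_X]
    simp [psi, MvPolynomial.C_eq_smul_one]
  have h1 : rightMul (psi ζ) (y k) = (↑ζ⁻¹ : k) • y k := by
    rw [← formToB_X_one, rightMul_formToB, formMul_X]
    simp [psi, MvPolynomial.C_eq_smul_one]
  have hT : ∀ t ∈ ((hat n (x k ^ n + y k ^ n) : Set (B k)) ∪ (hat 2 (x k * y k) : Set (B k))),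
      upsilon t ∈ Algebra.adjoin k ((hat n (x k ^ n + y k ^ n) : Set (B k)) ∪
      (hat 2 (x k * y k) : Set (B k))) := by
    rintro t (ht | ht)
    · refine Algebra.subset_adjoin (Or.inl ?_)
      rw [e1] at ht ⊢
      exact upsilon_mem_hat d1 ht
    · refine Algebra.subset_adjoin (Or.inr ?_)
      rw [e2] at ht ⊢
      exact upsilon_mem_hat d2 ht
  refine invariants_closure_eq_adjoin {psi ζ} _ hT ?_ ?_
  · have hz : (ζ : k) ^ n = 1 := by rw [← Units.val_pow_eq_pow_val, hζ.pow_eq_one, Units.val_one]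
    have hz' : (↑ζ⁻¹ : k) ^ n = 1 := by
      rw [← Units.val_pow_eq_pow_val, inv_pow, hζ.pow_eq_one, inv_one, Units.val_one]
    rintro _ rfl t (ht | ht)
    · refine rightMul_eq_of_mem_hat ?_ ht
      rw [map_add, map_pow, map_pow, h0, h1, smul_pow, smul_pow, hz, hz', one_smul, one_smul]
    · refine rightMul_eq_of_mem_hat ?_ ht
      rw [map_mul, h0, h1, smul_mul_smul_comm, Units.mul_inv, one_smul]
  · intro d g _ hg
    have hxy : x k * y k ∈ Algebra.adjoin k ((hat n (x k ^ n + y k ^ n) : Set (B k)) ∪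
      (hat 2 (x k * y k) : Set (B k))) := Algebra.subset_adjoin (Or.inr (self_mem_hat _ _))
    obtain ⟨hx, hy⟩ := x_pow_mem_and_y_pow_mem (fun a ha => upsilon_mem_adjoin hT ha) (n := n) (by omega)
      hxy (Algebra.subset_adjoin (Or.inl (self_mem_hat _ _)))
    exact formToB_mem_of_formMul_psi hζ hx hy hxy (hg _ rfl)

lemma formMul_psi_X_zero (ζ : kˣ) : formMul (psi ζ) (X 0) = C (ζ : k) * X 0 := by
  rw [formMul_X]; simp [psi, mul_comm]

lemma formMul_psi_X_one (ζ : kˣ) : formMul (psi ζ) (X 1) = C (↑ζ⁻¹ : k) * X 1 := by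
  rw [formMul_X]; simp [psi, mul_comm]

lemma formMul_C (h : Matrix.SpecialLinearGroup (Fin 2) k) (c : k) : formMul h (C c) = C c :=
  (formMul h).commutes c

lemma formMul_psi_monomial' {ζ : kˣ} {n : ℕ} (hζ : ζ ^ n = 1) {a b : ℕ} (hab : a ≡ b [MOD n]) :
    formMul (psi ζ) (X 0 ^ a * X 1 ^ b) = X 0 ^ a * X 1 ^ b := by
  have h : ζ ^ a = ζ ^ b := pow_eq_pow_iff_modEq.2 (hab.of_dvd (orderOf_dvd_of_pow_eq_one hζ))
  have h2 : (C (ζ : k) ^ a * C (↑ζ⁻¹ : k) ^ b : MvPolynomial (Fin 2) k) = 1 := by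
    rw [← C_pow, ← C_pow, ← C_mul, ← Units.val_pow_eq_pow_val, ← Units.val_pow_eq_pow_val, h, inv_pow,
      Units.mul_inv, C_1]
  rw [map_mul, map_pow, map_pow, formMul_psi_X_zero, formMul_psi_X_one]
  linear_combination X 0 ^ a * X 1 ^ b * h2

theorem invariants_cyclic_of_odd [CharZero k] {n : ℕ} (hn : 3 ≤ n) (ho : Odd n) {ζ : kˣ}
    (hζ : IsPrimitiveRoot ζ n) :
    invariants (cyclic ζ) = Algebra.adjoin k (hat n (x k ^ n + y k ^ n) : Set (B k)) := by
  have e1 : x k ^ n + y k ^ n = formToB k (X 0 ^ n + X 1 ^ n) := by simp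
  rw [e1]
  refine invariants_closure_eq_adjoin_hat {psi ζ}
    ((isHomogeneous_X_pow _ _).add (isHomogeneous_X_pow _ _)) ?_ ?_
  · rintro _ rfl
    have h0 := formMul_psi_monomial' hζ.pow_eq_one (a := n) (b := 0) (by simp [Nat.ModEq])
    have h1 := formMul_psi_monomial' hζ.pow_eq_one (a := 0) (b := n) (by simp [Nat.ModEq])
    rw [pow_zero, mul_one] at h0
    rw [pow_zero, one_mul] at h1
    rw [map_add, h0, h1]
  · intro A hA hf d g _ hg
    rw [← e1] at hf
    have hxy : x k * y k ∈ A := by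
      rw [← pow_one (x k * y k)]
      -- The order `n - 1` leaves exactly `x y`. It is even since `n` is odd; a self-transvectant of
      -- odd order vanishes.
      refine xy_pow_mem_of_power_sum hA (r := n - 1) ?_ (by omega) ?_
      · exact (Nat.even_sub (by omega)).2 (by simp [Nat.not_even_iff_odd.2 ho])
      · rwa [Nat.add_sub_cancel' (by omega)]
    obtain ⟨hx, hy⟩ := x_pow_mem_and_y_pow_mem hA (n := n) (by omega) hxy hf
    exact formToB_mem_of_formMul_psi hζ hx hy hxy (hg _ rfl)

end

end SLTwo

/-! ### Binary dihedral groups -/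

namespace SLTwo

noncomputable section

open MvPolynomial

variable {k : Type*} [Field k]

lemma formMul_quatJ_X_zero : formMul (k := k) quatJ (X 0) = - X 1 := by
  rw [formMul_X]; simp [quatJ]

lemma formMul_quatJ_X_one : formMul (k := k) quatJ (X 1) = X 0 := by
  rw [formMul_X]; simp [quatJ]

lemma formMul_quatJ_monomial (e : Fin 2 →₀ ℕ) (r : k) :
    formToB k (formMul quatJ (monomial e r)) = r • ((-1) ^ e 0 * (x k ^ e 1 * y k ^ e 0)) := by
  rw [monomial_eq, Finsupp.prod_fintype _ _ (by simp), Fin.prod_univ_two, map_mul, map_mul (formMul quatJ),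
    map_pow, map_pow, formMul_quatJ_X_zero, formMul_quatJ_X_one, formMul_C, map_mul, map_mul, map_pow,
    map_pow, map_neg, formToB_X_zero, formToB_X_one, ← algebraMap_eq, AlgHom.commutes, ← Algebra.smul_def,
    show (-y k) ^ e 0 = (-1) ^ e 0 * y k ^ e 0 by rw [← mul_pow]; congr 1; ring]
  congr 1
  ring

section Transvectants

variable {A : Subalgebra k (B k)} (hA : ∀ a ∈ A, upsilon a ∈ A)

include hA in
-- The Jacobian of `(x y) ^ 2` and `x ^ n + y ^ n`.
lemma xy_mul_sub_mem [CharZero k] {n : ℕ} (hn : n ≠ 0) (hxy : x k ^ 2 * y k ^ 2 ∈ A)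
    (h : x k ^ n + y k ^ n ∈ A) : x k * y k * (y k ^ n - x k ^ n) ∈ A := by
  obtain ⟨m, rfl⟩ : ∃ m, n = m + 1 := Nat.exists_eq_succ_of_ne_zero hn
  have h1 : 4 * (x k ^ 2 * y k ^ 2) * upsilon (x k ^ (m + 1) + y k ^ (m + 1)) -
      ((m + 1 : ℕ) : B k) * (x k ^ (m + 1) + y k ^ (m + 1)) * upsilon (x k ^ 2 * y k ^ 2) =
        ((2 * (m + 1) : ℕ) : B k) * (x k * y k * (y k ^ (m + 1) - x k ^ (m + 1))) := by
    simp only [map_add, upsilon_x_pow, upsilon_y_pow, Derivation.leibniz, smul_eq_mul,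
      Nat.add_sub_cancel]
    push_cast
    linear_combination 2 * ((m : B k) + 1) * (x k * y k) * (y k ^ (m + 1) - x k ^ (m + 1)) *
      det_eq (k := k)
  rw [← natCast_mul_mem_iff (n := 2 * (m + 1)) (by omega), ← h1]
  refine A.sub_mem (A.mul_mem (A.mul_mem (ofNat_mem A 4) hxy) (hA _ h)) ?_
  exact A.mul_mem (A.mul_mem (natCast_mem A _) h) (hA _ hxy)

include hA in
-- With `u = x ^ (2 n)` and `v = y ^ (2 n)`, the sequences `u ^ t + v ^ t` and `v ^ t - u ^ t` both
-- satisfy the recurrence with coefficients `u + v` and `-u v`.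
lemma power_sums_mem [CharZero k] {n : ℕ} (hxy : x k ^ 2 * y k ^ 2 ∈ A) (hn : n ≠ 0)
    (h : x k ^ (2 * n) + y k ^ (2 * n) ∈ A) (t : ℕ) :
    x k ^ (2 * n * t) + y k ^ (2 * n * t) ∈ A ∧
      x k * y k * (y k ^ (2 * n * t) - x k ^ (2 * n * t)) ∈ A := by
  have hp : x k ^ (2 * n) * y k ^ (2 * n) ∈ A := by
    have := A.pow_mem hxy n
    rwa [mul_pow, ← pow_mul, ← pow_mul] at this
  have hd := xy_mul_sub_mem hA (n := 2 * n) (by omega) hxy h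
  simp only [pow_mul _ (2 * n) t]
  induction t using Nat.twoStepInduction with
  | zero =>
    simp only [pow_zero, sub_self, mul_zero]
    exact ⟨A.add_mem A.one_mem A.one_mem, A.zero_mem⟩
  | one => simp only [pow_one]; exact ⟨h, hd⟩
  | more t h1 h2 =>
    generalize x k ^ (2 * n) = u at *
    generalize y k ^ (2 * n) = v at *
    constructor
    · convert A.sub_mem (A.mul_mem h h2.1) (A.mul_mem hp h1.1) using 1
      ring
    · convert A.sub_mem (A.mul_mem h h2.2) (A.mul_mem hp h1.2) using 1
      ring

include hA in
-- The element is the sum of a monomial and its image under `quatJ`. Up to sign it is a power of `x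
-- y` times a sum or a difference of powers, according to the parity of the smaller exponent; an odd
-- power has the spare `x y` that the difference needs.
lemma symmetrized_monomial_mem [CharZero k] {n : ℕ} (hxy : x k ^ 2 * y k ^ 2 ∈ A) (hn : n ≠ 0)
    (h : x k ^ (2 * n) + y k ^ (2 * n) ∈ A) {a b : ℕ} (hab : a ≡ b [MOD 2 * n]) :
    x k ^ a * y k ^ b + (-1) ^ a * (x k ^ b * y k ^ a) ∈ A := by
  have key : ∀ a t : ℕ, (x k * y k) ^ a * (y k ^ (2 * n * t) + (-1) ^ a * x k ^ (2 * n * t)) ∈ A := by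
    intro a t
    obtain ⟨h1, h2⟩ := power_sums_mem hA hxy hn h t
    have h3 : (x k * y k) ^ 2 ∈ A := by rwa [mul_pow]
    have hm : (-1 : B k) ^ 2 = 1 := by ring
    rcases Nat.even_or_odd' a with ⟨c, rfl | rfl⟩
    · rw [pow_mul, pow_mul _ 2 c, hm, one_pow, one_mul, add_comm (y k ^ _)]
      exact A.mul_mem (A.pow_mem h3 c) h1
    · rw [pow_succ, pow_mul, pow_succ (-1) (2 * c), pow_mul _ 2 c, hm, one_pow, mul_assoc]
      convert A.mul_mem (A.pow_mem h3 c) h2 using 1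
      ring
  have hs : ∀ t, (-1 : B k) ^ (2 * n * t) = 1 := fun t => by
    rw [mul_assoc, pow_mul, show (-1 : B k) ^ 2 = 1 by ring, one_pow]
  rcases le_total a b with hle | hle
  · obtain ⟨t, ht⟩ := (Nat.modEq_iff_dvd' hle).1 hab
    obtain rfl : b = a + 2 * n * t := by omega
    convert key a t using 1
    rw [pow_add, pow_add, mul_pow]
    ring
  · obtain ⟨t, ht⟩ := (Nat.modEq_iff_dvd' hle).1 hab.symm
    obtain rfl : a = b + 2 * n * t := by omega
    have h4 := A.mul_mem (A.pow_mem (A.neg_mem A.one_mem) b) (key b t)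
    have h5 : ((-1 : B k) ^ b) * (-1) ^ b = 1 := by
      rw [← mul_pow, show (-1 : B k) * -1 = 1 by ring, one_pow]
    convert h4 using 1
    rw [pow_add, pow_add, pow_add, hs, mul_pow]
    linear_combination - x k ^ b * y k ^ b * x k ^ (2 * n * t) * h5

end Transvectants

/-- Averaging: `2 g` is the sum of `g` and its image under `quatJ`, and the latter sum is taken
monomial by monomial. -/
lemma formToB_mem_of_formMul_quatJ [CharZero k] {A : Subalgebra k (B k)} {ζ : kˣ} {n : ℕ}
    (hζ : IsPrimitiveRoot ζ n)
    (hmem : ∀ a b : ℕ, a ≡ b [MOD n] → x k ^ a * y k ^ b + (-1) ^ a * (x k ^ b * y k ^ a) ∈ A)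
    {g : MvPolynomial (Fin 2) k} (hg : formMul (psi ζ) g = g) (hj : formMul quatJ g = g) :
    formToB k g ∈ A := by
  have h2 : formToB k g + formToB k (formMul quatJ g) ∈ A := by
    rw [← map_add, ← support_sum_monomial_coeff g, map_sum, ← Finset.sum_add_distrib, map_sum]
    refine A.sum_mem fun e he => ?_
    rw [map_add, formToB_monomial, formMul_quatJ_monomial, ← smul_add]
    exact A.smul_mem (hmem _ _ (modEq_of_formMul_psi hζ hg (mem_support_iff.1 he))) _
  rw [hj, ← two_mul] at h2
  rwa [← natCast_mul_mem_iff two_ne_zero]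

theorem invariants_binaryDihedral [CharZero k] {n : ℕ} (hn : 2 ≤ n) {ζ : kˣ}
    (hζ : IsPrimitiveRoot ζ (2 * n)) :
    invariants (binaryDihedral ζ) =
      Algebra.adjoin k (hat (2 * n) (x k ^ (2 * n) + y k ^ (2 * n)) : Set (B k)) := by
  have e1 : x k ^ (2 * n) + y k ^ (2 * n) = formToB k (X 0 ^ (2 * n) + X 1 ^ (2 * n)) := by simp
  rw [e1]
  refine invariants_closure_eq_adjoin_hat {psi ζ, quatJ}
    ((isHomogeneous_X_pow _ _).add (isHomogeneous_X_pow _ _)) ?_ ?_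
  · rintro s (rfl | rfl)
    · have h0 := formMul_psi_monomial' hζ.pow_eq_one (a := 2 * n) (b := 0) (by simp [Nat.ModEq])
      have h1 := formMul_psi_monomial' hζ.pow_eq_one (a := 0) (b := 2 * n) (by simp [Nat.ModEq])
      rw [pow_zero, mul_one] at h0
      rw [pow_zero, one_mul] at h1
      rw [map_add, h0, h1]
    · rw [map_add, map_pow, map_pow, formMul_quatJ_X_zero, formMul_quatJ_X_one,
        Even.neg_pow (even_two_mul n), add_comm]
  · intro A hA hf d g _ hg
    rw [← e1] at hf
    have hxy : x k ^ 2 * y k ^ 2 ∈ A := by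
      rw [← mul_pow]
      -- The order `2 n - 2` leaves `(x y) ^ 2`, and it is positive because `n ≥ 2`. The form `x y`
      -- itself changes sign under `quatJ`.
      refine xy_pow_mem_of_power_sum hA (r := 2 * n - 2) ⟨n - 1, by omega⟩ (by omega) ?_
      rwa [Nat.add_sub_cancel' (by omega)]
    exact formToB_mem_of_formMul_quatJ hζ
      (fun a b hab => symmetrized_monomial_mem hA hxy (by omega) hf hab) (hg _ (by simp)) (hg _ (by simp))

end

end SLTwo

/-! ### Cyclic groups of order `2 n`, `n` odd: transvectants by generating functions -/

namespace SLTwo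

noncomputable section

section Polarization

open Polynomial

variable {R : Type*} [CommRing R]

/-- The coefficient at `s ^ q` of `(x + s y) ^ (N - i) * (z + s w) ^ i`, that is, the normalized
`i`-th polarization of the binary form `N.choose q * x ^ (N - q) * y ^ q`. -/
def polar (x y z w : R) (N i q : ℕ) : R :=
  ((C x + X * C y) ^ (N - i) * (C z + X * C w) ^ i).coeff q

/-- Applied to coefficients, `d` sends `x + s y` to `z + s w` and this to `0`. -/
lemma deriv_polar (d : Derivation ℤ R R) {x y z w : R} (hx : d x = z) (hy : d y = w) (hz : d z = 0)
    (hw : d w = 0) (N i q : ℕ) :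
    d (polar x y z w N i q) = (N - i : ℕ) * polar x y z w N (i + 1) q := by
  let _ : Differential R := ⟨d⟩
  have hd : ∀ a : R, Differential.deriv a = d a := fun _ => rfl
  have h := Differential.coeff_mapCoeffs ((C x + X * C y) ^ (N - i) * (C z + X * C w) ^ i) q
  rw [hd] at h
  rw [polar, ← h]
  have h1 : Differential.mapCoeffs (C x + X * C y) = C z + X * C w := by
    simp [Derivation.leibniz, hd, hx, hy]
  have h2 : Differential.mapCoeffs (C z + X * C w) = 0 := by
    simp [Derivation.leibniz, hd, hz, hw]
  have h3 : Differential.mapCoeffs ((C x + X * C y) ^ (N - i) * (C z + X * C w) ^ i) =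
      C ((N - i : ℕ) : R) * ((C x + X * C y) ^ (N - (i + 1)) * (C z + X * C w) ^ (i + 1)) := by
    rw [Derivation.leibniz, Derivation.leibniz_pow, Derivation.leibniz_pow, h1, h2, Nat.sub_sub]
    simp only [smul_eq_mul, nsmul_eq_mul, C_eq_natCast]
    ring_nf
  rw [h3, coeff_C_mul, polar]

lemma polar_zero_right (x y z w : R) {N q : ℕ} (hq : q ≤ N) :
    polar x y z w N 0 q = N.choose q * (x ^ (N - q) * y ^ q) := by
  rw [polar, pow_zero, mul_one, Nat.sub_zero, add_comm, add_pow, finsetSum_coeff,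
    Finset.sum_eq_single q]
  · rw [mul_pow, ← C_pow, ← C_pow, ← C_eq_natCast, mul_assoc (X ^ q), ← C_mul, mul_assoc, ← C_mul,
      mul_comm, coeff_C_mul_X_pow, if_pos rfl]
    ring
  · intro m _ hm
    rw [mul_pow, ← C_pow, ← C_pow, ← C_eq_natCast, mul_assoc (X ^ m), ← C_mul, mul_assoc, ← C_mul,
      mul_comm, coeff_C_mul_X_pow, if_neg hm.symm]
  · intro h
    exact absurd (Finset.mem_range.2 (by omega)) h

/-- The transvectant of order `r` of two forms, in terms of the generating functions
`(x + s y) ^ N` and `(x + t y) ^ M`. -/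
lemma sum_polar_mul_polar {x y z w : R} (h : x * w - y * z = 1) {N M r : ℕ} (hN : r ≤ N) (hM : r ≤ M)
    (p q : ℕ) :
    ∑ m ∈ Finset.HasAntidiagonal.antidiagonal r, r.choose m.1 • ((-1) ^ m.1 *
      (polar x y z w N m.1 p * polar x y z w M m.2 q)) =
    ((C x + X * C y) ^ (N - r) *
      ((C (C x) + X * C (C y)) ^ (M - r) * (X - C X : R[X][X]) ^ r).coeff q).coeff p := by
  have hdet : (C (C x) * C (C w) - C (C y) * C (C z) : R[X][X]) = 1 := by
    rw [← C_mul, ← C_mul, ← C_mul, ← C_mul, ← C_sub, ← C_sub, h, C_1, C_1]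
  set L : R[X][X] := C (C x + X * C y) with hL
  set L' : R[X][X] := C (C z + X * C w) with hL'
  set T : R[X][X] := C (C x) + X * C (C y) with hT
  set T' : R[X][X] := C (C z) + X * C (C w) with hT'
  have key : C ((C x + X * C y) ^ (N - r)) * (T ^ (M - r) * (X - C X : R[X][X]) ^ r) =
      ∑ m ∈ Finset.HasAntidiagonal.antidiagonal r, r.choose m.1 • ((-1) ^ m.1 *
        (C ((C x + X * C y) ^ (N - m.1) * (C z + X * C w) ^ m.1) *
          ((C x + X * C y) ^ (M - m.2) * (C z + X * C w) ^ m.2).map C)) := by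
    -- The bracket of `x + s y` and `x + t y` is `t - s`, where `s` is the inner and `t` the outer
    -- variable.
    have h1 : (X - C X : R[X][X]) = -(L' * T) + L * T' := by
      simp only [hL, hL', hT, hT', C_add, C_mul]
      linear_combination -(X - C X) * hdet
    rw [h1, (Commute.all _ _).add_pow' r, Finset.mul_sum, Finset.mul_sum]
    refine Finset.sum_congr rfl fun m hm => ?_
    obtain rfl := Finset.HasAntidiagonal.mem_antidiagonal.1 hm
    have e1 : N - m.1 = (N - (m.1 + m.2)) + m.2 := by omega
    have e2 : M - m.2 = (M - (m.1 + m.2)) + m.1 := by omega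
    rw [e1, e2]
    simp only [C_mul, C_pow, Polynomial.map_mul, Polynomial.map_pow, Polynomial.map_add, map_C, map_X,
      ← hL, ← hL', ← hT, ← hT', nsmul_eq_mul, neg_pow (L' * T)]
    ring_nf
  rw [← coeff_C_mul, key, finsetSum_coeff, finsetSum_coeff]
  refine Finset.sum_congr rfl fun m _ => ?_
  rw [nsmul_eq_mul, nsmul_eq_mul, ← C_1, ← C_neg, ← C_pow, ← C_1, ← C_neg, ← C_pow, ← C_eq_natCast,
    ← C_eq_natCast, coeff_C_mul, coeff_C_mul, coeff_C_mul, coeff_C_mul, coeff_C_mul, coeff_map, coeff_mul_C]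
  rfl

lemma coeff_sq_mul_zero (x y : R) (P : R[X]) :
    ((C x + X * C y) ^ 2 * P).coeff 0 = x ^ 2 * P.coeff 0 := by
  have : (C x + X * C y) ^ 2 * P = C (x ^ 2) * P + X * ((C (2 * x * y) + X * C (y ^ 2)) * P) := by
    simp only [C_mul, C_pow, map_ofNat]
    ring
  rw [this, coeff_add, coeff_C_mul, coeff_X_mul_zero, add_zero]

lemma coeff_sq_mul_add_two (x y : R) (P : R[X]) (j : ℕ) :
    ((C x + X * C y) ^ 2 * P).coeff (j + 2) =
      x ^ 2 * P.coeff (j + 2) + 2 * x * y * P.coeff (j + 1) + y ^ 2 * P.coeff j := by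
  have : (C x + X * C y) ^ 2 * P = C (x ^ 2) * P + X * (C (2 * x * y) * P) +
      X * (X * (C (y ^ 2) * P)) := by
    simp only [C_mul, C_pow, map_ofNat]
    ring
  rw [this, coeff_add, coeff_add, coeff_C_mul, coeff_X_mul, coeff_X_mul, coeff_X_mul, coeff_C_mul,
    coeff_C_mul]

lemma coeff_coeff_sub_pow (r a b : ℕ) :
    (((X - C X : R[X][X]) ^ r).coeff b).coeff a =
      if a + b = r then (-1) ^ a * (r.choose b : R) else 0 := by
  have h : (X - C X : R[X][X]) = X + C (-X) := by rw [C_neg, sub_eq_add_neg]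
  rw [h, coeff_X_add_C_pow, neg_pow, ← C_1, ← C_neg, ← C_pow, ← C_eq_natCast, mul_assoc, mul_comm (X ^ _),
    coeff_C_mul, coeff_C_mul_X_pow]
  rcases le_or_gt b r with hb | hb
  · by_cases hab : a + b = r
    · rw [if_pos (by omega), if_pos hab]
      congr 2
      omega
    · rw [if_neg (by omega), if_neg hab, mul_zero]
  · rw [Nat.choose_eq_zero_of_lt hb]
    simp

lemma coeff_C_sq_mul (x : R) (P : R[X]) (a : ℕ) : (C x ^ 2 * P).coeff a = x ^ 2 * P.coeff a := by
  rw [← C_pow, coeff_C_mul]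

lemma coeff_two_mul_C_mul_C_mul (x y : R) (P : R[X]) (a : ℕ) :
    (2 * C x * C y * P).coeff a = 2 * x * y * P.coeff a := by
  rw [show (2 * C x * C y * P : R[X]) = C (2 * x * y) * P by simp only [C_mul, map_ofNat], coeff_C_mul]

/-- The self-transvectant of order `2 n - 2` of `x ^ (2 n) + (x y) ^ n + y ^ (2 n)`, where
`n = 2 p + 3`, up to the factor `((2 n).choose n) ^ 2`. -/
lemma self_transvectant {x y z w : R} (h : x * w - y * z = 1) (p K : ℕ) (c : R) (F : ℕ → R)
    (hF : ∀ i, F i = c * polar x y z w (4 * p + 6) i 0 + polar x y z w (4 * p + 6) i (2 * p + 3) +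
      c * polar x y z w (4 * p + 6) i (4 * p + 6))
    (hK : K + (4 * p + 4).choose (2 * p + 1) + (4 * p + 4).choose (2 * p + 3) =
      4 * (4 * p + 4).choose (2 * p + 2)) :
    ∑ m ∈ Finset.HasAntidiagonal.antidiagonal (4 * p + 4), (4 * p + 4).choose m.1 • ((-1) ^ m.1 *
      (F m.1 * F m.2)) = (2 * c ^ 2 + K) * (x ^ 2 * y ^ 2) := by
  let S : ℕ → ℕ → R := fun i j => ∑ m ∈ Finset.HasAntidiagonal.antidiagonal (4 * p + 4),
    (4 * p + 4).choose m.1 • ((-1) ^ m.1 *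
      (polar x y z w (4 * p + 6) m.1 i * polar x y z w (4 * p + 6) m.2 j))
  have W : ∀ i j, S i j = _ := fun i j =>
    sum_polar_mul_polar h (N := 4 * p + 6) (M := 4 * p + 6) (r := 4 * p + 4) (by omega) (by omega) i j
  simp only [show 4 * p + 6 - (4 * p + 4) = 2 by omega] at W
  have e0 : (-1 : R) ^ (4 * p + 4) = 1 := Even.neg_one_pow ⟨2 * p + 2, by ring⟩
  have e1 : (-1 : R) ^ (2 * p + 1) = -1 := Odd.neg_one_pow ⟨p, rfl⟩
  have e2 : (-1 : R) ^ (2 * p + 2) = 1 := Even.neg_one_pow ⟨p + 1, by ring⟩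
  have e3 : (-1 : R) ^ (2 * p + 3) = -1 := Odd.neg_one_pow ⟨p + 1, by ring⟩
  -- The generating function `(x + s y) ^ 2 (x + t y) ^ 2 (t - s) ^ (4 p + 4)` has terms only in
  -- total degrees from `4 p + 4` to `4 p + 8` in `s, t`. Of the nine coefficients only `W02`, `W11`
  -- and `W20` survive. Indices are written as `j + 2` to match `coeff_sq_mul_add_two`.
  have W00 := W 0 0
  have W01 := W 0 (2 * p + 1 + 2)
  have W02 := W 0 (4 * p + 4 + 2)
  have W10 := W (2 * p + 1 + 2) 0
  have W11 := W (2 * p + 1 + 2) (2 * p + 1 + 2)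
  have W12 := W (2 * p + 1 + 2) (4 * p + 4 + 2)
  have W20 := W (4 * p + 4 + 2) 0
  have W21 := W (4 * p + 4 + 2) (2 * p + 1 + 2)
  have W22 := W (4 * p + 4 + 2) (4 * p + 4 + 2)
  have hS : ∑ m ∈ Finset.HasAntidiagonal.antidiagonal (4 * p + 4), (4 * p + 4).choose m.1 •
      ((-1) ^ m.1 * (F m.1 * F m.2)) =
      c ^ 2 * S 0 0 + c * S 0 (2 * p + 1 + 2) + c ^ 2 * S 0 (4 * p + 4 + 2) +
      (c * S (2 * p + 1 + 2) 0 + S (2 * p + 1 + 2) (2 * p + 1 + 2) +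
        c * S (2 * p + 1 + 2) (4 * p + 4 + 2)) +
      (c ^ 2 * S (4 * p + 4 + 2) 0 + c * S (4 * p + 4 + 2) (2 * p + 1 + 2) +
        c ^ 2 * S (4 * p + 4 + 2) (4 * p + 4 + 2)) := by
    simp only [S, Finset.mul_sum, ← Finset.sum_add_distrib]
    refine Finset.sum_congr rfl fun m _ => ?_
    rw [hF, hF]
    simp only [nsmul_eq_mul]
    ring
  have hK' : (K : R) = 4 * ((4 * p + 4).choose (2 * p + 2) : R) - ((4 * p + 4).choose (2 * p + 1) : R) -
      ((4 * p + 4).choose (2 * p + 3) : R) := by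
    have := congrArg (Nat.cast (R := R)) hK
    push_cast at this
    linear_combination this
  simp only [coeff_sq_mul_zero, coeff_sq_mul_add_two, coeff_add, coeff_C_sq_mul,
    coeff_two_mul_C_mul_C_mul, coeff_coeff_sub_pow] at W00 W01 W02 W10 W11 W12 W20 W21 W22
  simp (disch := omega) only [if_pos, if_neg, mul_zero, add_zero, zero_add] at W00 W01 W02 W10 W11 W12 W20 W21 W22
  simp only [show 2 * p + 1 + 2 = 2 * p + 3 by omega, show 2 * p + 1 + 1 = 2 * p + 2 by omega,
    e1, e2, e3] at W11
  simp only [if_true, e0, Nat.choose_self, Nat.choose_zero_right] at W02 W20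
  rw [hS, W00, W01, W02, W10, W12, W20, W21, W22, show 2 * p + 1 + 2 = 2 * p + 3 by omega, W11, hK']
  push_cast
  ring

/-- The transvectant of order `2 n` of `(x y) ^ (n + 1)` and `x ^ (2 n) + (x y) ^ n + y ^ (2 n)`, where
`n = 2 p + 3`, up to a constant factor. -/
lemma mixed_transvectant {x y z w : R} (h : x * w - y * z = 1) (p : ℕ) (c : R) (F : ℕ → R)
    (hF : ∀ i, F i = c * polar x y z w (4 * p + 6) i 0 + polar x y z w (4 * p + 6) i (2 * p + 3) +
      c * polar x y z w (4 * p + 6) i (4 * p + 6)) :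
    ∑ m ∈ Finset.HasAntidiagonal.antidiagonal (4 * p + 6), (4 * p + 6).choose m.1 • ((-1) ^ m.1 *
      (polar x y z w (4 * p + 8) m.1 (2 * p + 4) * F m.2)) =
      - (2 * (4 * p + 6).choose (2 * p + 3)) * (x * y) := by
  let S : ℕ → R := fun j => ∑ m ∈ Finset.HasAntidiagonal.antidiagonal (4 * p + 6),
    (4 * p + 6).choose m.1 • ((-1) ^ m.1 *
      (polar x y z w (4 * p + 8) m.1 (2 * p + 4) * polar x y z w (4 * p + 6) m.2 j))
  have W : ∀ j, S j = _ := fun j =>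
    sum_polar_mul_polar h (N := 4 * p + 8) (M := 4 * p + 6) (r := 4 * p + 6) (by omega) (by omega)
      (2 * p + 2 + 2) j
  simp only [show 4 * p + 8 - (4 * p + 6) = 2 by omega, Nat.sub_self, pow_zero, one_mul] at W
  have e3 : (-1 : R) ^ (2 * p + 3) = -1 := Odd.neg_one_pow ⟨p + 1, by ring⟩
  -- In `(x + s y) ^ 2 (t - s) ^ (4 p + 6)` the exponent `2 p + 4` of `s` is compatible only with
  -- the exponent `2 p + 3` of `t`, so the outer terms of the form contribute nothing.
  have W0 := W 0
  have W1 := W (2 * p + 3)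
  have W2 := W (4 * p + 6)
  have hS : ∑ m ∈ Finset.HasAntidiagonal.antidiagonal (4 * p + 6), (4 * p + 6).choose m.1 •
      ((-1) ^ m.1 * (polar x y z w (4 * p + 8) m.1 (2 * p + 4) * F m.2)) =
      c * S 0 + S (2 * p + 3) + c * S (4 * p + 6) := by
    simp only [S, Finset.mul_sum, ← Finset.sum_add_distrib]
    refine Finset.sum_congr rfl fun m _ => ?_
    rw [hF]
    simp only [nsmul_eq_mul]
    ring
  simp only [coeff_sq_mul_add_two, coeff_coeff_sub_pow] at W0 W1 W2
  simp (disch := omega) only [if_pos, if_neg, mul_zero, add_zero, zero_add] at W0 W1 W2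
  rw [hS, W0, W1, W2, show 2 * p + 2 + 1 = 2 * p + 3 by omega, e3]
  ring

end Polarization

variable {k : Type*} [Field k]

/-- The polarizations of a form contained in a `υ`-stable subalgebra are contained in it. -/
lemma normalized_polarization_mem [CharZero k] {A : Subalgebra k (B k)} (hA : ∀ a ∈ A, upsilon a ∈ A)
    {N : ℕ} {F : ℕ → B k} (hF : ∀ i < N, upsilon (F i) = (N - i : ℕ) * F (i + 1)) (h0 : F 0 ∈ A)
    {i : ℕ} (hi : i ≤ N) : F i ∈ A := by
  induction i with
  | zero => exact h0
  | succ i ih =>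
    have h1 := hA _ (ih (by omega))
    rwa [hF i (by omega), natCast_mul_mem_iff (by omega)] at h1

lemma upsilon_polar (N i q : ℕ) : upsilon (polar (x k) (y k) (z k) (w k) N i q) =
    (N - i : ℕ) * polar (x k) (y k) (z k) (w k) N (i + 1) q :=
  deriv_polar (upsilon.restrictScalars ℤ) upsilon_x upsilon_y upsilon_z upsilon_w N i q

/-- Here `n = 2 p + 3`. By `self_transvectant` the algebra contains `(x y) ^ 2`, hence `(x y) ^ (n +
1)` as `n + 1` is even; by `mixed_transvectant` the transvectant of order `2 n` of that power with
the given form isolates `x y`. -/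
lemma xy_mem_of_sextic_type [CharZero k] {A : Subalgebra k (B k)} (hA : ∀ a ∈ A, upsilon a ∈ A) (p : ℕ)
    (hf : x k ^ (4 * p + 6) + (x k * y k) ^ (2 * p + 3) + y k ^ (4 * p + 6) ∈ A) : x k * y k ∈ A := by
  set c : ℕ := (4 * p + 6).choose (2 * p + 3) with hc
  have hc0 : c ≠ 0 := (Nat.choose_pos (by omega)).ne'
  -- `polar` carries a binomial factor, equal to `c` for the middle term and `1` for the outer ones;
  -- the coefficients make `F 0` equal to `c` times the given form.
  let F : ℕ → B k := fun i => c * polar (x k) (y k) (z k) (w k) (4 * p + 6) i 0 +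
    polar (x k) (y k) (z k) (w k) (4 * p + 6) i (2 * p + 3) +
      c * polar (x k) (y k) (z k) (w k) (4 * p + 6) i (4 * p + 6)
  have hF0 : F 0 ∈ A := by
    simp only [F]
    rw [polar_zero_right _ _ _ _ (by omega), polar_zero_right _ _ _ _ (by omega),
      polar_zero_right _ _ _ _ le_rfl, ← hc, show 4 * p + 6 - (2 * p + 3) = 2 * p + 3 by omega]
    convert A.mul_mem (natCast_mem A c) hf using 1
    rw [Nat.choose_self, Nat.choose_zero_right, Nat.sub_self, Nat.sub_zero, mul_pow]
    push_cast
    ring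
  have hF : ∀ i ≤ 4 * p + 6, F i ∈ A := fun i hi => by
    refine normalized_polarization_mem hA (fun i _ => ?_) hF0 hi
    simp only [F, map_add, Derivation.leibniz, upsilon_polar, Derivation.map_natCast, smul_eq_mul, mul_zero,
      add_zero]
    ring
  have hsign : ∀ i, (-1 : B k) ^ i ∈ A := fun i => A.pow_mem (A.neg_mem A.one_mem) i
  have h2 : x k ^ 2 * y k ^ 2 ∈ A := by
    -- The central binomial coefficient dominates its neighbours, so `K` is a natural number and `2
    -- * c ^ 2 + K` is positive.
    have l1 := Nat.choose_le_middle (2 * p + 1) (4 * p + 4)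
    have l2 := Nat.choose_le_middle (2 * p + 3) (4 * p + 4)
    rw [show (4 * p + 4) / 2 = 2 * p + 2 by omega] at l1 l2
    obtain ⟨K, hK⟩ := Nat.exists_eq_add_of_le' (show (4 * p + 4).choose (2 * p + 1) +
      (4 * p + 4).choose (2 * p + 3) ≤ 4 * (4 * p + 4).choose (2 * p + 2) by omega)
    have key := self_transvectant (det_eq (k := k)) p K c F (fun _ => rfl) (by omega)
    have hn : 2 * c ^ 2 + K ≠ 0 := by positivity
    rw [← natCast_mul_mem_iff hn]
    push_cast
    rw [← key]
    refine A.sum_mem fun m hm => A.nsmul_mem (A.mul_mem (hsign _) ?_) _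
    have := Finset.HasAntidiagonal.mem_antidiagonal.1 hm
    exact A.mul_mem (hF _ (by omega)) (hF _ (by omega))
  have hG : ∀ i ≤ 4 * p + 8, polar (x k) (y k) (z k) (w k) (4 * p + 8) i (2 * p + 4) ∈ A := fun i hi => by
    refine normalized_polarization_mem (F := fun i => polar (x k) (y k) (z k) (w k) (4 * p + 8) i (2 * p + 4))
      hA (fun i _ => upsilon_polar _ _ _) ?_ hi
    rw [polar_zero_right _ _ _ _ (by omega), show 4 * p + 8 - (2 * p + 4) = 2 * (p + 2) by omega,
      show 2 * p + 4 = 2 * (p + 2) by ring, pow_mul, pow_mul, ← mul_pow]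
    exact A.mul_mem (natCast_mem A _) (A.pow_mem h2 _)
  have key := mixed_transvectant (det_eq (k := k)) p c F (fun _ => rfl)
  rw [← hc] at key
  have hn : 2 * c ≠ 0 := by omega
  rw [← natCast_mul_mem_iff hn]
  have h3 : ((2 * c : ℕ) : B k) * (x k * y k) = - (-(2 * c) * (x k * y k)) := by push_cast; ring
  rw [h3, ← key]
  refine A.neg_mem (A.sum_mem fun m hm => A.nsmul_mem (A.mul_mem (hsign _) ?_) _)
  have := Finset.HasAntidiagonal.mem_antidiagonal.1 hm
  exact A.mul_mem (hG _ (by omega)) (hF _ (by omega))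

theorem invariants_cyclic_even_of_odd [CharZero k] {n : ℕ} (hn : 3 ≤ n) (ho : Odd n) {ζ : kˣ}
    (hζ : IsPrimitiveRoot ζ (2 * n)) :
    invariants (cyclic ζ) = Algebra.adjoin k
      (hat (2 * n) (x k ^ (2 * n) + (x k * y k) ^ n + y k ^ (2 * n)) : Set (B k)) := by
  open MvPolynomial in
  have e1 : x k ^ (2 * n) + (x k * y k) ^ n + y k ^ (2 * n) =
      formToB k (X 0 ^ (2 * n) + (X 0 * X 1) ^ n + X 1 ^ (2 * n)) := by simp
  rw [e1]
  refine invariants_closure_eq_adjoin_hat {psi ζ}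
    (((MvPolynomial.isHomogeneous_X_pow _ _).add
      (((MvPolynomial.isHomogeneous_X _ _).mul (MvPolynomial.isHomogeneous_X _ _)).pow n)).add
        (MvPolynomial.isHomogeneous_X_pow _ _)) ?_ ?_
  · rintro _ rfl
    have h0 := formMul_psi_monomial' hζ.pow_eq_one (a := 2 * n) (b := 0) (by simp [Nat.ModEq])
    have h1 := formMul_psi_monomial' hζ.pow_eq_one (a := 0) (b := 2 * n) (by simp [Nat.ModEq])
    have h2 := formMul_psi_monomial' hζ.pow_eq_one (a := n) (b := n) rfl
    rw [pow_zero, mul_one] at h0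
    rw [pow_zero, one_mul] at h1
    rw [mul_pow, map_add, map_add, h0, h1, h2]
  · intro A hA hf d g _ hg
    rw [← e1] at hf
    have hxy : x k * y k ∈ A := by
      obtain ⟨p, rfl⟩ : ∃ p, n = 2 * p + 3 := by
        obtain ⟨q, rfl⟩ := ho
        exact ⟨q - 1, by omega⟩
      rw [show 2 * (2 * p + 3) = 4 * p + 6 by ring] at hf
      exact xy_mem_of_sextic_type hA p hf
    have hs : x k ^ (2 * n) + y k ^ (2 * n) ∈ A := by
      convert A.sub_mem hf (A.pow_mem hxy n) using 1
      ring
    obtain ⟨hx, hy⟩ := x_pow_mem_and_y_pow_mem hA (n := 2 * n) (by omega) hxy hs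
    exact formToB_mem_of_formMul_psi hζ hx hy hxy (hg _ rfl)

end

end SLTwo

/-! ### Binary forms and orbits of linear factors -/

namespace SLTwo

noncomputable section

open MvPolynomial

variable {k : Type*} [Field k]

section BinaryForms

lemma isRelPrime_X_zero_X_one : IsRelPrime (X 0 : MvPolynomial (Fin 2) k) (X 1) := by
  have h0 : Irreducible (X 0 : MvPolynomial (Fin 2) k) := (X_prime (i := 0)).irreducible
  rw [h0.isRelPrime_iff_not_dvd, X_dvd_X]
  decide

lemma isRelPrime_X_zero_block (n : ℕ) (hn : n ≠ 0) (α : k) :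
    IsRelPrime (X 0 : MvPolynomial (Fin 2) k) (X 1 ^ n - C α * X 0 ^ n) := by
  intro d h0 h1
  refine isRelPrime_X_zero_X_one.pow_right (n := n) h0 ?_
  exact (dvd_sub_left (Dvd.dvd.mul_left (dvd_pow h0 hn) _)).1 h1

lemma isRelPrime_X_one_block (n : ℕ) (hn : n ≠ 0) {α : k} (hα : α ≠ 0) :
    IsRelPrime (X 1 : MvPolynomial (Fin 2) k) (X 1 ^ n - C α * X 0 ^ n) := by
  intro d h0 h1
  refine isRelPrime_X_zero_X_one.symm.pow_right (n := n) h0 ?_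
  have h2 := (dvd_sub_right (dvd_pow h0 hn)).1 h1
  exact ((isUnit_iff_ne_zero.2 hα).map C).dvd_mul_left.1 h2

/-- A common divisor also divides `(α - β)` times each of the coprime powers `X 0 ^ n` and `X 1 ^
n`. -/
lemma isRelPrime_blocks (n : ℕ) {α β : k} (h : α ≠ β) :
    IsRelPrime (X 1 ^ n - C α * X 0 ^ n : MvPolynomial (Fin 2) k) (X 1 ^ n - C β * X 0 ^ n) := by
  intro d h0 h1
  have hu : IsUnit (C (α - β) : MvPolynomial (Fin 2) k) := (isUnit_iff_ne_zero.2 (sub_ne_zero.2 h)).map C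
  refine (isRelPrime_X_zero_X_one.pow (m := n) (n := n)) ?_ ?_
  · refine hu.dvd_mul_left.1 ?_
    convert dvd_sub h1 h0 using 1
    rw [C_sub]; ring
  · refine hu.dvd_mul_left.1 ?_
    convert dvd_sub (Dvd.dvd.mul_left h1 (C α)) (Dvd.dvd.mul_left h0 (C β)) using 1
    rw [C_sub]; ring

lemma support_eq_single {d : ℕ} {g : MvPolynomial (Fin 2) k} (hg : g.IsHomogeneous d)
    {e : Fin 2 →₀ ℕ} (he : coeff e g ≠ 0) : e 0 + e 1 = d := by
  have := hg he
  rwa [Finsupp.weight_apply, Finsupp.sum_fintype _ _ (by simp), Fin.sum_univ_two, Pi.one_apply,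
    Pi.one_apply, smul_eq_mul, smul_eq_mul, mul_one, mul_one] at this

lemma homogeneous_eq_sum {d : ℕ} {g : MvPolynomial (Fin 2) k} (hg : g.IsHomogeneous d) :
    g = ∑ j ∈ Finset.range (d + 1),
      C (coeff (Finsupp.equivFunOnFinite.symm ![d - j, j]) g) * X 0 ^ (d - j) * X 1 ^ j := by
  classical
  have hm : ∀ (a b : ℕ) (c : k), C c * X 0 ^ a * X 1 ^ b =
      monomial (Finsupp.equivFunOnFinite.symm ![a, b]) c := fun a b c => by
    rw [monomial_eq, Finsupp.prod_fintype _ _ (by simp), Fin.prod_univ_two, mul_assoc]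
    simp
  simp only [hm]
  ext e
  rw [coeff_sum]
  simp only [coeff_monomial]
  by_cases he : coeff e g = 0
  · rw [he]
    refine (Finset.sum_eq_zero fun j _ => ?_).symm
    split_ifs with h
    · rw [h, he]
    · rfl
  · have hd := support_eq_single hg he
    have h1 : Finsupp.equivFunOnFinite.symm ![d - e 1, e 1] = e := by
      ext i
      fin_cases i
      · simp [← hd]
      · simp
    rw [Finset.sum_eq_single (e 1)]
    · rw [h1, if_pos rfl]
    · intro j _ hj
      rw [if_neg]
      rintro rfl
      exact hj (by simp)
    · intro h
      exact absurd (Finset.mem_range.2 (by omega)) h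

lemma eval_formMul (h : Matrix.SpecialLinearGroup (Fin 2) k) (a b : k) (g : MvPolynomial (Fin 2) k) :
    eval ![a, b] (formMul h g) = eval ![a * h 0 0 + b * h 1 0, a * h 0 1 + b * h 1 1] g := by
  suffices H : (aeval (R := k) ![a, b]).comp (formMul h) =
      aeval ![a * h 0 0 + b * h 1 0, a * h 0 1 + b * h 1 1] by
    simpa [coe_aeval_eq_eval] using DFunLike.congr_fun H g
  refine algHom_ext fun j => ?_
  rw [AlgHom.comp_apply, formMul_X]
  fin_cases j <;> simp

lemma eval_zero_one {d : ℕ} {g : MvPolynomial (Fin 2) k} (hg : g.IsHomogeneous d) :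
    eval ![0, 1] g = coeff (Finsupp.equivFunOnFinite.symm ![0, d]) g := by
  conv_lhs => rw [homogeneous_eq_sum hg]
  rw [map_sum, Finset.sum_eq_single d]
  · simp
  · intro j hj hjd
    have := Finset.mem_range.1 hj
    simp [show d - j ≠ 0 by omega]
  · intro h
    exact absurd (Finset.mem_range.2 (by omega)) h

lemma X_zero_dvd {d : ℕ} {g : MvPolynomial (Fin 2) k} (hg : g.IsHomogeneous d)
    (h : eval ![0, 1] g = 0) : X 0 ∣ g := by
  rw [homogeneous_eq_sum hg]
  refine Finset.dvd_sum fun j hj => ?_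
  rcases eq_or_ne j d with rfl | hjd
  · rw [Nat.sub_self, ← eval_zero_one hg, h, C_0]
    simp
  · have := Finset.mem_range.1 hj
    exact Dvd.dvd.mul_right (Dvd.dvd.mul_left (dvd_pow_self _ (by omega)) _) _

/-- Invariant forms lie in a given subalgebra, if each of them which vanishes at `(0, 1)` is divisible
by an invariant form `f` of the subalgebra, and there are sufficiently many invariant forms in the
subalgebra not vanishing at `(0, 1)`. -/
theorem mem_of_invariant_form {S : Set (Matrix.SpecialLinearGroup (Fin 2) k)}
    {𝒜 : Subalgebra k (MvPolynomial (Fin 2) k)} {f : MvPolynomial (Fin 2) k} {D : ℕ} (hD : 0 < D)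
    (hf : f.IsHomogeneous D) (hf0 : f ≠ 0) (hinv : ∀ s ∈ S, formMul s f = f) (hfA : f ∈ 𝒜)
    (hdiv : ∀ g, (∀ s ∈ S, formMul s g = g) → X 0 ∣ g → f ∣ g)
    (hsub : ∀ d g, g.IsHomogeneous d → (∀ s ∈ S, formMul s g = g) → eval ![0, 1] g ≠ 0 →
      ∃ q ∈ 𝒜, q.IsHomogeneous d ∧ (∀ s ∈ S, formMul s q = q) ∧ eval ![0, 1] q ≠ 0)
    (d : ℕ) : ∀ g : MvPolynomial (Fin 2) k, g.IsHomogeneous d → (∀ s ∈ S, formMul s g = g) → g ∈ 𝒜 := by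
  induction d using Nat.strong_induction_on with
  | _ d ih =>
    have h0 : ∀ g : MvPolynomial (Fin 2) k, g.IsHomogeneous d → (∀ s ∈ S, formMul s g = g) →
        eval ![0, 1] g = 0 → g ∈ 𝒜 := by
      intro g hg hgi he
      rcases eq_or_ne g 0 with rfl | hne
      · exact 𝒜.zero_mem
      obtain ⟨g', rfl⟩ := hdiv g hgi (X_zero_dvd hg he)
      obtain ⟨i, j, hij, hi, hj⟩ := isWeightedHomogeneous_of_mul hg hne
      have hiD : i = D := IsWeightedHomogeneous.inj_right hf0 hi hf
      refine 𝒜.mul_mem hfA (ih j (by omega) g' hj fun s hs => ?_)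
      have := hgi s hs
      rw [map_mul, hinv s hs] at this
      exact mul_left_cancel₀ hf0 this
    intro g hg hgi
    by_cases he : eval ![0, 1] g = 0
    · exact h0 g hg hgi he
    · obtain ⟨q, hqA, hq, hqi, hqe⟩ := hsub d g hg hgi he
      -- Cancelling the value at `(0, 1)` makes the difference divisible by `X 0`, hence by `f`; the
      -- cofactor is an invariant form of smaller degree.
      have h1 := h0 (g - C (eval ![0, 1] g / eval ![0, 1] q) * q) (hg.sub (hq.C_mul _))
        (fun s hs => by rw [map_sub, map_mul, formMul_C, hgi s hs, hqi s hs])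
        (by rw [map_sub, map_mul, eval_C, div_mul_cancel₀ _ hqe, sub_self])
      have h2 := 𝒜.add_mem h1 (𝒜.smul_mem hqA (eval ![0, 1] g / eval ![0, 1] q))
      rwa [smul_eq_C_mul, sub_add_cancel] at h2

/-- The value at `(0, 1)` is the coefficient of `X 1 ^ d`, a monomial fixed by `psi ζ` only if `n ∣
d`. -/
lemma dvd_of_formMul_psi {ζ : kˣ} {n : ℕ} (hζ : IsPrimitiveRoot ζ n) {d : ℕ}
    {g : MvPolynomial (Fin 2) k} (hg : g.IsHomogeneous d) (hinv : formMul (psi ζ) g = g)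
    (he : eval ![0, 1] g ≠ 0) : n ∣ d := by
  rw [eval_zero_one hg] at he
  have h := modEq_of_formMul_psi hζ hinv he
  simp only [Finsupp.coe_equivFunOnFinite_symm, Matrix.cons_val_zero, Matrix.cons_val_one] at h
  exact (Nat.modEq_zero_iff_dvd).1 h.symm

lemma formMul_linear (h : Matrix.SpecialLinearGroup (Fin 2) k) (a b : k) :
    formMul h (C a * X 0 + C b * X 1) =
      C (h 0 0 * a + h 0 1 * b) * X 0 + C (h 1 0 * a + h 1 1 * b) * X 1 := by
  rw [map_add, map_mul, map_mul, formMul_C, formMul_C, formMul_X, formMul_X]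
  simp only [C_add, C_mul]
  ring

/-- If an invariant form is divisible by a linear form, then by each linear form in its orbit. -/
lemma linear_dvd {h : Matrix.SpecialLinearGroup (Fin 2) k} {g : MvPolynomial (Fin 2) k}
    (hg : formMul h g = g) {a b : k} (hab : C a * X 0 + C b * X 1 ∣ g) {c t : k}
    (h0 : h 0 0 * a + h 0 1 * b = - (c * t)) (h1 : h 1 0 * a + h 1 1 * b = c) :
    X 1 - C t * X 0 ∣ g := by
  have h2 := map_dvd (formMul h) hab
  rw [hg, formMul_linear, h0, h1] at h2
  refine dvd_trans ⟨C c, ?_⟩ h2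
  rw [C_neg, C_mul]
  ring

lemma linear_form_eq (t : k) : (X 1 - C t * X 0 : MvPolynomial (Fin 2) k) = C (-t) * X 0 + C 1 * X 1 := by
  rw [C_neg, C_1]; ring

/-- The block splits into `n` pairwise coprime linear forms, one for each root of unity. -/
lemma pow_block_dvd {ζ : kˣ} {n : ℕ} (hn : 0 < n) (hζ : IsPrimitiveRoot ζ n) {g : MvPolynomial (Fin 2) k}
    {t : k} (ht : t ≠ 0) (h : ∀ j < n, X 1 - C ((ζ : k) ^ j * t) * X 0 ∣ g) :
    X 1 ^ n - C (t ^ n) * X 0 ^ n ∣ g := by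
  have hζ' : IsPrimitiveRoot (C (ζ : k) : MvPolynomial (Fin 2) k) n :=
    (hζ.map_of_injective (f := Units.coeHom k) Units.val_injective).map_of_injective
      (C_injective (Fin 2) k)
  have : NeZero n := ⟨hn.ne'⟩
  rw [C_pow, ← mul_pow, hζ'.pow_sub_pow_eq_prod_sub_mul _ _ hn]
  have hmem : ∀ μ ∈ Polynomial.nthRootsFinset n (1 : MvPolynomial (Fin 2) k),
      ∃ j < n, C ((ζ : k) ^ j) = μ := by
    intro μ hμ
    obtain ⟨j, hj, h⟩ := hζ'.eq_pow_of_pow_eq_one ((Polynomial.mem_nthRootsFinset hn 1).1 hμ)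
    exact ⟨j, hj, by rw [C_pow, h]⟩
  refine Finset.prod_dvd_of_isRelPrime ?_ ?_
  · intro μ hμ ν hν hne
    obtain ⟨j, -, rfl⟩ := hmem μ hμ
    obtain ⟨l, -, rfl⟩ := hmem ν hν
    have h1 : (ζ : k) ^ j * t ≠ (ζ : k) ^ l * t := fun h' => hne (by rw [mul_right_cancel₀ ht h'])
    have := isRelPrime_blocks 1 h1
    simp only [pow_one, C_mul] at this
    simpa only [Function.onFun, mul_assoc] using this
  · intro μ hμ
    obtain ⟨j, hj, rfl⟩ := hmem μ hμ
    have := h j hj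
    rwa [C_mul, mul_assoc] at this

lemma X_one_dvd_of_formMul_quatJ {g : MvPolynomial (Fin 2) k} (hg : formMul quatJ g = g)
    (h : X 0 ∣ g) : X 1 ∣ g := by
  have := map_dvd (formMul quatJ) h
  rwa [hg, formMul_quatJ_X_zero, neg_dvd] at this

lemma linear_dvd_of_X_zero_dvd {h : Matrix.SpecialLinearGroup (Fin 2) k} {g : MvPolynomial (Fin 2) k}
    (hg : formMul h g = g) (h0 : X 0 ∣ g) {t : k} (ht : h 0 0 = - (h 1 0 * t)) :
    X 1 - C t * X 0 ∣ g := by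
  refine linear_dvd hg (a := 1) (b := 0) (c := h 1 0) ?_ (by rw [← ht]; ring) (by ring)
  simpa using h0

lemma linear_dvd_of_X_one_dvd {h : Matrix.SpecialLinearGroup (Fin 2) k} {g : MvPolynomial (Fin 2) k}
    (hg : formMul h g = g) (h1 : X 1 ∣ g) {t : k} (ht : h 0 1 = - (h 1 1 * t)) :
    X 1 - C t * X 0 ∣ g := by
  refine linear_dvd hg (a := 0) (b := 1) (c := h 1 1) ?_ (by rw [← ht]; ring) (by ring)
  simpa using h1

/-- A diagonal matrix multiplies the slope `t` by the ratio of its entries, here `ζ / ζ⁻¹`. -/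
lemma linear_dvd_psi {ζ : kˣ} {g : MvPolynomial (Fin 2) k} (hg : formMul (psi ζ) g = g) {t : k}
    (h : X 1 - C t * X 0 ∣ g) : X 1 - C ((ζ : k) ^ 2 * t) * X 0 ∣ g := by
  rw [linear_form_eq] at h
  refine linear_dvd hg h (c := (ζ : k)⁻¹) ?_ ?_
  · simp [psi]
    field_simp
  · simp [psi]

end BinaryForms

end

end SLTwo

/-! ### Binary tetrahedral and octahedral groups -/

namespace SLTwo

noncomputable section

open MvPolynomial

variable {k : Type*} [Field k]

section Octahedron

variable {R : Type*} [CommRing R]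

/-- The form vanishing at the vertices of an octahedron. -/
def octaVertex (x y : R) : R := x * y * (x ^ 4 - y ^ 4)

/-- The form vanishing at the face centres of an octahedron. -/
def octaFace (x y : R) : R := x ^ 8 + 14 * x ^ 4 * y ^ 4 + y ^ 8

/-- The form vanishing at the edge midpoints of an octahedron. -/
def octaEdge (x y : R) : R := x ^ 12 - 33 * x ^ 8 * y ^ 4 - 33 * x ^ 4 * y ^ 8 + y ^ 12

lemma octaEdge_sq (x y : R) : octaEdge x y ^ 2 = octaFace x y ^ 3 - 108 * octaVertex x y ^ 4 := by
  simp only [octaVertex, octaFace, octaEdge]; ring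

lemma map_octaVertex {S : Type*} [CommRing S] (φ : R →+* S) (x y : R) :
    φ (octaVertex x y) = octaVertex (φ x) (φ y) := by
  simp [octaVertex]

lemma map_octaFace {S : Type*} [CommRing S] (φ : R →+* S) (x y : R) :
    φ (octaFace x y) = octaFace (φ x) (φ y) := by
  simp [octaFace, map_ofNat φ 14]

lemma map_octaEdge {S : Type*} [CommRing S] (φ : R →+* S) (x y : R) :
    φ (octaEdge x y) = octaEdge (φ x) (φ y) := by
  simp [octaEdge, map_ofNat φ 33]

lemma formToB_octaVertex : formToB k (octaVertex (X 0) (X 1)) = octaVertex (x k) (y k) := by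
  simpa using map_octaVertex (formToB k).toRingHom (X 0) (X 1)

lemma formToB_octaFace : formToB k (octaFace (X 0) (X 1)) = octaFace (x k) (y k) := by
  simpa using map_octaFace (formToB k).toRingHom (X 0) (X 1)

lemma formToB_octaEdge : formToB k (octaEdge (X 0) (X 1)) = octaEdge (x k) (y k) := by
  simpa using map_octaEdge (formToB k).toRingHom (X 0) (X 1)

section Derivation

variable {x y z w : R} (δ : Derivation ℤ R R) (h : x * w - y * z = 1) (hx : δ x = z) (hy : δ y = w)
  (hz : δ z = 0) (hw : δ w = 0)

include hx hy in
lemma derivation_octaVertex : δ (octaVertex x y) =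
    (5 * x ^ 4 * y - y ^ 5) * z + (x ^ 5 - 5 * x * y ^ 4) * w := by
  simp only [octaVertex, map_sub, Derivation.leibniz, Derivation.leibniz_pow, smul_eq_mul, nsmul_eq_mul, hx, hy]
  push_cast
  ring

include hx hy in
lemma derivation_octaFace : δ (octaFace x y) =
    (8 * x ^ 7 + 56 * x ^ 3 * y ^ 4) * z + (56 * x ^ 4 * y ^ 3 + 8 * y ^ 7) * w := by
  have h14 : δ (14 : R) = 0 := by exact_mod_cast δ.map_natCast 14
  simp only [octaFace, map_add, Derivation.leibniz, Derivation.leibniz_pow, smul_eq_mul, nsmul_eq_mul, hx, hy,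
    h14]
  push_cast
  ring

include h hx hy hz hw in
-- The Hessian of the vertex form, up to a scalar: `z` and `w` enter only through `(x * w - y * z) ^
-- 2`.
lemma octaFace_eq : 5 * δ (octaVertex x y) ^ 2 - 6 * octaVertex x y * δ (δ (octaVertex x y)) =
    5 * octaFace x y := by
  have h5 : δ (5 : R) = 0 := by exact_mod_cast δ.map_natCast 5
  rw [derivation_octaVertex δ hx hy]
  simp only [octaVertex, octaFace, map_add, map_sub, Derivation.leibniz, Derivation.leibniz_pow, smul_eq_mul, nsmul_eq_mul, hx, hy,
    hz, hw, h5]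
  push_cast
  linear_combination 5 * (x ^ 8 + 14 * x ^ 4 * y ^ 4 + y ^ 8) * (x * w - y * z + 1) * h

include h hx hy in
-- For forms `f`, `g` of degrees `m`, `n`, Euler's relation turns `m f δg - n g δf` into `x * w - y
-- * z` times their Jacobian.
lemma octaEdge_eq : 8 * octaFace x y * δ (octaVertex x y) - 6 * octaVertex x y * δ (octaFace x y) =
    8 * octaEdge x y := by
  rw [derivation_octaVertex δ hx hy, derivation_octaFace δ hx hy]
  simp only [octaVertex, octaFace, octaEdge]
  linear_combination 8 * (x ^ 12 - 33 * x ^ 8 * y ^ 4 - 33 * x ^ 4 * y ^ 8 + y ^ 12) * h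

include h hx hy hz hw in
-- The Hessian of the face form. Starting from that form one reaches the square of the vertex form
-- but not the vertex form, which is only semi-invariant under the octahedral group.
lemma octaVertex_sq_eq : 8 * octaFace x y * δ (δ (octaFace x y)) - 7 * δ (octaFace x y) ^ 2 =
    1344 * octaVertex x y ^ 2 := by
  have h56 : δ (56 : R) = 0 := by exact_mod_cast δ.map_natCast 56
  have h8 : δ (8 : R) = 0 := by exact_mod_cast δ.map_natCast 8
  rw [derivation_octaFace δ hx hy]
  simp only [octaVertex, octaFace, map_add, Derivation.leibniz, Derivation.leibniz_pow, smul_eq_mul, nsmul_eq_mul, hx, hy,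
    hz, hw, h56, h8]
  push_cast
  linear_combination 1344 * (x * y * (x ^ 4 - y ^ 4)) ^ 2 * (x * w - y * z + 1) * h

include h hx hy in
lemma octaVertex_mul_octaEdge_eq : 8 * octaFace x y * δ (octaVertex x y ^ 2) -
    12 * octaVertex x y ^ 2 * δ (octaFace x y) = 16 * (octaVertex x y * octaEdge x y) := by
  rw [Derivation.leibniz_pow, smul_eq_mul, nsmul_eq_mul]
  push_cast
  linear_combination 2 * octaVertex x y * octaEdge_eq δ h hx hy

variable {A : Subring R} (hA : ∀ a ∈ A, δ a ∈ A) (hdiv : ∀ n : ℕ, n ≠ 0 → ∀ b : R, n * b ∈ A → b ∈ A)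

include h hx hy hz hw hA hdiv in
lemma octaFace_mem (hV : octaVertex x y ∈ A) : octaFace x y ∈ A := by
  refine hdiv 5 (by norm_num) _ ?_
  rw [Nat.cast_ofNat, ← octaFace_eq δ h hx hy hz hw]
  refine A.sub_mem ?_ ?_
  · exact A.mul_mem (ofNat_mem A 5) (A.pow_mem (hA _ hV) 2)
  · exact A.mul_mem (A.mul_mem (ofNat_mem A 6) hV) (hA _ (hA _ hV))

include h hx hy hz hw hA hdiv in
lemma octaEdge_mem (hV : octaVertex x y ∈ A) : octaEdge x y ∈ A := by
  have hF := octaFace_mem δ h hx hy hz hw hA hdiv hV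
  refine hdiv 8 (by norm_num) _ ?_
  rw [Nat.cast_ofNat, ← octaEdge_eq δ h hx hy]
  refine A.sub_mem ?_ ?_
  · exact A.mul_mem (A.mul_mem (ofNat_mem A 8) hF) (hA _ hV)
  · exact A.mul_mem (A.mul_mem (ofNat_mem A 6) hV) (hA _ hF)

include h hx hy hz hw hA hdiv in
lemma octaVertex_sq_mem (hF : octaFace x y ∈ A) : octaVertex x y ^ 2 ∈ A := by
  refine hdiv 1344 (by norm_num) _ ?_
  rw [Nat.cast_ofNat, ← octaVertex_sq_eq δ h hx hy hz hw]
  refine A.sub_mem ?_ ?_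
  · exact A.mul_mem (A.mul_mem (ofNat_mem A 8) hF) (hA _ (hA _ hF))
  · exact A.mul_mem (ofNat_mem A 7) (A.pow_mem (hA _ hF) 2)

include h hx hy hz hw hA hdiv in
lemma octaVertex_mul_octaEdge_mem (hF : octaFace x y ∈ A) : octaVertex x y * octaEdge x y ∈ A := by
  have hV := octaVertex_sq_mem δ h hx hy hz hw hA hdiv hF
  refine hdiv 16 (by norm_num) _ ?_
  rw [Nat.cast_ofNat, ← octaVertex_mul_octaEdge_eq δ h hx hy]
  refine A.sub_mem ?_ ?_
  · exact A.mul_mem (A.mul_mem (ofNat_mem A 8) hF) (hA _ hV)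
  · exact A.mul_mem (A.mul_mem (ofNat_mem A 12) hV) (hA _ hF)

end Derivation

section Transvectants

variable {A : Subalgebra k (B k)} (hA : ∀ a ∈ A, upsilon a ∈ A)

include hA in
lemma formToB_octaFace_octaEdge_mem [CharZero k] (hV : formToB k (octaVertex (X 0) (X 1)) ∈ A) :
    formToB k (octaFace (X 0) (X 1)) ∈ A ∧ formToB k (octaEdge (X 0) (X 1)) ∈ A := by
  rw [formToB_octaVertex] at hV
  rw [formToB_octaFace, formToB_octaEdge]
  exact ⟨octaFace_mem (A := A.toSubring) (upsilon.restrictScalars ℤ) det_eq upsilon_x upsilon_y upsilon_z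
      upsilon_w hA (fun n hn b => (natCast_mul_mem_iff hn).1) hV,
    octaEdge_mem (A := A.toSubring) (upsilon.restrictScalars ℤ) det_eq upsilon_x upsilon_y upsilon_z
      upsilon_w hA (fun n hn b => (natCast_mul_mem_iff hn).1) hV⟩

include hA in
lemma formToB_octaVertex_sq_mem [CharZero k] (hF : formToB k (octaFace (X 0) (X 1)) ∈ A) :
    formToB k (octaVertex (X 0) (X 1) ^ 2) ∈ A ∧
      formToB k (octaVertex (X 0) (X 1) * octaEdge (X 0) (X 1)) ∈ A := by
  rw [formToB_octaFace] at hF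
  rw [map_pow, map_mul, formToB_octaVertex, formToB_octaEdge]
  exact ⟨octaVertex_sq_mem (A := A.toSubring) (upsilon.restrictScalars ℤ) det_eq upsilon_x upsilon_y
      upsilon_z upsilon_w hA (fun n hn b => (natCast_mul_mem_iff hn).1) hF,
    octaVertex_mul_octaEdge_mem (A := A.toSubring) (upsilon.restrictScalars ℤ) det_eq upsilon_x upsilon_y
      upsilon_z upsilon_w hA (fun n hn b => (natCast_mul_mem_iff hn).1) hF⟩

end Transvectants

lemma octaVertex_isHomogeneous : (octaVertex (X 0) (X 1) : MvPolynomial (Fin 2) k).IsHomogeneous 6 :=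
  ((isHomogeneous_X k 0).mul (isHomogeneous_X k 1)).mul
    ((isHomogeneous_X_pow 0 4).sub (isHomogeneous_X_pow 1 4))

lemma octaFace_isHomogeneous : (octaFace (X 0) (X 1) : MvPolynomial (Fin 2) k).IsHomogeneous 8 := by
  refine ((isHomogeneous_X_pow 0 8).add ?_).add (isHomogeneous_X_pow 1 8)
  rw [mul_assoc, show (14 : MvPolynomial (Fin 2) k) = C 14 from (map_ofNat C 14).symm]
  exact ((isHomogeneous_X_pow 0 4).mul (isHomogeneous_X_pow 1 4)).C_mul _

lemma octaEdge_isHomogeneous : (octaEdge (X 0) (X 1) : MvPolynomial (Fin 2) k).IsHomogeneous 12 := by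
  simp only [octaEdge, mul_assoc]
  rw [show (33 : MvPolynomial (Fin 2) k) = C 33 from (map_ofNat C 33).symm]
  exact (((isHomogeneous_X_pow 0 12).sub (((isHomogeneous_X_pow 0 8).mul (isHomogeneous_X_pow 1 4)).C_mul _)).sub
    (((isHomogeneous_X_pow 0 4).mul (isHomogeneous_X_pow 1 8)).C_mul _)).add (isHomogeneous_X_pow 1 12)

end Octahedron

section BinaryTetrahedral

lemma sq_eq_neg_one {i : kˣ} (hi : IsPrimitiveRoot i 4) : (i : k) ^ 2 = -1 := by
  have h := hi.map_of_injective (f := Units.coeHom k) Units.val_injective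
  have h2 : IsPrimitiveRoot ((i : k) ^ 2) 2 := h.pow (by norm_num) (by norm_num)
  exact h2.eq_neg_one_of_two_right

variable [CharZero k]

lemma sigma_sq_apply {i : kˣ} (hi : IsPrimitiveRoot i 4) :
    (sigma i hi ^ 2) 0 0 = (-1 + (i : k)) / 2 ∧ (sigma i hi ^ 2) 1 0 = (-1 + (i : k)) / 2 ∧
      (sigma i hi ^ 2) 0 1 = (1 + (i : k)) / 2 ∧ (sigma i hi ^ 2) 1 1 = -((1 + (i : k)) / 2) := by
  have h := sq_eq_neg_one hi
  rw [sq]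
  refine ⟨?_, ?_, ?_, ?_⟩ <;> rw [mul_apply_two] <;> simp [sigma] <;>
    first | linear_combination (1 / 2 : k) * h | linear_combination (0 : k) * h

/-- Generators of the binary tetrahedral group. -/
def tetraGen (i : kˣ) (hi : IsPrimitiveRoot i 4) : Set (Matrix.SpecialLinearGroup (Fin 2) k) :=
  {psi i, quatJ, sigma i hi ^ 2}

lemma binaryTetrahedral_eq_closure (i : kˣ) (hi : IsPrimitiveRoot i 4) :
    binaryTetrahedral i hi = Subgroup.closure (tetraGen i hi) := by
  rw [binaryTetrahedral, binaryDihedral, ← Subgroup.closure_union, tetraGen]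
  congr 1
  ext
  simp only [Set.mem_union, Set.mem_insert_iff, Set.mem_singleton_iff, or_assoc]

lemma octaVertex_mem_invariants {i : kˣ} (hi : IsPrimitiveRoot i 4) :
    ∀ s ∈ tetraGen i hi, formMul s (octaVertex (X 0) (X 1)) = octaVertex (X 0) (X 1) := by
  have hmap : ∀ s, formMul s (octaVertex (X 0) (X 1)) =
      octaVertex (formMul (k := k) s (X 0)) (formMul s (X 1)) := fun s =>
    map_octaVertex (formMul s).toRingHom _ _
  have h2 := sq_eq_neg_one hi
  rintro s (rfl | rfl | rfl) <;> rw [hmap]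
  · rw [formMul_psi_X_zero, formMul_psi_X_one]
    have h1 : (C (i : k) * C (↑i⁻¹ : k) : MvPolynomial (Fin 2) k) = 1 := by
      rw [← C_mul, Units.mul_inv, C_1]
    have h4 : (C (i : k) : MvPolynomial (Fin 2) k) ^ 4 = 1 := by
      rw [← C_pow, show (i : k) ^ 4 = 1 by linear_combination ((i : k) ^ 2 - 1) * h2, C_1]
    have h5 : (C (↑i⁻¹ : k) : MvPolynomial (Fin 2) k) ^ 4 = 1 := by
      rw [← one_pow 4, ← h1, mul_pow, h4, one_mul]
    simp only [octaVertex]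
    rw [mul_mul_mul_comm, h1, one_mul, mul_pow, mul_pow, h4, h5, one_mul, one_mul]
  · rw [formMul_quatJ_X_zero, formMul_quatJ_X_one]
    simp only [octaVertex]
    ring
  · obtain ⟨e1, e2, e3, e4⟩ := sigma_sq_apply hi
    rw [formMul_X, formMul_X, e1, e2, e3, e4, C_neg]
    -- The substitution is `x ↦ p (x + y)`, `y ↦ q (x - y)`, so the vertex form involves `p` and `q`
    -- only through `p q`, `p ^ 4` and `q ^ 4`.
    set p : k := (-1 + (i : k)) / 2
    set q : k := (1 + (i : k)) / 2
    have h1 : (C p * C q : MvPolynomial (Fin 2) k) = -C (1 / 2) := by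
      rw [← C_mul, ← C_neg]; congr 1; simp only [p, q]; linear_combination h2 / 4
    have hp : (C p : MvPolynomial (Fin 2) k) ^ 4 = -C (1 / 2) ^ 2 := by
      rw [← C_pow, ← C_pow, ← C_neg]; congr 1; simp only [p]
      linear_combination (((i : k) ^ 2 - 4 * i + 5) / 16) * h2
    have hq : (C q : MvPolynomial (Fin 2) k) ^ 4 = -C (1 / 2) ^ 2 := by
      rw [← C_pow, ← C_pow, ← C_neg]; congr 1; simp only [q]
      linear_combination (((i : k) ^ 2 + 4 * i + 5) / 16) * h2
    have hc : 2 * C (1 / 2 : k) = (1 : MvPolynomial (Fin 2) k) := by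
      rw [← C_1, show (2 : MvPolynomial (Fin 2) k) = C 2 from (map_ofNat C 2).symm, ← C_mul]
      congr 1; norm_num
    simp only [octaVertex]
    generalize (C (1 / 2 : k) : MvPolynomial (Fin 2) k) = c at *
    generalize (C p : MvPolynomial (Fin 2) k) = P at *
    generalize (C q : MvPolynomial (Fin 2) k) = Q at *
    generalize (X 0 : MvPolynomial (Fin 2) k) = x at *
    generalize (X 1 : MvPolynomial (Fin 2) k) = y at *
    linear_combination (x ^ 2 - y ^ 2) * (P ^ 4 * (x + y) ^ 4 - Q ^ 4 * (x - y) ^ 4) * h1 -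
      c * (x ^ 2 - y ^ 2) * (x + y) ^ 4 * hp + c * (x ^ 2 - y ^ 2) * (x - y) ^ 4 * hq +
      x * y * (x ^ 4 - y ^ 4) * (4 * c ^ 2 + 2 * c + 1) * hc

/-- The ring of invariants is stable under `upsilon`, so it contains the transvectants of the
invariant vertex form. -/
lemma octaFace_octaEdge_invariant {i : kˣ} (hi : IsPrimitiveRoot i 4) :
    ∀ s ∈ tetraGen i hi, formMul s (octaFace (X 0) (X 1)) = octaFace (X 0) (X 1) ∧
      formMul s (octaEdge (X 0) (X 1)) = octaEdge (X 0) (X 1) := by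
  have h := formToB_octaFace_octaEdge_mem (A := invariants (Subgroup.closure (tetraGen i hi)))
    (fun a ha h hh => by rw [← upsilon_rightMul, ha h hh])
    (mem_invariants_closure.2 fun s hs => formMul_eq_iff.1 (octaVertex_mem_invariants hi s hs))
  exact fun s hs => ⟨formMul_eq_iff.2 (mem_invariants_closure.1 h.1 s hs),
    formMul_eq_iff.2 (mem_invariants_closure.1 h.2 s hs)⟩

/-- Up to scalars the orbit of `X 0` consists of the six coprime forms `X 0`, `X 1` and `X 1 - i ^ j
X 0`, whose product is minus the vertex form. -/
lemma octaVertex_dvd {i : kˣ} (hi : IsPrimitiveRoot i 4) {g : MvPolynomial (Fin 2) k}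
    (hg : ∀ s ∈ tetraGen i hi, formMul s g = g) (h : X 0 ∣ g) : octaVertex (X 0) (X 1) ∣ g := by
  have h2 := sq_eq_neg_one hi
  obtain ⟨e1, e2, e3, e4⟩ := sigma_sq_apply hi
  have hψ := hg (psi i) (by simp [tetraGen])
  have hσ := hg (sigma i hi ^ 2) (by simp [tetraGen])
  have h1 := X_one_dvd_of_formMul_quatJ (hg quatJ (by simp [tetraGen])) h
  have hm : X 1 - C (-1) * X 0 ∣ g := linear_dvd_of_X_zero_dvd hσ h (by rw [e1, e2]; ring)
  have hp : X 1 - C 1 * X 0 ∣ g := by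
    have := linear_dvd_psi hψ hm
    rwa [h2, neg_mul_neg, one_mul] at this
  have hpi : X 1 - C (i : k) * X 0 ∣ g := by
    rw [linear_form_eq] at hm
    refine linear_dvd hσ hm (c := -1) ?_ ?_ <;> simp only [e1, e2, e3, e4] <;> ring
  have hmi : X 1 - C (-(i : k)) * X 0 ∣ g := by
    have := linear_dvd_psi hψ hpi
    rwa [h2, neg_one_mul] at this
  have hb : X 1 ^ 4 - C (1 ^ 4) * X 0 ^ 4 ∣ g := by
    refine pow_block_dvd (by norm_num) hi one_ne_zero fun j hj => ?_
    rw [mul_one]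
    interval_cases j
    · rwa [pow_zero]
    · rwa [pow_one]
    · rwa [h2]
    · rwa [pow_succ, h2, neg_one_mul]
  have h14 : (1 : k) ^ 4 ≠ 0 := pow_ne_zero 4 one_ne_zero
  have h3 := (isRelPrime_X_one_block 4 (by norm_num) h14).mul_dvd h1 hb
  have h5 := (isRelPrime_X_zero_X_one.mul_right (isRelPrime_X_zero_block 4 (by norm_num) (1 ^ 4))).mul_dvd h h3
  rw [← neg_dvd] at h5
  convert h5 using 1
  rw [octaVertex, one_pow, C_1]
  ring

/-- This excludes degree `4`, the only multiple of `4` not of the form `8 a + 12 b` with `a`, `b`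
the exponents of face and edge forms. -/
lemma eval_zero_one_eq_zero_of_tetraGen {i : kˣ} (hi : IsPrimitiveRoot i 4) {g : MvPolynomial (Fin 2) k}
    (hd : g.IsHomogeneous 4) (hg : ∀ s ∈ tetraGen i hi, formMul s g = g) : eval ![0, 1] g = 0 := by
  have h2 := sq_eq_neg_one hi
  obtain ⟨e1, e2, e3, e4⟩ := sigma_sq_apply hi
  have hJ := hg quatJ (by simp [tetraGen])
  have hσ := hg (sigma i hi ^ 2) (by simp [tetraGen])
  obtain ⟨c, hc⟩ : ∃ c : ℕ → k, ∀ a b : k, eval ![a, b] g =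
      c 0 * a ^ 4 + c 1 * a ^ 3 * b + c 2 * a ^ 2 * b ^ 2 + c 3 * a * b ^ 3 + c 4 * b ^ 4 := by
    refine ⟨fun j => coeff (Finsupp.equivFunOnFinite.symm ![4 - j, j]) g, fun a b => ?_⟩
    conv_lhs => rw [homogeneous_eq_sum hd]
    simp [Finset.sum_range_succ]
  have h0 := eval_formMul quatJ 1 0 g
  have h3 := eval_formMul (sigma i hi ^ 2) 1 0 g
  have h4 := eval_formMul (sigma i hi ^ 2) 0 1 g
  have h5 := eval_formMul (sigma i hi ^ 2) 1 1 g
  have h6 := eval_formMul (sigma i hi ^ 2) 1 (-1) g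
  rw [hσ, hc, hc, e1, e2, e3, e4] at h3 h4 h5 h6
  rw [hJ, hc, hc] at h0
  rw [hc]
  simp [quatJ] at h0
  set p : k := (-1 + (i : k)) / 2 with hp
  set q : k := (1 + (i : k)) / 2 with hq
  have hpq : p * q = -1 / 2 := by rw [hp, hq]; linear_combination h2 / 4
  have hp4 : p ^ 4 = -1 / 4 := by rw [hp]; linear_combination (((i : k) ^ 2 - 4 * i + 5) / 16) * h2
  have hq4 : q ^ 4 = -1 / 4 := by rw [hq]; linear_combination (((i : k) ^ 2 + 4 * i + 5) / 16) * h2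
  -- In `h3 + h4` and in `h5 + h6` the odd coefficients cancel. The two sums give `c 2 = 3 (c 0 + c
  -- 4)` and `c 2 = -3 (c 0 + c 4)`, and `h0` says `c 0 = c 4`.
  have key : 12 * c 4 = 0 := by
    linear_combination (h5 + h6) / 2 + 2 * (h3 + h4) - 6 * h0 + 12 * c 0 * hp4 + 12 * c 4 * hq4 +
      4 * c 2 * (p * q - 1 / 2) * hpq
  have hc4 : c 4 = 0 := by simpa using key
  rw [hc4]
  ring

theorem mem_adjoin_of_tetraGen {i : kˣ} (hi : IsPrimitiveRoot i 4) {d : ℕ} {g : MvPolynomial (Fin 2) k}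
    (hd : g.IsHomogeneous d) (hg : ∀ s ∈ tetraGen i hi, formMul s g = g) :
    g ∈ Algebra.adjoin k ({octaVertex (X 0) (X 1), octaFace (X 0) (X 1), octaEdge (X 0) (X 1)} :
      Set (MvPolynomial (Fin 2) k)) := by
  have hF : eval ![0, 1] (octaFace (X 0) (X 1) : MvPolynomial (Fin 2) k) = 1 := by
    simp [octaFace]
  have hE : eval ![0, 1] (octaEdge (X 0) (X 1) : MvPolynomial (Fin 2) k) = 1 := by
    simp [octaEdge]
  have hV0 : (octaVertex (X 0) (X 1) : MvPolynomial (Fin 2) k) ≠ 0 := fun h => by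
    have := congrArg (eval ![1, 2]) h
    simp [octaVertex] at this
    norm_num at this
  refine mem_of_invariant_form (D := 6) (by norm_num) octaVertex_isHomogeneous hV0
    (octaVertex_mem_invariants hi) (Algebra.subset_adjoin (by simp)) (fun g hg h => octaVertex_dvd hi hg h)
    ?_ d g hd hg
  intro d g hd hg he
  obtain ⟨e, rfl⟩ := dvd_of_formMul_psi hi hd (hg _ (by simp [tetraGen])) he
  have h1 : e ≠ 1 := by
    rintro rfl
    exact he (eval_zero_one_eq_zero_of_tetraGen hi hd hg)
  obtain ⟨a, b, rfl⟩ : ∃ a b, e = 2 * a + 3 * b := by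
    rcases Nat.even_or_odd' e with ⟨c, rfl | rfl⟩
    · exact ⟨c, 0, by ring⟩
    · exact ⟨c - 1, 1, by omega⟩
  refine ⟨octaFace (X 0) (X 1) ^ a * octaEdge (X 0) (X 1) ^ b, ?_, ?_, ?_, ?_⟩
  · exact Subalgebra.mul_mem _ (Subalgebra.pow_mem _ (Algebra.subset_adjoin (by simp)) a)
      (Subalgebra.pow_mem _ (Algebra.subset_adjoin (by simp)) b)
  · rw [show 4 * (2 * a + 3 * b) = 8 * a + 12 * b by ring]
    exact (octaFace_isHomogeneous.pow a).mul (octaEdge_isHomogeneous.pow b)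
  · intro s hs
    obtain ⟨h3, h4⟩ := octaFace_octaEdge_invariant hi s hs
    rw [map_mul, map_pow, map_pow, h3, h4]
  · rw [map_mul, map_pow, map_pow, hF, hE, one_pow, one_pow, mul_one]
    exact one_ne_zero

theorem invariants_binaryTetrahedral {i : kˣ} (hi : IsPrimitiveRoot i 4) :
    invariants (binaryTetrahedral i hi) =
      Algebra.adjoin k (hat 6 (x k * y k * (x k ^ 4 - y k ^ 4)) : Set (B k)) := by
  have e : x k * y k * (x k ^ 4 - y k ^ 4) = formToB k (octaVertex (X 0) (X 1)) := formToB_octaVertex.symm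
  rw [binaryTetrahedral_eq_closure, e]
  refine invariants_closure_eq_adjoin_hat _ octaVertex_isHomogeneous (octaVertex_mem_invariants hi) ?_
  intro A hA hV d g hd hg
  obtain ⟨hF, hE⟩ := formToB_octaFace_octaEdge_mem hA hV
  suffices h : Algebra.adjoin k ({octaVertex (X 0) (X 1), octaFace (X 0) (X 1), octaEdge (X 0) (X 1)} :
      Set (MvPolynomial (Fin 2) k)) ≤ A.comap (formToB k) from h (mem_adjoin_of_tetraGen hi hd hg)
  refine Algebra.adjoin_le ?_
  rintro s (rfl | rfl | rfl)
  · exact hV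
  · exact hF
  · exact hE

end BinaryTetrahedral

section BinaryOctahedral

/-- The `A`-module spanned by `1`, the vertex form and the edge form is closed under products, since
the square of the edge form lies in `A` by `octaEdge_sq`. -/
lemma exists_of_mem_adjoin {g : MvPolynomial (Fin 2) k}
    (hg : g ∈ Algebra.adjoin k ({octaVertex (X 0) (X 1), octaFace (X 0) (X 1), octaEdge (X 0) (X 1)} :
      Set (MvPolynomial (Fin 2) k))) {A : Subalgebra k (MvPolynomial (Fin 2) k)}
    (hF : octaFace (X 0) (X 1) ∈ A) (hVV : octaVertex (X 0) (X 1) ^ 2 ∈ A)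
    (hVE : octaVertex (X 0) (X 1) * octaEdge (X 0) (X 1) ∈ A) :
    ∃ u ∈ A, ∃ v ∈ A, ∃ w ∈ A, g = u + octaVertex (X 0) (X 1) * v + octaEdge (X 0) (X 1) * w := by
  have hEE : octaEdge (X 0) (X 1) ^ 2 ∈ A := by
    rw [octaEdge_sq, show 4 = 2 * 2 from rfl, pow_mul _ 2 2]
    exact A.sub_mem (A.pow_mem hF 3) (A.mul_mem (ofNat_mem A 108) (A.pow_mem hVV 2))
  induction hg using Algebra.adjoin_induction with
  | mem s hs =>
    rcases hs with rfl | rfl | rfl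
    · exact ⟨0, A.zero_mem, 1, A.one_mem, 0, A.zero_mem, by ring⟩
    · exact ⟨_, hF, 0, A.zero_mem, 0, A.zero_mem, by ring⟩
    · exact ⟨0, A.zero_mem, 0, A.zero_mem, 1, A.one_mem, by ring⟩
  | algebraMap r => exact ⟨_, A.algebraMap_mem r, 0, A.zero_mem, 0, A.zero_mem, by ring⟩
  | add a b _ _ ha hb =>
    obtain ⟨u, hu, v, hv, w, hw, rfl⟩ := ha
    obtain ⟨u', hu', v', hv', w', hw', rfl⟩ := hb
    exact ⟨_, A.add_mem hu hu', _, A.add_mem hv hv', _, A.add_mem hw hw', by ring⟩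
  | mul a b _ _ ha hb =>
    obtain ⟨u, hu, v, hv, w, hw, rfl⟩ := ha
    obtain ⟨u', hu', v', hv', w', hw', rfl⟩ := hb
    refine ⟨_, A.add_mem (A.add_mem (A.mul_mem hu hu') (A.mul_mem hVV (A.mul_mem hv hv'))) (A.add_mem
      (A.mul_mem hVE (A.add_mem (A.mul_mem hv hw') (A.mul_mem hw hv'))) (A.mul_mem hEE (A.mul_mem hw hw'))),
      _, A.add_mem (A.mul_mem hu hv') (A.mul_mem hv hu'), _, A.add_mem (A.mul_mem hu hw') (A.mul_mem hw hu'),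
      by ring⟩

lemma formMul_psi_octa {ζ : kˣ} (hζ : IsPrimitiveRoot ζ 8) :
    formMul (psi ζ) (octaVertex (X 0) (X 1)) = -octaVertex (X 0) (X 1) ∧
    formMul (psi ζ) (octaFace (X 0) (X 1)) = octaFace (X 0) (X 1) ∧
    formMul (psi ζ) (octaEdge (X 0) (X 1)) = -octaEdge (X 0) (X 1) := by
  have h4 : (ζ : k) ^ 4 = -1 := by
    have h := hζ.map_of_injective (f := Units.coeHom k) Units.val_injective
    have h2 : IsPrimitiveRoot ((ζ : k) ^ 4) 2 := h.pow (by norm_num) (by norm_num)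
    exact h2.eq_neg_one_of_two_right
  have h1 : (C (ζ : k) * C (↑ζ⁻¹ : k) : MvPolynomial (Fin 2) k) = 1 := by
    rw [← C_mul, Units.mul_inv, C_1]
  have h5 : (C (ζ : k) : MvPolynomial (Fin 2) k) ^ 4 = -1 := by
    rw [← C_pow, h4, C_neg, C_1]
  have h6 : (C (↑ζ⁻¹ : k) : MvPolynomial (Fin 2) k) ^ 4 = -1 := by
    have := congrArg (· ^ 4) h1
    simp only [mul_pow, h5, one_pow] at this
    linear_combination -this
  refine ⟨?_, ?_, ?_⟩
  · rw [← AlgHom.coe_toRingHom, map_octaVertex, AlgHom.coe_toRingHom, formMul_psi_X_zero, formMul_psi_X_one]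
    simp only [octaVertex]
    generalize (C (ζ : k) : MvPolynomial (Fin 2) k) = c at *
    generalize (C (↑ζ⁻¹ : k) : MvPolynomial (Fin 2) k) = c' at *
    rw [mul_mul_mul_comm, h1, mul_pow, mul_pow, h5, h6]
    ring
  · rw [← AlgHom.coe_toRingHom, map_octaFace, AlgHom.coe_toRingHom, formMul_psi_X_zero, formMul_psi_X_one]
    simp only [octaFace, mul_pow]
    rw [show 8 = 4 * 2 from rfl, pow_mul (C _), pow_mul (C _), h5, h6]
    ring
  · rw [← AlgHom.coe_toRingHom, map_octaEdge, AlgHom.coe_toRingHom, formMul_psi_X_zero, formMul_psi_X_one]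
    simp only [octaEdge, mul_pow]
    rw [show 12 = 4 * 3 from rfl, show 8 = 4 * 2 from rfl, pow_mul (C _), pow_mul (C _), pow_mul (C _),
      pow_mul (C _), h5, h6]
    ring

lemma binaryOctahedral_eq_closure [CharZero k] (i : kˣ) (hi : IsPrimitiveRoot i 4) (ζ : kˣ) :
    binaryOctahedral i hi ζ = Subgroup.closure (tetraGen i hi ∪ {psi ζ}) := by
  rw [binaryOctahedral, binaryTetrahedral_eq_closure, ← Subgroup.closure_union]

theorem invariants_binaryOctahedral [CharZero k] {i : kˣ} (hi : IsPrimitiveRoot i 4) {ζ : kˣ}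
    (hζ : IsPrimitiveRoot ζ 8) :
    invariants (binaryOctahedral i hi ζ) =
      Algebra.adjoin k (hat 8 (x k ^ 8 + 14 * x k ^ 4 * y k ^ 4 + y k ^ 8) : Set (B k)) := by
  obtain ⟨eV, eF, eE⟩ := formMul_psi_octa hζ
  have e : x k ^ 8 + 14 * x k ^ 4 * y k ^ 4 + y k ^ 8 = formToB k (octaFace (X 0) (X 1)) :=
    formToB_octaFace.symm
  rw [binaryOctahedral_eq_closure, e]
  refine invariants_closure_eq_adjoin_hat _ octaFace_isHomogeneous ?_ ?_
  · rintro s (hs | rfl)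
    · exact (octaFace_octaEdge_invariant hi s hs).1
    · exact eF
  intro A hA hF d g hd hg
  obtain ⟨hVV, hVE⟩ := formToB_octaVertex_sq_mem hA hF
  obtain ⟨u, hu, v, hv, w, hw, rfl⟩ := exists_of_mem_adjoin
    (mem_adjoin_of_tetraGen hi hd fun s hs => hg s (Or.inl hs))
    -- Intersecting with the forms fixed by `psi ζ` makes `u`, `v`, `w` fixed. As `psi ζ` negates
    -- the vertex and edge forms, an invariant form equals its part `u`.
    (A := A.comap (formToB k) ⊓ AlgHom.equalizer (formMul (psi ζ)) (AlgHom.id k _)) ⟨hF, eF⟩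
    ⟨hVV, by
      change formMul (psi ζ) _ = _
      rw [map_pow, eV, AlgHom.id_apply, neg_sq]⟩
    ⟨hVE, by
      change formMul (psi ζ) _ = _
      rw [map_mul, eV, eE, AlgHom.id_apply, neg_mul_neg]⟩
  have h := hg (psi ζ) (Or.inr rfl)
  have hu' : formMul (psi ζ) u = u := hu.2
  have hv' : formMul (psi ζ) v = v := hv.2
  have hw' : formMul (psi ζ) w = w := hw.2
  rw [map_add, map_add, map_mul (formMul _), map_mul (formMul _), hu', hv', hw', eV, eE] at h
  have h0 : octaVertex (X 0) (X 1) * v + octaEdge (X 0) (X 1) * w = 0 := by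
    have : 2 * (octaVertex (X 0) (X 1) * v + octaEdge (X 0) (X 1) * w) = 0 := by linear_combination -h
    simpa using this
  rw [add_assoc, h0, add_zero]
  exact hu.1

end BinaryOctahedral

end

end SLTwo

/-! ### Binary icosahedral group: generators of the invariants -/

namespace SLTwo

noncomputable section

open MvPolynomial

variable {k : Type*} [Field k]

section Icosahedron

variable {R : Type*} [CommRing R]

/-- The form vanishing at the vertices of an icosahedron. -/
def icosaVertex (x y : R) : R := x * y * (x ^ 10 + 11 * x ^ 5 * y ^ 5 - y ^ 10)

/-- The form vanishing at the face centres of an icosahedron. -/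
def icosaFace (x y : R) : R :=
  -(x ^ 20 + y ^ 20) + 228 * (x ^ 15 * y ^ 5 - x ^ 5 * y ^ 15) - 494 * (x ^ 10 * y ^ 10)

/-- The form vanishing at the edge midpoints of an icosahedron. -/
def icosaEdge (x y : R) : R :=
  x ^ 30 + y ^ 30 + 522 * (x ^ 25 * y ^ 5 - x ^ 5 * y ^ 25) -
    10005 * (x ^ 20 * y ^ 10 + x ^ 10 * y ^ 20)

lemma map_icosaVertex {S : Type*} [CommRing S] (φ : R →+* S) (x y : R) :
    φ (icosaVertex x y) = icosaVertex (φ x) (φ y) := by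
  simp [icosaVertex, map_ofNat φ 11]

lemma map_icosaFace {S : Type*} [CommRing S] (φ : R →+* S) (x y : R) :
    φ (icosaFace x y) = icosaFace (φ x) (φ y) := by
  simp [icosaFace, map_ofNat φ 228, map_ofNat φ 494]

lemma map_icosaEdge {S : Type*} [CommRing S] (φ : R →+* S) (x y : R) :
    φ (icosaEdge x y) = icosaEdge (φ x) (φ y) := by
  simp [icosaEdge, map_ofNat φ 522, map_ofNat φ 10005]

lemma formToB_icosaVertex : formToB k (icosaVertex (X 0) (X 1)) = icosaVertex (x k) (y k) := by
  simpa using map_icosaVertex (formToB k).toRingHom (X 0) (X 1)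

lemma formToB_icosaFace : formToB k (icosaFace (X 0) (X 1)) = icosaFace (x k) (y k) := by
  simpa using map_icosaFace (formToB k).toRingHom (X 0) (X 1)

lemma formToB_icosaEdge : formToB k (icosaEdge (X 0) (X 1)) = icosaEdge (x k) (y k) := by
  simpa using map_icosaEdge (formToB k).toRingHom (X 0) (X 1)

section Derivation

variable {x y z w : R} (δ : Derivation ℤ R R) (h : x * w - y * z = 1) (hx : δ x = z) (hy : δ y = w)
  (hz : δ z = 0) (hw : δ w = 0)

include hx hy in
lemma derivation_icosaVertex : δ (icosaVertex x y) =
    (11 * x ^ 10 * y + 66 * x ^ 5 * y ^ 6 - y ^ 11) * z + (x ^ 11 + 66 * x ^ 6 * y ^ 5 - 11 * x * y ^ 10) * w := by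
  have h11 : δ (11 : R) = 0 := by exact_mod_cast δ.map_natCast 11
  simp only [icosaVertex, map_add, map_sub, Derivation.leibniz, Derivation.leibniz_pow, smul_eq_mul, nsmul_eq_mul,
    hx, hy, h11]
  push_cast
  ring

include hx hy in
lemma derivation_icosaFace : δ (icosaFace x y) =
    (-20 * x ^ 19 + 228 * (15 * x ^ 14 * y ^ 5 - 5 * x ^ 4 * y ^ 15) - 4940 * x ^ 9 * y ^ 10) * z +
    (-20 * y ^ 19 + 228 * (5 * x ^ 15 * y ^ 4 - 15 * x ^ 5 * y ^ 14) - 4940 * x ^ 10 * y ^ 9) * w := by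
  have h228 : δ (228 : R) = 0 := by exact_mod_cast δ.map_natCast 228
  have h494 : δ (494 : R) = 0 := by exact_mod_cast δ.map_natCast 494
  simp only [icosaFace, map_add, map_sub, map_neg, Derivation.leibniz, Derivation.leibniz_pow, smul_eq_mul,
    nsmul_eq_mul, hx, hy, h228, h494]
  push_cast
  ring

include h hx hy hz hw in
-- The Hessian of the vertex form up to a scalar; `icosaEdge_eq` is the Jacobian of the vertex and
-- face forms.
lemma icosaFace_eq : 12 * icosaVertex x y * δ (δ (icosaVertex x y)) - 11 * δ (icosaVertex x y) ^ 2 =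
    11 * icosaFace x y := by
  have h11 : δ (11 : R) = 0 := by exact_mod_cast δ.map_natCast 11
  have h66 : δ (66 : R) = 0 := by exact_mod_cast δ.map_natCast 66
  rw [derivation_icosaVertex δ hx hy]
  simp only [icosaVertex, map_add, map_sub, Derivation.leibniz, Derivation.leibniz_pow, smul_eq_mul,
    nsmul_eq_mul, hx, hy, hz, hw, h11, h66]
  push_cast
  simp only [icosaFace]
  linear_combination 11 * (-(x ^ 20 + y ^ 20) + 228 * (x ^ 15 * y ^ 5 - x ^ 5 * y ^ 15) -
    494 * (x ^ 10 * y ^ 10)) * (x * w - y * z + 1) * h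

include h hx hy in
lemma icosaEdge_eq : 12 * icosaVertex x y * δ (icosaFace x y) - 20 * icosaFace x y * δ (icosaVertex x y) =
    20 * icosaEdge x y := by
  rw [derivation_icosaVertex δ hx hy, derivation_icosaFace δ hx hy]
  simp only [icosaVertex, icosaFace, icosaEdge]
  linear_combination 20 * (x ^ 30 + y ^ 30 + 522 * (x ^ 25 * y ^ 5 - x ^ 5 * y ^ 25) -
    10005 * (x ^ 20 * y ^ 10 + x ^ 10 * y ^ 20)) * h

variable {A : Subring R} (hA : ∀ a ∈ A, δ a ∈ A) (hdiv : ∀ n : ℕ, n ≠ 0 → ∀ b : R, n * b ∈ A → b ∈ A)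

include h hx hy hz hw hA hdiv in
lemma icosaFace_mem (hV : icosaVertex x y ∈ A) : icosaFace x y ∈ A := by
  refine hdiv 11 (by norm_num) _ ?_
  rw [Nat.cast_ofNat, ← icosaFace_eq δ h hx hy hz hw]
  refine A.sub_mem ?_ ?_
  · exact A.mul_mem (A.mul_mem (ofNat_mem A 12) hV) (hA _ (hA _ hV))
  · exact A.mul_mem (ofNat_mem A 11) (A.pow_mem (hA _ hV) 2)

include h hx hy hz hw hA hdiv in
lemma icosaEdge_mem (hV : icosaVertex x y ∈ A) : icosaEdge x y ∈ A := by
  have hF := icosaFace_mem δ h hx hy hz hw hA hdiv hV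
  refine hdiv 20 (by norm_num) _ ?_
  rw [Nat.cast_ofNat, ← icosaEdge_eq δ h hx hy]
  refine A.sub_mem ?_ ?_
  · exact A.mul_mem (A.mul_mem (ofNat_mem A 12) hV) (hA _ hF)
  · exact A.mul_mem (A.mul_mem (ofNat_mem A 20) hF) (hA _ hV)

end Derivation

lemma formToB_icosaFace_icosaEdge_mem [CharZero k] {A : Subalgebra k (B k)} (hA : ∀ a ∈ A, upsilon a ∈ A)
    (hV : formToB k (icosaVertex (X 0) (X 1)) ∈ A) :
    formToB k (icosaFace (X 0) (X 1)) ∈ A ∧ formToB k (icosaEdge (X 0) (X 1)) ∈ A := by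
  rw [formToB_icosaVertex] at hV
  rw [formToB_icosaFace, formToB_icosaEdge]
  exact ⟨icosaFace_mem (A := A.toSubring) (upsilon.restrictScalars ℤ) det_eq upsilon_x upsilon_y upsilon_z
      upsilon_w hA (fun n hn b => (natCast_mul_mem_iff hn).1) hV,
    icosaEdge_mem (A := A.toSubring) (upsilon.restrictScalars ℤ) det_eq upsilon_x upsilon_y upsilon_z
      upsilon_w hA (fun n hn b => (natCast_mul_mem_iff hn).1) hV⟩

lemma icosaVertex_isHomogeneous :
    (icosaVertex (X 0) (X 1) : MvPolynomial (Fin 2) k).IsHomogeneous 12 := by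
  simp only [icosaVertex, mul_assoc (11 : MvPolynomial (Fin 2) k)]
  rw [show (11 : MvPolynomial (Fin 2) k) = C 11 from (map_ofNat C 11).symm]
  exact ((isHomogeneous_X k 0).mul (isHomogeneous_X k 1)).mul (((isHomogeneous_X_pow 0 10).add
    (((isHomogeneous_X_pow 0 5).mul (isHomogeneous_X_pow 1 5)).C_mul _)).sub (isHomogeneous_X_pow 1 10))

lemma icosaFace_isHomogeneous :
    (icosaFace (X 0) (X 1) : MvPolynomial (Fin 2) k).IsHomogeneous 20 := by
  simp only [icosaFace]
  rw [show (228 : MvPolynomial (Fin 2) k) = C 228 from (map_ofNat C 228).symm,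
    show (494 : MvPolynomial (Fin 2) k) = C 494 from (map_ofNat C 494).symm]
  exact (((isHomogeneous_X_pow 0 20).add (isHomogeneous_X_pow 1 20)).neg.add
    ((((isHomogeneous_X_pow 0 15).mul (isHomogeneous_X_pow 1 5)).sub
      ((isHomogeneous_X_pow 0 5).mul (isHomogeneous_X_pow 1 15))).C_mul _)).sub
    (((isHomogeneous_X_pow 0 10).mul (isHomogeneous_X_pow 1 10)).C_mul _)

lemma icosaEdge_isHomogeneous :
    (icosaEdge (X 0) (X 1) : MvPolynomial (Fin 2) k).IsHomogeneous 30 := by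
  simp only [icosaEdge]
  rw [show (522 : MvPolynomial (Fin 2) k) = C 522 from (map_ofNat C 522).symm,
    show (10005 : MvPolynomial (Fin 2) k) = C 10005 from (map_ofNat C 10005).symm]
  exact (((isHomogeneous_X_pow 0 30).add (isHomogeneous_X_pow 1 30)).add
    ((((isHomogeneous_X_pow 0 25).mul (isHomogeneous_X_pow 1 5)).sub
      ((isHomogeneous_X_pow 0 5).mul (isHomogeneous_X_pow 1 25))).C_mul _)).sub
    ((((isHomogeneous_X_pow 0 20).mul (isHomogeneous_X_pow 1 10)).add
      ((isHomogeneous_X_pow 0 10).mul (isHomogeneous_X_pow 1 20))).C_mul _)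

/-- `kappa` is a multiple of the matrix `(1, τ; τ, -1)`. The new `x y` is `τ (x ^ 2 + x y - y ^ 2)`,
a factor of the old dodecic; fifth powers are reduced to the form `P + τ Q`, so that the remaining
factors are compared with only one use of `h2`. -/
lemma icosaVertex_golden {τ : R} (h2 : τ ^ 2 = τ + 1) (x y : R) :
    icosaVertex (x + τ * y) (τ * x - y) = 125 * τ ^ 6 * icosaVertex x y := by
  have h3 : τ ^ 3 = 2 * τ + 1 := by linear_combination (τ + 1) * h2
  have h4 : τ ^ 4 = 3 * τ + 2 := by linear_combination (τ ^ 2 + τ + 2) * h2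
  have h5 : τ ^ 5 = 5 * τ + 3 := by linear_combination (τ ^ 3 + τ ^ 2 + 2 * τ + 3) * h2
  set P := x ^ 5 + 10 * x ^ 3 * y ^ 2 + 10 * x ^ 2 * y ^ 3 + 10 * x * y ^ 4 + 3 * y ^ 5 with hP
  set Q := 5 * x ^ 4 * y + 10 * x ^ 3 * y ^ 2 + 20 * x ^ 2 * y ^ 3 + 15 * x * y ^ 4 + 5 * y ^ 5 with hQ
  set P' := 3 * x ^ 5 - 10 * x ^ 4 * y + 10 * x ^ 3 * y ^ 2 - 10 * x ^ 2 * y ^ 3 - y ^ 5 with hP'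
  set Q' := 5 * x ^ 5 - 15 * x ^ 4 * y + 20 * x ^ 3 * y ^ 2 - 10 * x ^ 2 * y ^ 3 + 5 * x * y ^ 4 with hQ'
  have hu : (x + τ * y) ^ 5 = P + τ * Q := by
    rw [hP, hQ]
    linear_combination 10 * x ^ 3 * y ^ 2 * h2 + 10 * x ^ 2 * y ^ 3 * h3 + 5 * x * y ^ 4 * h4 + y ^ 5 * h5
  have hv : (τ * x - y) ^ 5 = P' + τ * Q' := by
    rw [hP', hQ']
    linear_combination x ^ 5 * h5 - 5 * x ^ 4 * y * h4 + 10 * x ^ 3 * y ^ 2 * h3 - 10 * x ^ 2 * y ^ 3 * h2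
  have huv : (x + τ * y) * (τ * x - y) = τ * (x ^ 2 + x * y - y ^ 2) := by
    linear_combination x * y * h2
  set S := (x ^ 4 - 3 * x ^ 3 * y + 4 * x ^ 2 * y ^ 2 - 2 * x * y ^ 3 + y ^ 4) *
    (x ^ 4 + 2 * x ^ 3 * y + 4 * x ^ 2 * y ^ 2 + 3 * x * y ^ 3 + y ^ 4) with hS
  have hfac : x ^ 10 + 11 * x ^ 5 * y ^ 5 - y ^ 10 = (x ^ 2 + x * y - y ^ 2) * S := by
    rw [hS]; ring
  have hmain : (P + τ * Q) ^ 2 + 11 * (P + τ * Q) * (P' + τ * Q') - (P' + τ * Q') ^ 2 =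
      125 * (5 * τ + 3) * (x * y * S) := by
    rw [hP, hQ, hP', hQ', hS]
    linear_combination ((5 * x ^ 4 * y + 10 * x ^ 3 * y ^ 2 + 20 * x ^ 2 * y ^ 3 + 15 * x * y ^ 4 + 5 * y ^ 5) ^ 2 +
      11 * (5 * x ^ 4 * y + 10 * x ^ 3 * y ^ 2 + 20 * x ^ 2 * y ^ 3 + 15 * x * y ^ 4 + 5 * y ^ 5) *
      (5 * x ^ 5 - 15 * x ^ 4 * y + 20 * x ^ 3 * y ^ 2 - 10 * x ^ 2 * y ^ 3 + 5 * x * y ^ 4) -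
      (5 * x ^ 5 - 15 * x ^ 4 * y + 20 * x ^ 3 * y ^ 2 - 10 * x ^ 2 * y ^ 3 + 5 * x * y ^ 4) ^ 2) * h2
  rw [icosaVertex, icosaVertex, huv, hfac, show 10 = 5 * 2 from rfl, pow_mul, pow_mul, hu, hv, hmain, ← h5]
  ring

end Icosahedron

section BinaryIcosahedral

variable [CharZero k]

/-- `τ` is the ratio of the off-diagonal to the diagonal entry `α`. The two quadratic relations
replace computations with `ζ` and serve both choices of `s`. -/
lemma kappa_apply {ζ : kˣ} (hζ : IsPrimitiveRoot ζ 5) {s : k} (hs : s ^ 2 = 5) :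
    ∃ α τ : k, τ ^ 2 = τ + 1 ∧ 5 * α ^ 2 = τ - 3 ∧ kappa ζ hζ s hs 0 0 = α ∧
      kappa ζ hζ s hs 0 1 = α * τ ∧ kappa ζ hζ s hs 1 0 = α * τ ∧ kappa ζ hζ s hs 1 1 = -α := by
  have h := hζ.map_of_injective (f := Units.coeHom k) Units.val_injective
  have hsum : (1 : k) + ζ + (ζ : k) ^ 2 + (ζ : k) ^ 3 + (ζ : k) ^ 4 = 0 := by
    simpa [Finset.sum_range_succ] using h.geom_sum_eq_zero (by norm_num)
  have h5 : (ζ : k) ^ 5 = 1 := by simpa using h.pow_eq_one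
  have hs0 : s ≠ 0 := by
    rintro rfl
    norm_num at hs
  have ha : (ζ : k) ^ 4 - ζ ≠ 0 := by
    intro h0
    have := h.pow_inj (i := 4) (j := 1) (by norm_num) (by norm_num) (by simpa using sub_eq_zero.1 h0)
    norm_num at this
  have key : ∀ c : k, s⁻¹ * c = s⁻¹ * ((ζ : k) ^ 4 - ζ) * (c / ((ζ : k) ^ 4 - ζ)) := fun c => by
    rw [mul_assoc, ← mul_div_assoc, mul_div_cancel_left₀ _ ha]
  refine ⟨s⁻¹ * ((ζ : k) ^ 4 - ζ), ((ζ : k) ^ 2 - (ζ : k) ^ 3) / ((ζ : k) ^ 4 - ζ), ?_, ?_, ?_, ?_, ?_, ?_⟩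
  · rw [div_pow, div_add_one ha, div_eq_div_iff (pow_ne_zero 2 ha) ha]
    linear_combination ((ζ : k) ^ 4 - ζ) * ((ζ : k) ^ 2 - (ζ : k) ^ 3) * h5
  · rw [mul_pow, inv_pow, hs, ← mul_assoc, mul_inv_cancel₀ (by norm_num), one_mul, eq_sub_iff_add_eq,
      eq_div_iff ha]
    linear_combination ((ζ : k) ^ 2 * ((ζ : k) ^ 5 + 1) - 3 * (ζ : k) ^ 4 + 3 * ζ) * h5
  · simp [kappa]
  · rw [← key]; simp [kappa]
  · rw [← key]; simp [kappa]
  · simp only [kappa]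
    simp
    ring

/-- Generators of the binary icosahedral group. -/
def icosaGen (ζ : kˣ) (hζ : IsPrimitiveRoot ζ 5) (s : k) (hs : s ^ 2 = 5) :
    Set (Matrix.SpecialLinearGroup (Fin 2) k) :=
  {psi ζ, kappa ζ hζ s hs, quatJ}

variable {ζ : kˣ} (hζ : IsPrimitiveRoot ζ 5) {s : k} (hs : s ^ 2 = 5)

lemma icosaVertex_invariant :
    ∀ h ∈ icosaGen ζ hζ s hs, formMul h (icosaVertex (X 0) (X 1)) = icosaVertex (X 0) (X 1) := by
  rintro h (rfl | rfl | rfl) <;>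
    rw [← AlgHom.coe_toRingHom, map_icosaVertex, AlgHom.coe_toRingHom]
  · rw [formMul_psi_X_zero, formMul_psi_X_one]
    have h1 : (C (ζ : k) * C (↑ζ⁻¹ : k) : MvPolynomial (Fin 2) k) = 1 := by
      rw [← C_mul, Units.mul_inv, C_1]
    have h5 : (C (ζ : k) : MvPolynomial (Fin 2) k) ^ 5 = 1 := by
      rw [← C_pow, ← Units.val_pow_eq_pow_val, hζ.pow_eq_one, Units.val_one, C_1]
    have h6 : (C (↑ζ⁻¹ : k) : MvPolynomial (Fin 2) k) ^ 5 = 1 := by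
      rw [← one_pow 5, ← h1, mul_pow, h5, one_mul]
    simp only [icosaVertex]
    rw [mul_mul_mul_comm, h1, show 10 = 5 * 2 from rfl]
    simp only [mul_pow, pow_mul, h5, h6, one_mul]
  · obtain ⟨α, τ, h2, hα, e1, e2, e3, e4⟩ := kappa_apply hζ hs
    rw [formMul_X, formMul_X, e1, e2, e3, e4]
    have hτ : (C τ : MvPolynomial (Fin 2) k) ^ 2 = C τ + 1 := by rw [← C_pow, h2, C_add, C_1]
    have h12 : C α ^ 12 * (125 * C τ ^ 6) = (1 : MvPolynomial (Fin 2) k) := by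
      rw [show (125 : MvPolynomial (Fin 2) k) = C 125 from (map_ofNat C 125).symm, ← C_pow, ← C_pow, ← C_mul,
        ← C_mul, ← C_1]
      congr 1
      -- Its cube is `5 ^ 6 * α ^ 12 * τ ^ 6 = 125`, which is the required normalization.
      have h3 : (5 * α ^ 2 * τ) ^ 2 = 5 := by
        rw [hα]; linear_combination (τ ^ 2 - 5 * τ + 5) * h2
      have h4 : (5 : k) ^ 6 * (α ^ 12 * (125 * τ ^ 6)) = 5 ^ 6 * 1 := by
        linear_combination 125 * ((5 * α ^ 2 * τ) ^ 4 + 5 * (5 * α ^ 2 * τ) ^ 2 + 25) * h3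
      exact mul_left_cancel₀ (by norm_num) h4
    have e5 : (X 0 : MvPolynomial (Fin 2) k) * C α + X 1 * C (α * τ) = C α * (X 0 + C τ * X 1) := by rw [C_mul]; ring
    have e6 : (X 0 : MvPolynomial (Fin 2) k) * C (α * τ) + X 1 * C (-α) = C α * (C τ * X 0 - X 1) := by rw [C_mul, C_neg]; ring
    rw [e5, e6]
    have e7 : ∀ c u v : MvPolynomial (Fin 2) k, icosaVertex (c * u) (c * v) = c ^ 12 * icosaVertex u v :=
      fun c u v => by simp only [icosaVertex]; ring
    rw [e7, icosaVertex_golden hτ, ← mul_assoc, h12, one_mul]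
  · rw [formMul_quatJ_X_zero, formMul_quatJ_X_one]
    simp only [icosaVertex]
    ring

lemma icosaFace_icosaEdge_invariant :
    ∀ h ∈ icosaGen ζ hζ s hs, formMul h (icosaFace (X 0) (X 1)) = icosaFace (X 0) (X 1) ∧
      formMul h (icosaEdge (X 0) (X 1)) = icosaEdge (X 0) (X 1) := by
  have h := formToB_icosaFace_icosaEdge_mem (A := invariants (Subgroup.closure (icosaGen ζ hζ s hs)))
    (fun a ha h hh => by rw [← upsilon_rightMul, ha h hh])
    (mem_invariants_closure.2 fun t ht => formMul_eq_iff.1 (icosaVertex_invariant hζ hs t ht))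
  exact fun t ht => ⟨formMul_eq_iff.2 (mem_invariants_closure.1 h.1 t ht),
    formMul_eq_iff.2 (mem_invariants_closure.1 h.2 t ht)⟩

/-- The orbit of `X 0` has twelve members up to scalars: `X 0`, `X 1`, and two blocks of five, with
slopes `τ` and `1 - τ` times fifth roots of unity. -/
lemma icosaVertex_dvd {g : MvPolynomial (Fin 2) k} (hg : ∀ t ∈ icosaGen ζ hζ s hs, formMul t g = g)
    (h : X 0 ∣ g) : icosaVertex (X 0) (X 1) ∣ g := by
  obtain ⟨α, τ, h2, hα, e1, e2, e3, e4⟩ := kappa_apply hζ hs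
  have hψ := hg (psi ζ) (by simp [icosaGen])
  have hκ := hg (kappa ζ hζ s hs) (by simp [icosaGen])
  have h1 := X_one_dvd_of_formMul_quatJ (hg quatJ (by simp [icosaGen])) h
  have hζ2 : IsPrimitiveRoot (ζ ^ 2) 5 := hζ.pow_of_coprime 2 (by norm_num)
  have hblock : ∀ t : k, t ≠ 0 → X 1 - C t * X 0 ∣ g → X 1 ^ 5 - C (t ^ 5) * X 0 ^ 5 ∣ g := by
    intro t ht hd
    refine pow_block_dvd (by norm_num) hζ2 ht fun j _ => ?_
    induction j with
    | zero => simpa using hd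
    | succ j ih =>
      have := linear_dvd_psi hψ (ih (by omega))
      rwa [← mul_assoc, ← Units.val_pow_eq_pow_val, ← pow_succ'] at this
  have hτ0 : τ ≠ 0 := by rintro rfl; norm_num at h2
  have hτ1 : 1 - τ ≠ 0 := fun h0 => hτ0 (by linear_combination (-τ) * h2 - τ ^ 2 * h0)
  have hb1 := hblock τ hτ0 (linear_dvd_of_X_one_dvd hκ h1 (by rw [e2, e4]; ring))
  have hb2 := hblock (1 - τ) hτ1 (linear_dvd_of_X_zero_dvd hκ h (by
    rw [e1, e3]; linear_combination (-α) * h2))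
  have h5 : τ ^ 5 = 5 * τ + 3 := by linear_combination (τ ^ 3 + τ ^ 2 + 2 * τ + 3) * h2
  have h5' : (1 - τ) ^ 5 = 8 - 5 * τ := by linear_combination (-τ ^ 3 + 4 * τ ^ 2 - 7 * τ + 7) * h2
  have hne : τ ^ 5 ≠ (1 - τ) ^ 5 := by
    rw [h5, h5']
    intro h0
    have h3 : τ = 1 / 2 := by linear_combination h0 / 10
    rw [h3] at h2
    norm_num at h2
  have hm := (isRelPrime_blocks 5 hne).mul_dvd hb1 hb2
  have hm1 := ((isRelPrime_X_one_block 5 (by norm_num) (pow_ne_zero 5 hτ0)).mul_right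
    (isRelPrime_X_one_block 5 (by norm_num) (pow_ne_zero 5 hτ1))).mul_dvd h1 hm
  have hm0 := (isRelPrime_X_zero_X_one.mul_right ((isRelPrime_X_zero_block 5 (by norm_num) (τ ^ 5)).mul_right
    (isRelPrime_X_zero_block 5 (by norm_num) ((1 - τ) ^ 5)))).mul_dvd h hm1
  rw [← neg_dvd] at hm0
  convert hm0 using 1
  -- The sum and the product of the two fifth powers are the coefficients `11` and `-1` of the
  -- vertex form.
  have hsum : C (τ ^ 5) + C ((1 - τ) ^ 5) = (11 : MvPolynomial (Fin 2) k) := by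
    rw [← C_add, h5, h5', show (11 : MvPolynomial (Fin 2) k) = C 11 from (map_ofNat C 11).symm]
    congr 1; ring
  have hprod : C (τ ^ 5) * C ((1 - τ) ^ 5) = (-1 : MvPolynomial (Fin 2) k) := by
    rw [← C_mul, ← mul_pow, show τ * (1 - τ) = -1 by linear_combination -h2, Odd.neg_one_pow (by decide), C_neg, C_1]
  rw [icosaVertex]
  linear_combination (-(X 0 : MvPolynomial (Fin 2) k) ^ 6 * X 1 ^ 6) * hsum +
    (X 0 : MvPolynomial (Fin 2) k) ^ 11 * X 1 * hprod

/-- The square of `quatJ` is `-1`, which acts on forms of degree `d` by `(-1) ^ d`. -/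
lemma two_dvd_of_formMul_quatJ {d : ℕ} {g : MvPolynomial (Fin 2) k} (hd : g.IsHomogeneous d)
    (hg : formMul quatJ g = g) (he : eval ![0, 1] g ≠ 0) : 2 ∣ d := by
  have h1 := eval_formMul quatJ 0 1 g
  have h2 := eval_formMul quatJ (-1) 0 g
  rw [hg] at h1 h2
  simp only [quatJ, Matrix.SpecialLinearGroup.coe_mk, Matrix.of_apply, Matrix.cons_val_zero, Matrix.cons_val_one,
    Matrix.cons_val', mul_one, mul_zero, add_zero, zero_add, mul_neg, neg_zero] at h1 h2
  have h3 : eval ![0, -1] g = (-1) ^ d * eval ![0, 1] g := by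
    conv_lhs => rw [homogeneous_eq_sum hd]
    rw [eval_zero_one hd, map_sum, Finset.sum_eq_single d]
    · simp [mul_comm]
    · intro j hj hjd
      have := Finset.mem_range.1 hj
      simp [show d - j ≠ 0 by omega]
    · intro h
      exact absurd (Finset.mem_range.2 (by omega)) h
  refine even_iff_two_dvd.1 (Nat.not_odd_iff_even.1 fun ho => he ?_)
  have h4 : 2 * eval ![0, 1] g = 0 := by
    rw [ho.neg_one_pow] at h3
    linear_combination h1 + h2 + h3
  simpa using h4

/-- Degree `10` is the only multiple of `10` not of the form `20 a + 30 b`. Under `psi ζ` three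
monomials survive, `quatJ` gives `c 5 = 0` and `c 0 = c 10`, and the value of `kappa` at `(1, 0)`
gives `c 10 = -c 10 / 5`. -/
lemma eval_zero_one_eq_zero_of_icosaGen {g : MvPolynomial (Fin 2) k}
    (hd : g.IsHomogeneous 10) (hg : ∀ t ∈ icosaGen ζ hζ s hs, formMul t g = g) : eval ![0, 1] g = 0 := by
  obtain ⟨α, τ, h2, hα, e1, e2, e3, e4⟩ := kappa_apply hζ hs
  have hψ := hg (psi ζ) (by simp [icosaGen])
  have hκ := hg (kappa ζ hζ s hs) (by simp [icosaGen])
  have hJ := hg quatJ (by simp [icosaGen])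
  obtain ⟨c, hc⟩ : ∃ c : ℕ → k, ∀ a b : k, eval ![a, b] g =
      c 0 * a ^ 10 + c 5 * a ^ 5 * b ^ 5 + c 10 * b ^ 10 := by
    refine ⟨fun j => coeff (Finsupp.equivFunOnFinite.symm ![10 - j, j]) g, fun a b => ?_⟩
    have h0 : ∀ j ≤ 10, ¬ (10 - j ≡ j [MOD 5]) →
        coeff (Finsupp.equivFunOnFinite.symm ![10 - j, j]) g = 0 := by
      intro j _ hj
      by_contra hne
      exact hj (by simpa using modEq_of_formMul_psi hζ hψ hne)
    conv_lhs => rw [homogeneous_eq_sum hd]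
    simp only [Finset.sum_range_succ, Finset.sum_range_zero]
    rw [h0 1 (by norm_num) (by decide), h0 2 (by norm_num) (by decide), h0 3 (by norm_num) (by decide),
      h0 4 (by norm_num) (by decide), h0 6 (by norm_num) (by decide), h0 7 (by norm_num) (by decide),
      h0 8 (by norm_num) (by decide), h0 9 (by norm_num) (by decide)]
    simp
  have h0 := eval_formMul quatJ 1 0 g
  have h1 := eval_formMul quatJ 1 1 g
  have h3 := eval_formMul (kappa ζ hζ s hs) 1 0 g
  rw [hκ, hc, hc, e1, e2, e3, e4] at h3
  rw [hJ, hc, hc] at h0 h1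
  rw [hc]
  simp [quatJ] at h0 h1
  have hc5 : c 5 = 0 := by linear_combination h1 / 2
  have hτ : 5 * (α ^ 10 * (1 + τ ^ 10)) = -1 := by
    have e5 : τ ^ 5 = 5 * τ + 3 := by linear_combination (τ ^ 3 + τ ^ 2 + 2 * τ + 3) * h2
    have e6 : (5 * α ^ 2) ^ 5 = 275 * τ - 450 := by
      rw [hα]
      linear_combination (τ ^ 3 - 14 * τ ^ 2 + 77 * τ - 207) * h2
    have e7 : (5 : k) ^ 5 * (5 * (α ^ 10 * (1 + τ ^ 10))) = 5 ^ 5 * (-1) := by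
      linear_combination 5 * (1 + τ ^ 10) * e6 + 5 * (275 * τ - 450) * (τ ^ 5 + 5 * τ + 3) * e5 +
        5 * (275 * τ - 450) * 25 * h2 + 75625 * h2
    exact mul_left_cancel₀ (by norm_num) e7
  have key : 6 * c 10 = 0 := by
    rw [hc5] at h3
    linear_combination 5 * h3 - 5 * h0 + c 10 * hτ + 5 * α ^ 10 * h0
  have hc10 : c 10 = 0 := by simpa using key
  rw [hc10]
  ring

theorem invariants_binaryIcosahedral :
    invariants (binaryIcosahedral ζ hζ s hs) = Algebra.adjoin k
      (hat 12 (x k * y k * (x k ^ 10 + 11 * x k ^ 5 * y k ^ 5 - y k ^ 10)) : Set (B k)) := by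
  have e : x k * y k * (x k ^ 10 + 11 * x k ^ 5 * y k ^ 5 - y k ^ 10) =
    formToB k (icosaVertex (X 0) (X 1)) := formToB_icosaVertex.symm
  rw [e]
  refine invariants_closure_eq_adjoin_hat (icosaGen ζ hζ s hs) icosaVertex_isHomogeneous
    (icosaVertex_invariant hζ hs) ?_
  intro A hA hV d g hd hg
  obtain ⟨hF, hE⟩ := formToB_icosaFace_icosaEdge_mem hA hV
  have hF1 : eval ![0, 1] (icosaFace (X 0) (X 1) : MvPolynomial (Fin 2) k) = -1 := by
    simp [icosaFace]
  have hE1 : eval ![0, 1] (icosaEdge (X 0) (X 1) : MvPolynomial (Fin 2) k) = 1 := by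
    simp [icosaEdge]
  have hV0 : (icosaVertex (X 0) (X 1) : MvPolynomial (Fin 2) k) ≠ 0 := fun h => by
    have := congrArg (eval ![1, 1]) h
    simp [icosaVertex] at this
  refine mem_of_invariant_form (𝒜 := A.comap (formToB k)) (D := 12) (by norm_num) icosaVertex_isHomogeneous hV0
    (icosaVertex_invariant hζ hs) hV (fun g hg h => icosaVertex_dvd hζ hs hg h) ?_ d g hd hg
  intro d g hd hg he
  have h5 := dvd_of_formMul_psi hζ hd (hg _ (by simp [icosaGen])) he
  have h2 := two_dvd_of_formMul_quatJ hd (hg _ (by simp [icosaGen])) he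
  obtain ⟨e, rfl⟩ : 10 ∣ d := by omega
  have h1 : e ≠ 1 := by
    rintro rfl
    exact he (eval_zero_one_eq_zero_of_icosaGen hζ hs hd hg)
  obtain ⟨a, b, rfl⟩ : ∃ a b, e = 2 * a + 3 * b := by
    rcases Nat.even_or_odd' e with ⟨c, rfl | rfl⟩
    · exact ⟨c, 0, by ring⟩
    · exact ⟨c - 1, 1, by omega⟩
  refine ⟨icosaFace (X 0) (X 1) ^ a * icosaEdge (X 0) (X 1) ^ b, ?_, ?_, ?_, ?_⟩
  · exact Subalgebra.mul_mem _ (Subalgebra.pow_mem (A.comap (formToB k)) hF a)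
      (Subalgebra.pow_mem (A.comap (formToB k)) hE b)
  · rw [show 10 * (2 * a + 3 * b) = 20 * a + 30 * b by ring]
    exact (icosaFace_isHomogeneous.pow a).mul (icosaEdge_isHomogeneous.pow b)
  · intro t ht
    obtain ⟨h3, h4⟩ := icosaFace_icosaEdge_invariant hζ hs t ht
    rw [map_mul, map_pow, map_pow, h3, h4]
  · rw [map_mul, map_pow, map_pow, hF1, hE1, one_pow, mul_one]
    exact pow_ne_zero _ (neg_ne_zero.2 one_ne_zero)

end BinaryIcosahedral

end

end SLTwo

/-! ### Binary icosahedral group: absence of characters and factoriality -/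

namespace SLTwo

noncomputable section

variable {k : Type*} [Field k]

/-- The action of a subgroup of `SL₂(k)` on `B` by right multiplication. -/
abbrev rightMulAction (H : Subgroup (Matrix.SpecialLinearGroup (Fin 2) k)) :
    MulSemiringAction H (B k) where
  smul h b := rightMul (h : Matrix.SpecialLinearGroup (Fin 2) k) b
  one_smul b := by
    change rightMul ((1 : H) : Matrix.SpecialLinearGroup (Fin 2) k) b = b
    rw [Subgroup.coe_one, rightMul_one]
  mul_smul g h b := by
    change rightMul ((g * h : H) : Matrix.SpecialLinearGroup (Fin 2) k) b = rightMul g.1 (rightMul h.1 b)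
    rw [Subgroup.coe_mul, rightMul_mul]
  smul_zero h := map_zero (rightMul (h : Matrix.SpecialLinearGroup (Fin 2) k))
  smul_add h := map_add (rightMul (h : Matrix.SpecialLinearGroup (Fin 2) k))
  smul_one h := map_one (rightMul (h : Matrix.SpecialLinearGroup (Fin 2) k))
  smul_mul h := map_mul (rightMul (h : Matrix.SpecialLinearGroup (Fin 2) k))

lemma algebraMap_B_injective : Function.Injective (algebraMap k (B k)) :=
  (algebraMap k (B k)).injective

/-- The ring of invariants of a group without nontrivial characters is factorial. -/
theorem uniqueFactorizationMonoid_invariants (H : Subgroup (Matrix.SpecialLinearGroup (Fin 2) k))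
    (hχ : ∀ (χ : H →* k) (h : H), χ h = 1) : UniqueFactorizationMonoid (invariants H) := by
  let _ := rightMulAction H
  refine uniqueFactorizationMonoid_of_fixed (G := H) (invariants H).val.toRingHom Subtype.val_injective
    (fun b => ?_) ?_
  · refine ⟨?_, fun hb => ⟨⟨b, fun h hh => hb ⟨h, hh⟩⟩, rfl⟩⟩
    rintro ⟨a, rfl⟩ g
    exact a.2 g g.2
  · intro e he hassoc
    -- Units of `B` are constants, so an element fixed up to units is multiplied by a character.
    have hex : ∀ g : H, ∃ c : k, rightMul (g : Matrix.SpecialLinearGroup (Fin 2) k) e =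
        algebraMap k (B k) c * e := by
      intro g
      obtain ⟨u, hu⟩ := (hassoc g).symm
      obtain ⟨c, hc⟩ := eq_algebraMap_of_isUnit u.isUnit
      exact ⟨c, by rw [← hc, mul_comm, hu]; rfl⟩
    choose c hc using hex
    have hinj : ∀ a b : k, algebraMap k (B k) a * e = algebraMap k (B k) b * e → a = b := fun a b h =>
      algebraMap_B_injective (mul_right_cancel₀ he h)
    let χ : H →* k :=
      { toFun := c
        map_one' := hinj _ _ (by rw [← hc, Subgroup.coe_one, rightMul_one, map_one, one_mul])
        map_mul' := fun g h => hinj _ _ (by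
          rw [← hc, Subgroup.coe_mul, rightMul_mul, hc, map_mul, AlgHom.commutes, hc, map_mul]
          ring) }
    intro g
    have h1 : c g = 1 := hχ χ g
    exact (hc g).trans (by rw [h1, map_one, one_mul])

lemma ext_two {g h : Matrix.SpecialLinearGroup (Fin 2) k} (h00 : g 0 0 = h 0 0) (h01 : g 0 1 = h 0 1)
    (h10 : g 1 0 = h 1 0) (h11 : g 1 1 = h 1 1) : g = h := by
  ext i j
  fin_cases i <;> fin_cases j <;> assumption

lemma quatJ_apply : quatJ (k := k) 0 0 = 0 ∧ quatJ (k := k) 0 1 = 1 ∧ quatJ (k := k) 1 0 = -1 ∧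
    quatJ (k := k) 1 1 = 0 := by
  simp [quatJ]

lemma psi_apply (ζ : kˣ) : psi ζ 0 0 = (ζ : k) ∧ psi ζ 0 1 = 0 ∧ psi ζ 1 0 = 0 ∧ psi ζ 1 1 = (↑ζ⁻¹ : k) := by
  simp [psi]

lemma psi_pow (ζ : kˣ) (n : ℕ) : psi ζ ^ n = psi (ζ ^ n) := by
  induction n with
  | zero => rw [pow_zero, pow_zero]; refine ext_two ?_ ?_ ?_ ?_ <;> simp [psi]
  | succ n ih =>
    rw [pow_succ, ih]
    obtain ⟨a1, a2, a3, a4⟩ := psi_apply ζ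
    obtain ⟨b1, b2, b3, b4⟩ := psi_apply (ζ ^ n)
    obtain ⟨c1, c2, c3, c4⟩ := psi_apply (ζ ^ (n + 1))
    refine ext_two ?_ ?_ ?_ ?_ <;> rw [mul_apply_two] <;> simp only [*] <;> simp [pow_succ, mul_comm]

/-- A matrix of determinant `1` and trace `±1` has order `6` or `3`. -/
lemma pow_three_eq_of_trace {M : Matrix.SpecialLinearGroup (Fin 2) k} (ht : (M 0 0 + M 1 1) ^ 2 = 1) :
    M ^ 3 = 1 ∨ M ^ 3 = quatJ ^ 2 := by
  have hD : M 0 0 * M 1 1 - M 0 1 * M 1 0 = 1 := det_entries M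
  obtain ⟨j1, j2, j3, j4⟩ := quatJ_apply (k := k)
  -- By Cayley–Hamilton trace `1` gives `M ^ 3 = -1`, which is `quatJ ^ 2`, and trace `-1` gives `M
  -- ^ 3 = 1`.
  rcases (sq_eq_sq_iff_eq_or_eq_neg.1 (ht.trans (one_pow 2).symm)) with h | h
  · right
    rw [pow_succ, pow_two, pow_two]
    refine ext_two ?_ ?_ ?_ ?_ <;> simp only [mul_apply_two, j1, j2, j3, j4]
    · linear_combination M 0 0 * ht - (2 * M 0 0 + M 1 1) * hD - h
    · linear_combination M 0 1 * ht - M 0 1 * hD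
    · linear_combination M 1 0 * ht - M 1 0 * hD
    · linear_combination M 1 1 * ht - (M 0 0 + 2 * M 1 1) * hD - h
  · left
    rw [pow_succ, pow_two]
    refine ext_two ?_ ?_ ?_ ?_ <;> simp only [mul_apply_two, Matrix.SpecialLinearGroup.coe_one, Matrix.one_apply]
    · simp
      linear_combination M 0 0 * ht - (2 * M 0 0 + M 1 1) * hD - h
    · simp
      linear_combination M 0 1 * ht - M 0 1 * hD
    · simp
      linear_combination M 1 0 * ht - M 1 0 * hD
    · simp
      linear_combination M 1 1 * ht - (M 0 0 + 2 * M 1 1) * hD - h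

variable [CharZero k]

/-- The numbers squared are the traces of `psi ζ ^ 2 * kappa` and `quatJ * psi ζ * kappa`. -/
lemma kappa_trace {ζ : kˣ} (hζ : IsPrimitiveRoot ζ 5) {s : k} (hs : s ^ 2 = 5) :
    (kappa ζ hζ s hs 0 0 * ((ζ : k) ^ 2 - (ζ : k) ^ 3)) ^ 2 = 1 ∧
      (kappa ζ hζ s hs 0 1 * ((ζ : k) ^ 4 - ζ)) ^ 2 = 1 := by
  have h := hζ.map_of_injective (f := Units.coeHom k) Units.val_injective
  have hsum : (1 : k) + ζ + (ζ : k) ^ 2 + (ζ : k) ^ 3 + (ζ : k) ^ 4 = 0 := by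
    simpa [Finset.sum_range_succ] using h.geom_sum_eq_zero (by norm_num)
  have h5 : (ζ : k) ^ 5 = 1 := by simpa using h.pow_eq_one
  have ha2 : ((ζ : k) ^ 4 - ζ) ^ 2 = (ζ : k) ^ 3 + (ζ : k) ^ 2 - 2 := by
    linear_combination ((ζ : k) ^ 3 - 2) * h5
  have hb2 : ((ζ : k) ^ 2 - (ζ : k) ^ 3) ^ 2 = (ζ : k) ^ 4 + ζ - 2 := by
    linear_combination ((ζ : k) - 2) * h5
  have hab : (((ζ : k) ^ 4 - ζ) * ((ζ : k) ^ 2 - (ζ : k) ^ 3)) ^ 2 = 5 := by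
    rw [mul_pow, ha2, hb2]
    linear_combination ((ζ : k) ^ 2 + ζ) * h5 - hsum
  have h1 : (s⁻¹ * (((ζ : k) ^ 4 - ζ) * ((ζ : k) ^ 2 - (ζ : k) ^ 3))) ^ 2 = 1 := by
    rw [mul_pow, hab, inv_pow, hs, inv_mul_cancel₀ (by norm_num)]
  constructor
  · refine Eq.trans ?_ h1; simp only [kappa]; simp; ring
  · refine Eq.trans ?_ h1; simp only [kappa]; simp; ring

/-- Relations chosen to kill every character `χ`. The first two give `χ (psi ζ) = 1`, the next two
give `χ` of `quatJ` and of `kappa` square `1`, and the last two then give them cube `1`. -/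
lemma icosahedral_relations {ζ : kˣ} (hζ : IsPrimitiveRoot ζ 5) {s : k} (hs : s ^ 2 = 5) :
    psi ζ * quatJ * psi ζ = quatJ ∧ psi ζ ^ 5 = 1 ∧
    kappa ζ hζ s hs * quatJ = quatJ ^ 3 * kappa ζ hζ s hs ∧ kappa ζ hζ s hs ^ 2 = quatJ ^ 2 ∧
    ((psi ζ ^ 2 * kappa ζ hζ s hs) ^ 3 = 1 ∨ (psi ζ ^ 2 * kappa ζ hζ s hs) ^ 3 = quatJ ^ 2) ∧
    ((quatJ * psi ζ * kappa ζ hζ s hs) ^ 3 = 1 ∨ (quatJ * psi ζ * kappa ζ hζ s hs) ^ 3 = quatJ ^ 2) := by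
  obtain ⟨t1, t2⟩ := kappa_trace hζ hs
  obtain ⟨α, τ, h2, hα, e1, e2, e3, e4⟩ := kappa_apply hζ hs
  obtain ⟨j1, j2, j3, j4⟩ := quatJ_apply (k := k)
  obtain ⟨p1, p2, p3, p4⟩ := psi_apply ζ
  have hinv : (↑ζ⁻¹ : k) = (ζ : k) ^ 4 := by
    rw [← Units.val_pow_eq_pow_val]; congr 1
    rw [inv_eq_iff_mul_eq_one, ← pow_succ', hζ.pow_eq_one]
  have h5 : (ζ : k) ^ 5 = 1 := by rw [← Units.val_pow_eq_pow_val, hζ.pow_eq_one, Units.val_one]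
  rw [e1] at t1
  rw [e2] at t2
  refine ⟨?_, ?_, ?_, ?_, pow_three_eq_of_trace ?_, pow_three_eq_of_trace ?_⟩
  · refine ext_two ?_ ?_ ?_ ?_ <;> simp only [mul_apply_two, j1, j2, j3, j4, p1, p2, p3, p4, hinv] <;>
      first | linear_combination (0 : k) * h5 | linear_combination h5 | linear_combination -h5
  · rw [psi_pow, hζ.pow_eq_one]
    refine ext_two ?_ ?_ ?_ ?_ <;> simp [psi]
  · rw [pow_succ, pow_two]
    refine ext_two ?_ ?_ ?_ ?_ <;> simp only [mul_apply_two, j1, j2, j3, j4, e1, e2, e3, e4] <;> ring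
  · rw [pow_two, pow_two]
    have h6 : α ^ 2 * (1 + τ ^ 2) = -1 := by
      have : 5 * (α ^ 2 * (1 + τ ^ 2)) = 5 * (-1) := by
        linear_combination (1 + τ ^ 2) * hα + (τ - 2) * h2
      exact mul_left_cancel₀ (by norm_num) this
    refine ext_two ?_ ?_ ?_ ?_ <;> simp only [mul_apply_two, j1, j2, j3, j4, e1, e2, e3, e4] <;>
      first | linear_combination h6 | ring
  · refine Eq.trans ?_ t1
    rw [pow_two (psi ζ)]
    simp only [mul_apply_two, e1, e2, e3, e4, p1, p2, p3, p4, hinv]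
    congr 1
    linear_combination (-α * (ζ : k) ^ 3) * h5
  · refine Eq.trans ?_ t2
    simp only [mul_apply_two, j1, j2, j3, j4, e1, e2, e3, e4, p1, p2, p3, p4, hinv]
    congr 1
    ring

theorem uniqueFactorizationMonoid_invariants_binaryIcosahedral {ζ : kˣ} (hζ : IsPrimitiveRoot ζ 5) {s : k}
    (hs : s ^ 2 = 5) : UniqueFactorizationMonoid (invariants (binaryIcosahedral ζ hζ s hs)) := by
  refine uniqueFactorizationMonoid_invariants _ fun χ => ?_
  obtain ⟨r1, r2, r3, r4, r5, r6⟩ := icosahedral_relations hζ hs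
  let P : binaryIcosahedral ζ hζ s hs := ⟨psi ζ, Subgroup.subset_closure (by simp)⟩
  let K : binaryIcosahedral ζ hζ s hs := ⟨kappa ζ hζ s hs, Subgroup.subset_closure (by simp)⟩
  let J : binaryIcosahedral ζ hζ s hs := ⟨quatJ, Subgroup.subset_closure (by simp)⟩
  have hunit : ∀ g, χ g ≠ 0 := fun g h0 => by
    have := map_mul χ g g⁻¹
    rw [mul_inv_cancel, map_one, h0, zero_mul] at this
    exact one_ne_zero this
  have s1 : χ P * χ J * χ P = χ J := by
    rw [← map_mul, ← map_mul]; exact congrArg χ (Subtype.ext r1)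
  have s2 : χ P ^ 5 = 1 := by
    rw [← map_pow, ← map_one χ]; exact congrArg χ (Subtype.ext r2)
  have s3 : χ K * χ J = χ J ^ 3 * χ K := by
    rw [← map_pow, ← map_mul, ← map_mul]; exact congrArg χ (Subtype.ext r3)
  have s4 : χ K ^ 2 = χ J ^ 2 := by
    rw [← map_pow, ← map_pow]; exact congrArg χ (Subtype.ext r4)
  have hJ2 : χ J ^ 2 = 1 := by
    refine mul_left_cancel₀ (mul_ne_zero (hunit K) (hunit J)) ?_
    linear_combination -s3
  have hP2 : χ P ^ 2 = 1 := mul_left_cancel₀ (hunit J) (by linear_combination s1)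
  have hP : χ P = 1 := by linear_combination s2 - χ P * (χ P ^ 2 + 1) * hP2
  have s5 : (χ P ^ 2 * χ K) ^ 3 = 1 := by
    rcases r5 with r | r
    · rw [← map_pow, ← map_mul, ← map_pow, ← map_one χ]; exact congrArg χ (Subtype.ext r)
    · rw [← hJ2, ← map_pow, ← map_mul, ← map_pow, ← map_pow]; exact congrArg χ (Subtype.ext r)
  have s6 : (χ J * χ P * χ K) ^ 3 = 1 := by
    rcases r6 with r | r
    · rw [← map_mul, ← map_mul, ← map_pow, ← map_one χ]; exact congrArg χ (Subtype.ext r)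
    · rw [← hJ2, ← map_mul, ← map_mul, ← map_pow, ← map_pow]; exact congrArg χ (Subtype.ext r)
  have hK : χ K = 1 := by
    rw [hP] at s5
    linear_combination s5 - χ K * (s4.trans hJ2)
  have hJ : χ J = 1 := by
    rw [hP, hK] at s6
    linear_combination s6 - χ J * hJ2
  rintro ⟨h, hh⟩
  change h ∈ Subgroup.closure _ at hh
  induction hh using Subgroup.closure_induction with
  | mem h hh =>
    rcases hh with rfl | rfl | rfl
    · exact hP
    · exact hK
    · exact hJ
  | one => exact map_one χ
  | mul g h hg hh h1 h2 =>
    have := map_mul χ ⟨g, hg⟩ ⟨h, hh⟩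
    rw [h1, h2, one_mul] at this
    exact this
  | inv g hg h1 =>
    have := map_mul χ ⟨g, hg⟩ ⟨g⁻¹, inv_mem hg⟩
    rw [h1, one_mul] at this
    rw [← this, ← map_one χ]
    exact congrArg χ (Subtype.ext (mul_inv_cancel g))

end

end SLTwo

theorem theorem3p3 {k : Type*} [Field k] [IsAlgClosed k] [CharZero k] :
    -- (a)
    (∀ n : ℕ, 2 ≤ n → ∀ ζ : kˣ, IsPrimitiveRoot ζ n →
      SLTwo.invariants (SLTwo.cyclic ζ) =
        Algebra.adjoin k ((SLTwo.hat n (SLTwo.x k ^ n + SLTwo.y k ^ n) : Set (SLTwo.B k)) ∪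
          (SLTwo.hat 2 (SLTwo.x k * SLTwo.y k) : Set (SLTwo.B k)))) ∧
    -- (b)
    (∀ n : ℕ, 3 ≤ n → Odd n → ∀ ζ : kˣ, IsPrimitiveRoot ζ n →
      SLTwo.invariants (SLTwo.cyclic ζ) =
        Algebra.adjoin k (SLTwo.hat n (SLTwo.x k ^ n + SLTwo.y k ^ n) : Set (SLTwo.B k))) ∧
    -- (c)
    (∀ n : ℕ, 3 ≤ n → Odd n → ∀ ζ : kˣ, IsPrimitiveRoot ζ (2 * n) →
      SLTwo.invariants (SLTwo.cyclic ζ) =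
        Algebra.adjoin k (SLTwo.hat (2 * n)
          (SLTwo.x k ^ (2 * n) + (SLTwo.x k * SLTwo.y k) ^ n + SLTwo.y k ^ (2 * n)) :
            Set (SLTwo.B k))) ∧
    -- (d)
    (∀ n : ℕ, 2 ≤ n → ∀ ζ : kˣ, IsPrimitiveRoot ζ (2 * n) →
      SLTwo.invariants (SLTwo.binaryDihedral ζ) =
        Algebra.adjoin k (SLTwo.hat (2 * n) (SLTwo.x k ^ (2 * n) + SLTwo.y k ^ (2 * n)) :
          Set (SLTwo.B k))) ∧
    -- (e)
    (∀ (i : kˣ) (hi : IsPrimitiveRoot i 4),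
      SLTwo.invariants (SLTwo.binaryTetrahedral i hi) =
        Algebra.adjoin k (SLTwo.hat 6
          (SLTwo.x k * SLTwo.y k * (SLTwo.x k ^ 4 - SLTwo.y k ^ 4)) : Set (SLTwo.B k))) ∧
    -- (f)
    (∀ (i : kˣ) (hi : IsPrimitiveRoot i 4) (ζ : kˣ), IsPrimitiveRoot ζ 8 →
      SLTwo.invariants (SLTwo.binaryOctahedral i hi ζ) =
        Algebra.adjoin k (SLTwo.hat 8
          (SLTwo.x k ^ 8 + 14 * SLTwo.x k ^ 4 * SLTwo.y k ^ 4 + SLTwo.y k ^ 8) :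
            Set (SLTwo.B k))) ∧
    -- (g)
    (∀ (ζ : kˣ) (hζ : IsPrimitiveRoot ζ 5) (s : k) (hs : s ^ 2 = 5),
      SLTwo.invariants (SLTwo.binaryIcosahedral ζ hζ s hs) =
        Algebra.adjoin k (SLTwo.hat 12
          (SLTwo.x k * SLTwo.y k *
            (SLTwo.x k ^ 10 + 11 * SLTwo.x k ^ 5 * SLTwo.y k ^ 5 - SLTwo.y k ^ 10)) :
              Set (SLTwo.B k)) ∧
      IsDomain (SLTwo.invariants (SLTwo.binaryIcosahedral ζ hζ s hs)) ∧
      UniqueFactorizationMonoid (SLTwo.invariants (SLTwo.binaryIcosahedral ζ hζ s hs))) := by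
  refine ⟨fun n hn ζ hζ => SLTwo.invariants_cyclic_eq_adjoin_pair hn hζ,
    fun n hn ho ζ hζ => SLTwo.invariants_cyclic_of_odd hn ho hζ,
    fun n hn ho ζ hζ => SLTwo.invariants_cyclic_even_of_odd hn ho hζ,
    fun n hn ζ hζ => SLTwo.invariants_binaryDihedral hn hζ,
    fun i hi => SLTwo.invariants_binaryTetrahedral hi,
    fun i hi ζ hζ => SLTwo.invariants_binaryOctahedral hi hζ,
    fun ζ hζ s hs => ⟨SLTwo.invariants_binaryIcosahedral hζ hs, inferInstance,
      SLTwo.uniqueFactorizationMonoid_invariants_binaryIcosahedral hζ hs⟩⟩
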